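/- Let $\mathbf S^2\subset\mathbf R^3$ be the unit sphere with surface measure $\lambda$, let $Y_{lm}$ ($l\ge 0$, $|m|\le l$) be the standard orthonormal spherical harmonics, $\mu_l=l(l+1)$, and let $P_s$, $s>0$, be the heat semigroup of $\mathbf S^2$, $$P_sf(x)=\int_{\mathbf S^2}\Big(\sum_{l\ge0}\sum_{|m|\le l}e^{-s\mu_l}Y_{lm}(x)Y^*_{lm}(y)\Big)f(y)\,\lambda(dy).$$ Let $M$ be a measure on $(0,\infty)$ with $\int (y\wedge 1)\,M(dy)<\infty$, let $\Psi(\mu)=\int_0^\infty(1-e^{-\mu y})\,M(dy)$, and let $\mathbb D_Mf(x)=\int_0^\infty (P_sf(x)-f(x))\,M(ds)$, with domain the $f\in L^2(\lambda)$ for which $\int_0^\infty\|P_sf-f\|_{L^2(\lambda)}M(ds)<\infty$. On a probability space let $D$ be a driftless subordinator with Lévy measure $M$ (so $\mathbb E e^{-\mu D_t}=e^{-t\Psi(\mu)}$); for every $x\in\mathbf S^2$ let $B^{x}$ be a rotational Brownian motion (the continuous Markov process with transition semigroup $P_s$) started from $x$ and independent of $D$, and let $B^{\Psi,x}_t=B^{x}_{D_t}$.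 Let $T=\{T(x):x\in\mathbf S^2\}$ be a real zero-mean Gaussian random field on $\mathbf S^2$ whose law is invariant under all rotations in $SO(3)$, jointly measurable with respect to $\mathscr B(\mathbf S^2)\otimes\mathcal E$ for some $\sigma$-field $\mathcal E$ of events which, for every $x$, is independent of $(B^{x},D)$. Put $a_{lm}=\int_{\mathbf S^2} T(x)Y^*_{lm}(x)\,\lambda(dx)$, $T_l(x)=\sum_{|m|\le l}a_{lm}Y_{lm}(x)$, and let $\mathfrak F_T$ be the $\sigma$-field generated by $T$. Then there is a Gaussian random field $\eta_t(x)$, $t\ge 0$, $x\in\mathbf S^2$ (jointly Gaussian in $(t,x)$, and jointly measurable in $(x,\omega)$ for every $t$), such that $\eta_0(x)=T(x)$ almost surely for every $x$, and the following hold. 1. Almost surely, $t\mapsto\eta_t$ is the unique solution in $L^2(\lambda)$ of $$(\partial_t-\mathbb D_M)\eta_t=0\quad(t>0),\qquad \eta_0=T,$$ that is, the unique continuous map from $[0,\infty)$ to $L^2(\lambda)$ with value $T$ at $t=0$ that for each $t>0$ takes its value in the domain of $\mathbb D_M$ and is differentiable in $L^2(\lambda)$ with derivative $\mathbb D_M\eta_t$.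 2. $\eta_t(x)=\sum_{l\ge 0}\sum_{|m|\le l}a_{lm}(t)Y_{lm}(x)=\sum_{l\ge0}e^{-t\Psi(\mu_l)}T_l(x)$, where, almost surely, $a_{lm}(t)=\int_{\mathbf S^2}\eta_t(x)Y_{lm}^*(x)\,\lambda(dx)=e^{-t\Psi(\mu_l)}a_{lm}$ for all $t,l,m$, and the series converges in $L^2(dP\otimes\lambda)$: for all $t\ge 0$, $$\lim_{L\to\infty}\mathbb E\Big[\int_{\mathbf S^2}\Big(\eta_t(x)-\sum_{l=0}^Le^{-t\Psi(\mu_l)}T_l(x)\Big)^2\lambda(dx)\Big]=0.$$ 3. For all $t\ge0$ and $x\in\mathbf S^2$, almost surely, $$\eta_t(x)=\mathbb P_tT(x)=\mathbb E\big[T(B^{\Psi,x}_t)\,\big|\,\mathfrak F_T\big],$$ where $\mathbb P_tf(x)=\mathbb E f(B^{\Psi,x}_t)$ is the transition operator of the subordinate Brownian motion, applied to $f=T(\cdot)$ for a fixed realization of $T$; both integrands are integrable. -/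

import Mathlib

open MeasureTheory ProbabilityTheory Filter Topology
open scoped NNReal ENNReal

noncomputable section

namespace SphereField

/-! ### The unit sphere and the spherical harmonics -/

/-- Euclidean three-space. -/
abbrev E3 : Type := EuclideanSpace ℝ (Fin 3)

/-- The unit sphere in Euclidean three-space. -/
abbrev S2 : Type := Metric.sphere (0 : E3) 1

/-- The Lebesgue (surface) measure on the unit sphere; its total mass is `4π`. -/
def lam : Measure S2 := (volume : Measure E3).toSphere

/-- A linear isometry of three-space, acting on the unit sphere. -/
def rotate (g : E3 ≃ₗᵢ[ℝ] E3) (x : S2) : S2 :=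
  ⟨g (x : E3), by
    simp⟩

/-- The Legendre polynomials, by Rodrigues' formula. -/
def legendreQ (l : ℕ) : Polynomial ℝ :=
  Polynomial.C (1 / (2 ^ l * (l.factorial : ℝ))) *
    (Polynomial.derivative)^[l] ((Polynomial.X ^ 2 - 1) ^ l)

/-- The spherical harmonic of degree `l` and order `k ≥ 0`,
`√((2l+1)/(4π) · (l-k)!/(l+k)!) · (-1)^k (1-z²)^(k/2) Q_l^(k)(z) · e^{ikφ}` with `z = cos ϑ`, in
Cartesian coordinates: `z = x 2` and `(1-z²)^(1/2) e^{iφ} = sin ϑ e^{iφ} = x 0 + i x 1`. -/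
def sphHarmNonneg (l k : ℕ) (x : S2) : ℂ :=
  ((Real.sqrt ((2 * l + 1) / (4 * Real.pi) *
        (((l - k).factorial : ℝ) / ((l + k).factorial : ℝ))) *
      ((-1) ^ k * ((Polynomial.derivative)^[k] (legendreQ l)).eval ((x : E3) 2)) : ℝ) : ℂ) *
    (((x : E3) 0 : ℂ) + Complex.I * ((x : E3) 1 : ℂ)) ^ k

/-- The spherical harmonic `Y_{lm}`, `-l ≤ m ≤ l`, with `Y_{l,-m} = (-1)^m conj Y_{lm}`. -/
def sphHarm (l : ℕ) (m : ℤ) (x : S2) : ℂ :=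
  if 0 ≤ m then sphHarmNonneg l m.toNat x
  else (-1) ^ (-m).toNat * (starRingEnd ℂ) (sphHarmNonneg l (-m).toNat x)

/-- The eigenvalues `μ_l = l (l + 1)` of minus the spherical Laplacian. -/
def eigMu (l : ℕ) : ℝ := l * (l + 1)

/-- The Fourier coefficient `f_{lm} = ∫ f(x) conj Y_{lm}(x) λ(dx)`. -/
def coeff (f : S2 → ℝ) (l : ℕ) (m : ℤ) : ℂ :=
  ∫ x, (f x : ℂ) * (starRingEnd ℂ) (sphHarm l m x) ∂lam

/-- The component of degree `l`: `f_l(x) = ∑_{|m| ≤ l} f_{lm} Y_{lm}(x)`. -/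
def component (f : S2 → ℝ) (l : ℕ) (x : S2) : ℂ :=
  ∑ m ∈ Finset.Icc (-(l : ℤ)) (l : ℤ), coeff f l m * sphHarm l m x

/-! ### The heat semigroup and the rotational Brownian motion -/

/-- The transition density of the rotational Brownian motion at time `s > 0`:
`∑_l ∑_{|m| ≤ l} e^{-s μ_l} Y_{lm}(x) conj Y_{lm}(y)`. The sum over `m` is real, since the
terms of order `m` and `-m` are conjugate to each other. -/
def heatKernel (s : ℝ) (x y : S2) : ℝ :=
  ∑' l : ℕ, Real.exp (-s * eigMu l) *
    (∑ m ∈ Finset.Icc (-(l : ℤ)) (l : ℤ),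
      sphHarm l m x * (starRingEnd ℂ) (sphHarm l m y)).re

/-- The heat semigroup `P_s = e^{sΔ}` of the sphere, for `s > 0`. -/
def heatOp (s : ℝ) (f : S2 → ℝ) (x : S2) : ℝ :=
  ∫ y, heatKernel s x y * f y ∂lam

/-- The σ-algebra generated by a family of random variables. -/
@[reducible] def sigmaOf {Ω ι β : Type*} [MeasurableSpace β] (X : ι → Ω → β) : MeasurableSpace Ω :=
  ⨆ i, MeasurableSpace.comap (X i) inferInstance

/-- `B` is a rotational Brownian motion on the unit sphere started from `x`: a continuous process
with `B_0 = x` that is Markov with the transition semigroup `P_t = e^{tΔ}`. -/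
structure IsSphereBM {Ω : Type*} [MeasurableSpace Ω] (P : Measure Ω)
    (B : ℝ≥0 → Ω → S2) (x : S2) : Prop where
  measurable : ∀ t, Measurable (B t)
  continuous : ∀ ω, Continuous fun t => B t ω
  start : ∀ᵐ ω ∂P, B 0 ω = x
  markov : ∀ s t : ℝ≥0, 0 < t → ∀ f : S2 → ℝ, Measurable f → (∃ C, ∀ y, |f y| ≤ C) →
    P[fun ω => f (B (s + t) ω) | sigmaOf fun r : Set.Iic s => B r]
      =ᵐ[P] fun ω => heatOp t f (B s ω)

/-! ### Subordinators without drift and the operator attached to the Lévy measure -/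

/-- `M` is the Lévy measure of a subordinator: it lives on `(0, ∞)` and `∫ (y ∧ 1) M(dy) < ∞`. -/
structure IsSubLevyMeasure (M : Measure ℝ) : Prop where
  null_nonpos : M (Set.Iic 0) = 0
  integrable_min : ∫⁻ y, ENNReal.ofReal (min y 1) ∂M < ∞

/-- The driftless Laplace exponent `Ψ(μ) = ∫_0^∞ (1 - e^{-μ y}) M(dy)`. -/
def laplaceExp (M : Measure ℝ) (μ : ℝ) : ℝ :=
  ∫ y in Set.Ioi 0, (1 - Real.exp (-μ * y)) ∂M

/-- `D` is a driftless subordinator with Lévy measure `M`: a process started from `0` with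
nondecreasing right-continuous paths and independent stationary increments, with
`E exp(-μ D_t) = exp(-t Ψ(μ))`. -/
structure IsSubordinator {Ω : Type*} [MeasurableSpace Ω] (P : Measure Ω)
    (M : Measure ℝ) (D : ℝ≥0 → Ω → ℝ≥0) : Prop where
  measurable : ∀ t, Measurable (D t)
  start : ∀ᵐ ω ∂P, D 0 ω = 0
  mono : ∀ᵐ ω ∂P, Monotone fun t => D t ω
  rightCont : ∀ᵐ ω ∂P, ∀ t, ContinuousWithinAt (fun s => D s ω) (Set.Ici t) t
  indep : HasIndepIncrements (fun t ω => (D t ω : ℝ)) P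
  laplace : ∀ (s t : ℝ≥0) (μ : ℝ), 0 < μ →
    ∫ ω, Real.exp (-μ * ((D (s + t) ω : ℝ) - D s ω)) ∂P
      = Real.exp (-(t : ℝ) * laplaceExp M μ)

/-- The fractional operator `𝔻_M f(x) = ∫_0^∞ (P_s f(x) - f(x)) M(ds)`. -/
def fracOp (M : Measure ℝ) (f : S2 → ℝ) (x : S2) : ℝ :=
  ∫ s in Set.Ioi 0, (heatOp s f x - f x) ∂M

/-- The functions for which the integral defining `𝔻_M f` converges absolutely in `L²(λ)`
(and hence at almost every point of the sphere). -/
def InDomain (M : Measure ℝ) (f : S2 → ℝ) : Prop :=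
  ∫⁻ s in Set.Ioi 0, eLpNorm (fun x => heatOp s f x - f x) 2 lam ∂M < ∞

/-- `u` solves the Cauchy problem `(∂_t - 𝔻_M) u = 0`, `u_0 = f` in `L²(λ)`: it is continuous
on `[0, ∞)` with `u_0 = f`, and for all `t > 0` it takes values in the domain of `𝔻_M` and is
differentiable with derivative `𝔻_M u_t`. -/
structure IsCauchySolution (M : Measure ℝ) (f : S2 → ℝ) (u : ℝ≥0 → Lp ℝ 2 lam) : Prop where
  continuous : Continuous u
  initial : u 0 =ᵐ[lam] f
  inDomain : ∀ t, 0 < t → InDomain M (u t)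
  hasDeriv : ∀ t, 0 < t → ∃ v : Lp ℝ 2 lam, v =ᵐ[lam] fracOp M (u t) ∧
    HasDerivAt (fun s : ℝ => u s.toNNReal) v (t : ℝ)

/-! ### Gaussian random fields on the sphere -/

/-- `T` is a zero-mean isotropic Gaussian random field on the unit sphere. Isotropy: for each
rotation `g`, the fields `x ↦ T (g x)` and `x ↦ T x` have the same law. -/
structure IsIsotropicGaussianField {Ω : Type*} [MeasurableSpace Ω] (P : Measure Ω)
    (T : S2 → Ω → ℝ) : Prop where
  gaussian : IsGaussianProcess T P
  mean_zero : ∀ x, ∫ ω, T x ω ∂P = 0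
  isotropic : ∀ g : E3 ≃ₗᵢ[ℝ] E3, LinearMap.det (g.toLinearEquiv : E3 →ₗ[ℝ] E3) = 1 →
    Measure.map (fun ω x => T (rotate g x) ω) P = Measure.map (fun ω x => T x ω) P

end SphereField

end

open MeasureTheory ProbabilityTheory Filter Topology
open scoped NNReal ENNReal

noncomputable section

namespace SphereField

/-! The solution can be written down at once: `η t x ω` is the average of the path `T(·, ω)` under
the law of `B^x_{D_t}` (`evolve`, `subKer`). Two properties of this averaging give everything.

It is diagonal in the spherical harmonics. These are orthonormal: rotations about the vertical axis
separate the orders, and for equal orders Archimedes' theorem reduces the integral to one of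
associated Legendre functions. The weights `e^{-sμ_l}` beat a crude bound on `Y_lm`, so for `s > 0`
the heat kernel series converges uniformly, is symmetric, and has every `Y_lm` as an eigenfunction.
The remaining facts about the kernel are taken from the Brownian motion: it is nonnegative of mass
one because it is the density of a law, and the harmonics are complete because `P_s h = 0` for any
`h` orthogonal to all of them, while `P_s φ → φ` as `s → 0` by continuity of paths. Mixing over the
independent time `D_t` keeps the kernel reversible for `λ`, so it acts on Fourier coefficients by
the multiplier `E e^{-μ_l D_t} = e^{-tΨ(μ_l)}` (`coeff_evolve`). The operator `𝔻_M` has multiplier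
`-Ψ(μ_l)` (`InDomain.exists_fracOp`), so the Cauchy problem decouples into scalar equations.
Uniqueness follows at once; existence needs estimates uniform in `l`, the delicate one being
membership in the domain for `t > 0` (`inDomain_of_coeffCLM`). Parseval and dominated convergence
give the mean-square expansion.

It is linear in `T`. Isotropy makes `E T(x)²` independent of `x`, and Fubini then places each `η t
x` in the closed linear span of `T` in `L²(P)` (`exists_mem_closedSpan_average`). The elements of
that space are centred Gaussian, which gives joint Gaussianity, and are a.e. equal to
`σ(T)`-measurable variables. Freezing the path identifies `η t x` with the conditional expectation
given `𝓔`, and the tower property replaces `𝓔` by `σ(T)`. -/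

/-! ### Legendre polynomials: differential equation and orthogonality. -/

open Polynomial in
/-- The Legendre-type differential equation satisfied by the derivatives of `(X² - 1)^l`. -/
theorem ode_iterate_derivative (l n : ℕ) :
    (X ^ 2 - 1) * derivative^[n + 2] ((X ^ 2 - 1 : ℝ[X]) ^ l)
      + C (2 * (n + 1 - l : ℝ)) * X * derivative^[n + 1] ((X ^ 2 - 1 : ℝ[X]) ^ l)
      + C ((n + 1) * (n - 2 * l : ℝ)) * derivative^[n] ((X ^ 2 - 1 : ℝ[X]) ^ l) = 0 := by
  set w : ℝ[X] := (X ^ 2 - 1) ^ l with hw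
  -- The first-order equation of `w`; the claim for `n` is its derivative of order `n + 1`.
  have h1 : (X ^ 2 - 1) * derivative w = C (2 * (l : ℝ)) * X * w := by
    rcases l with _ | l
    · simp [hw]
    · rw [hw, derivative_pow]
      simp [show (C 2 : ℝ[X]) = 2 from rfl]
      ring
  have hd : ∀ k, derivative (derivative^[k] w) = derivative^[k + 1] w := fun k => by
    rw [Function.iterate_succ_apply']
  induction n with
  | zero =>
    have := congrArg derivative h1
    simp only [derivative_mul, derivative_sub, derivative_X_pow, derivative_one, derivative_C,
      derivative_X] at this
    simp only [Nat.zero_add, Function.iterate_succ, Function.iterate_zero, Function.comp, id] at *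
    simp only [map_mul, map_add, map_sub, map_natCast, map_one, map_zero, Nat.cast_zero,
      Nat.cast_ofNat, map_ofNat] at *
    linear_combination this
  | succ n ih =>
    have := congrArg derivative ih
    simp only [derivative_add, derivative_mul, derivative_sub, derivative_X_pow, derivative_one,
      derivative_C, derivative_X, hd, derivative_zero] at this
    simp only [map_mul, map_add, map_sub, map_natCast, map_one, Nat.cast_add, Nat.cast_one,
      Nat.cast_ofNat, map_ofNat] at *
    linear_combination this

/-- The moment integrals `∫_{-1}^1 (1 - x²)^k Q_l^{(k)} Q_{l'}^{(k)}`. -/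
def legendreInner (k l l' : ℕ) : ℝ :=
  ∫ x in (-1 : ℝ)..1, (1 - x ^ 2) ^ k *
    (((Polynomial.derivative)^[k] (legendreQ l)).eval x *
      ((Polynomial.derivative)^[k] (legendreQ l')).eval x)

open Polynomial in
theorem iterate_derivative_legendreQ (l k : ℕ) :
    derivative^[k] (legendreQ l) =
      C (1 / (2 ^ l * (l.factorial : ℝ))) * derivative^[l + k] ((X ^ 2 - 1 : ℝ[X]) ^ l) := by
  rw [legendreQ, iterate_derivative_C_mul, ← Function.iterate_add_apply, add_comm]

open Polynomial in
-- By Rodrigues' formula this is `ode_iterate_derivative` at `n = l + k`, rescaled and with the sign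
-- flipped.
theorem ode_legendreQ (l k : ℕ) :
    (1 - X ^ 2) * derivative^[k + 2] (legendreQ l)
      - C (2 * (k + 1 : ℝ)) * X * derivative^[k + 1] (legendreQ l)
      + C ((l + k + 1) * (l - k : ℝ)) * derivative^[k] (legendreQ l) = 0 := by
  simp only [iterate_derivative_legendreQ]
  have := ode_iterate_derivative l (l + k)
  rw [show l + (k + 2) = l + k + 2 by ring, show l + (k + 1) = l + k + 1 by ring]
  simp only [map_mul, map_add, map_sub, map_natCast, map_one, Nat.cast_add,
      map_ofNat] at *
  linear_combination -(C (1 / (2 ^ l * (l.factorial : ℝ)))) * this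

theorem legendreInner_comm (k l l' : ℕ) : legendreInner k l l' = legendreInner k l' l := by
  unfold legendreInner
  congr 1; ext x; ring

/-- In Sturm–Liouville form the Legendre equation reads `((1 - x²)^(k+1) q')' = -(l'+k+1)(l'-k) (1 -
x²)^k q`. Integrating by parts against `p` produces no boundary terms, since `1 - x²` vanishes at
both ends. -/
theorem legendreInner_succ (k l l' : ℕ) :
    legendreInner (k + 1) l l' = (l' + k + 1) * (l' - k : ℝ) * legendreInner k l l' := by
  set p := (Polynomial.derivative)^[k] (legendreQ l)
  set q := (Polynomial.derivative)^[k] (legendreQ l') with hq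
  have hp' : (Polynomial.derivative)^[k + 1] (legendreQ l) = Polynomial.derivative p := by
    rw [Function.iterate_succ_apply']
  have hq' : (Polynomial.derivative)^[k + 1] (legendreQ l') = Polynomial.derivative q := by
    rw [Function.iterate_succ_apply']
  set v : ℝ → ℝ := fun x => (1 - x ^ 2) ^ (k + 1) * (Polynomial.derivative q).eval x with hv
  have hode : ∀ x : ℝ, (1 - x ^ 2) * (Polynomial.derivative (Polynomial.derivative q)).eval x
      - 2 * (k + 1) * x * (Polynomial.derivative q).eval x
      + (l' + k + 1) * (l' - k : ℝ) * q.eval x = 0 := by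
    intro x
    have := congrArg (Polynomial.eval x) (ode_legendreQ l' k)
    rw [show k + 2 = k + 1 + 1 from rfl, Function.iterate_succ_apply', hq', ← hq] at this
    simpa using this
  have hvd : ∀ x : ℝ, HasDerivAt v
      (-((l' + k + 1) * (l' - k : ℝ) * ((1 - x ^ 2) ^ k * q.eval x))) x := by
    intro x
    have h1 : HasDerivAt (fun x : ℝ => (1 - x ^ 2) ^ (k + 1))
        ((k + 1 : ℕ) * (1 - x ^ 2) ^ k * (-(2 * x))) x := by
      have := ((hasDerivAt_pow 2 x).const_sub 1).fun_pow (k + 1)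
      simpa using this
    have h2 := h1.mul ((Polynomial.derivative q).hasDerivAt x)
    refine h2.congr_deriv ?_
    have := hode x
    push_cast
    linear_combination (1 - x ^ 2) ^ k * this
  have hpart := intervalIntegral.integral_mul_deriv_eq_deriv_mul (a := -1) (b := 1)
    (u := v) (v := fun x => p.eval x) (u' := fun x =>
      -((l' + k + 1) * (l' - k : ℝ) * ((1 - x ^ 2) ^ k * q.eval x)))
    (v' := fun x => (Polynomial.derivative p).eval x)
    (fun x _ => hvd x) (fun x _ => p.hasDerivAt x)
    (by apply Continuous.intervalIntegrable; fun_prop)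
    (by apply Continuous.intervalIntegrable; fun_prop)
  have hb : v 1 = 0 ∧ v (-1) = 0 := by constructor <;> simp [hv]
  rw [hb.1, hb.2] at hpart
  unfold legendreInner
  rw [hp', hq', ← intervalIntegral.integral_const_mul]
  calc _ = ∫ x in (-1 : ℝ)..1, v x * (Polynomial.derivative p).eval x := by
        congr 1; ext x; simp only [hv]; ring
    _ = _ := by
        rw [hpart, zero_mul, zero_mul, sub_zero, zero_sub, ← intervalIntegral.integral_neg]
        congr 1; ext x; ring

theorem legendreInner_eq (l l' k : ℕ) (hk : k ≤ l') :
    legendreInner k l l' = ((l' + k).factorial / (l' - k).factorial : ℝ) * legendreInner 0 l l' := by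
  induction k with
  | zero => simp [Nat.factorial_ne_zero]
  | succ k ih =>
    rw [legendreInner_succ, ih (by omega)]
    obtain ⟨d, rfl⟩ : ∃ d, l' = k + 1 + d := ⟨l' - (k + 1), by omega⟩
    rw [show k + 1 + d - k = d + 1 by omega, show k + 1 + d - (k + 1) = d by omega,
      show k + 1 + d + (k + 1) = (k + 1 + d + k) + 1 by ring, Nat.factorial_succ d,
      Nat.factorial_succ (k + 1 + d + k)]
    have := Nat.factorial_ne_zero d
    push_cast
    field_simp
    ring

/-- Symmetry of the integral of order `1` equates `l'(l'+1)` and `l(l+1)` times the integral of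
order `0`, as for distinct eigenvalues of a symmetric operator. -/
theorem legendreInner_zero_of_ne {l l' : ℕ} (h : l ≠ l') : legendreInner 0 l l' = 0 := by
  have h1 := legendreInner_succ 0 l l'
  have h2 := legendreInner_succ 0 l' l
  rw [legendreInner_comm 1 l' l, legendreInner_comm 0 l' l] at h2
  simp only [Nat.cast_zero, add_zero, sub_zero, zero_add] at h1 h2
  rw [h1] at h2
  have h3 : ((l' : ℝ) - l) * (l' + l + 1) * legendreInner 0 l l' = 0 := by linear_combination h2
  have h4 : ((l' : ℝ) - l) ≠ 0 := sub_ne_zero.2 (by exact_mod_cast h.symm)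
  have h5 : ((l' : ℝ) + l + 1) ≠ 0 := by positivity
  simpa [h4, h5] using h3

theorem integral_one_sub_sq_pow (l : ℕ) :
    ∫ x in (-1 : ℝ)..1, (1 - x ^ 2) ^ l =
      2 * 4 ^ l * (l.factorial : ℝ) ^ 2 / (2 * l + 1).factorial := by
  induction l with
  | zero => norm_num
  | succ l ih =>
    -- The integrand is the derivative of `x (1 - x²)^(l+1)`, after writing `x² = 1 - (1 - x²)`.
    have key : ∫ x in (-1 : ℝ)..1, ((2 * l + 3) * (1 - x ^ 2) ^ (l + 1)
        - (2 * l + 2) * (1 - x ^ 2) ^ l) = 0 := by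
      rw [intervalIntegral.integral_eq_sub_of_hasDerivAt
        (f := fun x : ℝ => x * (1 - x ^ 2) ^ (l + 1))]
      · simp
      · intro x _
        have h1 : HasDerivAt (fun x : ℝ => (1 - x ^ 2) ^ (l + 1))
            ((l + 1 : ℕ) * (1 - x ^ 2) ^ l * (-(2 * x))) x := by
          have := ((hasDerivAt_pow 2 x).const_sub 1).fun_pow (l + 1)
          simpa using this
        refine ((hasDerivAt_id x).mul h1).congr_deriv ?_
        push_cast
        simp only [id]
        ring
      · apply Continuous.intervalIntegrable; fun_prop
    rw [intervalIntegral.integral_sub, intervalIntegral.integral_const_mul,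
      intervalIntegral.integral_const_mul, ih] at key
    rotate_left
    · apply Continuous.intervalIntegrable; fun_prop
    · apply Continuous.intervalIntegrable; fun_prop
    rw [show 2 * (l + 1) + 1 = (2 * l + 1) + 1 + 1 by ring, Nat.factorial_succ (2 * l + 1 + 1),
      Nat.factorial_succ (2 * l + 1), Nat.factorial_succ l]
    have h3 : (2 * (l : ℝ) + 3) ≠ 0 := by positivity
    have h4 := Nat.factorial_ne_zero (2 * l + 1)
    have h5 : ∫ x in (-1 : ℝ)..1, (1 - x ^ 2) ^ (l + 1) = (2 * l + 2) *
        (2 * 4 ^ l * (l.factorial : ℝ) ^ 2 / (2 * l + 1).factorial) / (2 * l + 3) := by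
      field_simp at key ⊢
      linear_combination key
    rw [h5]
    push_cast
    field_simp
    ring

open Polynomial in
theorem iterate_derivative_legendreQ_self (l : ℕ) :
    derivative^[l] (legendreQ l) = C (((2 * l).factorial : ℝ) / (2 ^ l * l.factorial)) := by
  rw [iterate_derivative_legendreQ, ← two_mul]
  have hdeg : natDegree ((X ^ 2 - 1 : ℝ[X]) ^ l) = 2 * l := by
    rw [natDegree_pow, show (1 : ℝ[X]) = C 1 by simp, natDegree_X_pow_sub_C]; ring
  have hmon : ((X ^ 2 - 1 : ℝ[X]) ^ l).Monic := by
    apply Monic.pow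
    rw [show (1 : ℝ[X]) = C 1 by simp]
    exact monic_X_pow_sub_C 1 (by norm_num)
  have h0 : natDegree (derivative^[2 * l] ((X ^ 2 - 1 : ℝ[X]) ^ l)) = 0 := by
    have := natDegree_iterate_derivative ((X ^ 2 - 1 : ℝ[X]) ^ l) (2 * l)
    omega
  rw [eq_C_of_natDegree_eq_zero h0, coeff_iterate_derivative, zero_add, Nat.descFactorial_self]
  have : Polynomial.coeff ((X ^ 2 - 1 : ℝ[X]) ^ l) (2 * l) = 1 := by rw [← hdeg]; exact hmon
  rw [this, ← C_mul]
  congr 1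
  simp
  ring

/-- At order `k = l` both derivatives are constants and the integral is that of `(1 - x²)^l`;
`legendreInner_eq` carries the value back to order `0`. -/
theorem legendreInner_zero_self (l : ℕ) : legendreInner 0 l l = 2 / (2 * l + 1) := by
  have h1 := legendreInner_eq l l l le_rfl
  have h2 : legendreInner l l l = (((2 * l).factorial : ℝ) / (2 ^ l * l.factorial)) ^ 2 *
      (2 * 4 ^ l * (l.factorial : ℝ) ^ 2 / (2 * l + 1).factorial) := by
    unfold legendreInner
    rw [← integral_one_sub_sq_pow, ← intervalIntegral.integral_const_mul]
    congr 1; ext x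
    rw [iterate_derivative_legendreQ_self]
    simp
    ring
  rw [h2, Nat.factorial_succ (2 * l), ← two_mul] at h1
  have h3 := Nat.factorial_ne_zero l
  have h4 := Nat.factorial_ne_zero (2 * l)
  have h6 : (4 : ℝ) ^ l = 2 ^ l * 2 ^ l := by rw [← mul_pow]; norm_num
  rw [h6] at h1
  push_cast at h1
  simp only [Nat.sub_self, Nat.factorial_zero, Nat.cast_one, div_one] at h1
  have h7 : (2 * (l : ℝ) + 1) ≠ 0 := by positivity
  field_simp at h1 ⊢
  linear_combination -h1

/-- The integral over `[-1, 1]` of products of associated Legendre functions of equal order. -/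
theorem legendreInner_value (l l' k : ℕ) (hk : k ≤ l') :
    legendreInner k l l' = if l = l' then
      ((l + k).factorial / (l - k).factorial : ℝ) * (2 / (2 * l + 1)) else 0 := by
  rw [legendreInner_eq l l' k hk]
  split_ifs with h
  · subst h; rw [legendreInner_zero_self]
  · rw [legendreInner_zero_of_ne h, mul_zero]

/-! ### A crude bound for the spherical harmonics -/

open Polynomial in
theorem abs_eval_le_sum_abs_coeff {d : ℕ} {p : ℝ[X]} (hp : p.natDegree ≤ d) {z : ℝ}
    (hz : |z| ≤ 1) : |p.eval z| ≤ ∑ i ∈ Finset.range (d + 1), |p.coeff i| := by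
  rw [eval_eq_sum_range' (Nat.lt_succ_of_le hp)]
  refine (Finset.abs_sum_le_sum_abs _ _).trans (Finset.sum_le_sum fun i _ => ?_)
  rw [abs_mul, abs_pow]
  exact mul_le_of_le_one_right (abs_nonneg _) (pow_le_one₀ (abs_nonneg _) hz)

open Polynomial in
-- Differentiation multiplies each coefficient by an exponent at most `d`. The `ℓ¹` norm of the
-- coefficients is used because it dominates the sup norm on `[-1, 1]`.
theorem sum_abs_coeff_derivative_le {d : ℕ} {p : ℝ[X]} (hp : p.natDegree ≤ d) :
    ∑ i ∈ Finset.range (d + 1), |(derivative p).coeff i|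
      ≤ d * ∑ i ∈ Finset.range (d + 1), |p.coeff i| := by
  have h0 : (derivative p).coeff d = 0 := by
    rw [coeff_derivative, coeff_eq_zero_of_natDegree_lt (by omega), zero_mul]
  rw [Finset.sum_range_succ, h0, abs_zero, add_zero, Finset.sum_range_succ', mul_add,
    Finset.mul_sum]
  have h1 : ∑ i ∈ Finset.range d, |(derivative p).coeff i|
      ≤ ∑ i ∈ Finset.range d, (d : ℝ) * |p.coeff (i + 1)| := by
    refine Finset.sum_le_sum fun i hi => ?_
    rw [coeff_derivative, abs_mul, mul_comm]
    gcongr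
    rw [abs_of_nonneg (by positivity)]
    exact_mod_cast Finset.mem_range.1 hi
  have : 0 ≤ (d : ℝ) * |p.coeff 0| := by positivity
  linarith

open Polynomial in
theorem sum_abs_coeff_iterate_derivative_le {d : ℕ} {p : ℝ[X]} (hp : p.natDegree ≤ d) (n : ℕ) :
    ∑ i ∈ Finset.range (d + 1), |(derivative^[n] p).coeff i|
      ≤ d ^ n * ∑ i ∈ Finset.range (d + 1), |p.coeff i| := by
  induction n with
  | zero => simp
  | succ n ih =>
    rw [Function.iterate_succ_apply']
    refine (sum_abs_coeff_derivative_le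
      ((natDegree_iterate_derivative p n).trans ((Nat.sub_le _ _).trans hp))).trans ?_
    rw [pow_succ', mul_assoc]
    gcongr

open Polynomial in
theorem sum_abs_coeff_sq_sub_one_pow_le (l : ℕ) :
    ∑ i ∈ Finset.range (2 * l + 1), |((X ^ 2 - 1 : ℝ[X]) ^ l).coeff i| ≤ 2 ^ l := by
  induction l with
  | zero => simp
  | succ l ih =>
    set p := (X ^ 2 - 1 : ℝ[X]) ^ l with hp
    have hdeg : natDegree p = 2 * l := by
      rw [hp, natDegree_pow, show (1 : ℝ[X]) = C 1 by simp, natDegree_X_pow_sub_C]; ring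
    have h1 : (X ^ 2 - 1 : ℝ[X]) ^ (l + 1) = p * X ^ 2 - p := by rw [pow_succ, hp]; ring
    have h2 : ∑ i ∈ Finset.range (2 * (l + 1) + 1), |(p * X ^ 2).coeff i|
        = ∑ i ∈ Finset.range (2 * l + 1), |p.coeff i| := by
      rw [show 2 * (l + 1) + 1 = (2 * l + 1) + 1 + 1 by ring, Finset.sum_range_succ',
        Finset.sum_range_succ']
      simp [coeff_mul_X_pow']
    have h3 : ∑ i ∈ Finset.range (2 * (l + 1) + 1), |p.coeff i|
        = ∑ i ∈ Finset.range (2 * l + 1), |p.coeff i| := by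
      rw [show 2 * (l + 1) + 1 = (2 * l + 1) + 1 + 1 by ring, Finset.sum_range_succ,
        Finset.sum_range_succ, coeff_eq_zero_of_natDegree_lt (n := 2 * l + 1) (by omega),
        coeff_eq_zero_of_natDegree_lt (n := 2 * l + 1 + 1) (by omega)]
      simp
    calc _ ≤ ∑ i ∈ Finset.range (2 * (l + 1) + 1), (|(p * X ^ 2).coeff i| + |p.coeff i|) := by
          refine Finset.sum_le_sum fun i _ => ?_
          rw [h1, coeff_sub]
          exact abs_sub _ _
      _ ≤ _ := by
          rw [Finset.sum_add_distrib, h2, h3, pow_succ]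
          linarith

open Polynomial in
-- Each of the `l + k` derivatives costs a factor `2l`; the norm `2^l` of `(X² - 1)^l` cancels the
-- `2^l` in Rodrigues' formula, and `1 / l!` is dropped. The Gaussian-type decay of `e^{-s l(l+1)}`
-- tolerates such a crude bound.
theorem abs_eval_iterate_derivative_legendreQ_le (l k : ℕ) {z : ℝ} (hz : |z| ≤ 1) :
    |(derivative^[k] (legendreQ l)).eval z| ≤ (2 * l) ^ (l + k) := by
  have hdeg : natDegree ((X ^ 2 - 1 : ℝ[X]) ^ l) ≤ 2 * l := by
    rw [natDegree_pow, show (1 : ℝ[X]) = C 1 by simp, natDegree_X_pow_sub_C, mul_comm]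
  have h1 := (abs_eval_le_sum_abs_coeff ((natDegree_iterate_derivative _ (l + k)).trans
    ((Nat.sub_le _ _).trans hdeg)) hz).trans
    ((sum_abs_coeff_iterate_derivative_le hdeg (l + k)).trans
      (mul_le_mul_of_nonneg_left (sum_abs_coeff_sq_sub_one_pow_le l) (by positivity)))
  rw [iterate_derivative_legendreQ, eval_mul, eval_C, abs_mul]
  have hf : (1 : ℝ) ≤ l.factorial := by exact_mod_cast Nat.one_le_iff_ne_zero.2 l.factorial_ne_zero
  rw [abs_of_nonneg (by positivity), div_mul_eq_mul_div, one_mul, div_le_iff₀ (by positivity)]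
  push_cast at h1
  refine h1.trans ?_
  gcongr
  exact le_mul_of_one_le_right (by positivity) hf

/-! ### The surface measure: isometry invariance and the law of the height. -/

instance : IsFiniteMeasure lam := inferInstanceAs (IsFiniteMeasure (volume : Measure E3).toSphere)

theorem finrank_E3 : Module.finrank ℝ E3 = 3 := by simp

theorem continuous_rotate (g : E3 ≃ₗᵢ[ℝ] E3) : Continuous (rotate g) := by
  unfold rotate
  fun_prop

theorem rotate_rotate (g h : E3 ≃ₗᵢ[ℝ] E3) (x : S2) : rotate g (rotate h x) = rotate (h.trans g) x :=
  rfl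

/-- The surface measure is invariant under linear isometries. -/
theorem measurePreserving_rotate (g : E3 ≃ₗᵢ[ℝ] E3) : MeasurePreserving (rotate g) lam lam := by
  refine ⟨(continuous_rotate g).measurable, ?_⟩
  ext s hs
  rw [Measure.map_apply (continuous_rotate g).measurable hs]
  unfold lam
  -- The surface measure of a set is a multiple of the volume of the cone over it, and `g` carries
  -- cones to cones preserving volume.
  rw [Measure.toSphere_apply' _ hs, Measure.toSphere_apply' _ ((continuous_rotate g).measurable hs)]
  congr 1
  rw [← g.symm.measurePreserving.measure_preimage_emb g.symm.toMeasurableEquiv.measurableEmbedding]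
  congr 1
  ext v
  simp only [Set.mem_smul, Set.mem_image, Set.mem_preimage]
  constructor
  · rintro ⟨r, hr, _, ⟨y, hy, rfl⟩, hv⟩
    refine ⟨r, hr, _, ⟨_, hy, rfl⟩, ?_⟩
    apply g.symm.injective
    rw [← hv]
    simp [rotate]
  · rintro ⟨r, hr, _, ⟨y, hy, rfl⟩, rfl⟩
    refine ⟨r, hr, _, ⟨rotate g.symm y, ?_, rfl⟩, by simp [rotate]⟩
    rw [rotate_rotate]
    have : rotate (g.symm.trans g) y = y := by ext; simp [rotate]
    rwa [this]

theorem integral_comp_rotate {F : Type*} [NormedAddCommGroup F] [NormedSpace ℝ F]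
    (g : E3 ≃ₗᵢ[ℝ] E3) {f : S2 → F} (hf : Continuous f) :
    ∫ x, f (rotate g x) ∂lam = ∫ x, f x ∂lam := by
  have h := (measurePreserving_rotate g).map_eq
  conv_rhs => rw [← h]
  rw [integral_map (continuous_rotate g).aemeasurable]
  exact hf.aestronglyMeasurable

/-- The half-line Gaussian moments. -/
def gaussMoment (n : ℕ) : ℝ := ∫ r in Set.Ioi (0 : ℝ), r ^ n * Real.exp (-r ^ 2)

theorem gaussMoment_eq (n : ℕ) : gaussMoment n = 1 / 2 * Real.Gamma ((n + 1) / 2) := by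
  have := integral_rpow_mul_exp_neg_rpow (p := 2) (q := n) two_pos
    (by have : (0 : ℝ) ≤ n := n.cast_nonneg
        linarith)
  rw [← this, gaussMoment]
  refine setIntegral_congr_fun measurableSet_Ioi fun r _ => ?_
  simp [Real.rpow_natCast]

theorem gaussMoment_pos (n : ℕ) : 0 < gaussMoment n := by
  rw [gaussMoment_eq]
  have := Real.Gamma_pos_of_pos (s := ((n : ℝ) + 1) / 2) (by positivity)
  positivity

theorem gaussMoment_add_two (n : ℕ) : gaussMoment (n + 2) = (n + 1) / 2 * gaussMoment n := by
  rw [gaussMoment_eq, gaussMoment_eq]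
  have : (((n + 2 : ℕ) : ℝ) + 1) / 2 = (n + 1) / 2 + 1 := by push_cast; ring
  rw [this, Real.Gamma_add_one (by positivity)]
  ring

theorem integral_pow_mul_exp_neg_sq (n : ℕ) :
    ∫ x : ℝ, x ^ n * Real.exp (-x ^ 2) = if Even n then 2 * gaussMoment n else 0 := by
  split_ifs with h
  · have := integral_comp_abs (f := fun r : ℝ => r ^ n * Real.exp (-r ^ 2))
    simpa [h.pow_abs, gaussMoment] using this
  · have h1 := integral_neg_eq_self (fun x : ℝ => x ^ n * Real.exp (-x ^ 2)) volume
    rw [Nat.not_even_iff_odd] at h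
    simp only [h.neg_pow, neg_sq, neg_mul, integral_neg] at h1
    linarith

/-- The Gaussian weight factorises in Cartesian coordinates. Comparison with the same integral in
polar coordinates yields the moments of the height on the sphere. -/
theorem integral_coord_gaussian (n : ℕ) :
    ∫ v : E3, (v 2) ^ n * Real.exp (-‖v‖ ^ 2)
      = Real.pi * (if Even n then 2 * gaussMoment n else 0) := by
  have h1 : ∫ v : E3, (v 2) ^ n * Real.exp (-‖v‖ ^ 2) =
      ∫ w : Fin 3 → ℝ, ∏ i, ((if i = 2 then (w i) ^ n else 1) * Real.exp (-(w i) ^ 2)) := by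
    rw [← (EuclideanSpace.volume_preserving_symm_measurableEquiv_toLp (Fin 3)).integral_comp
      (MeasurableEquiv.measurableEmbedding _)]
    congr 1; ext v
    rw [EuclideanSpace.norm_sq_eq]
    simp [Fin.prod_univ_three, Fin.sum_univ_three, Real.exp_add]
    ring
  rw [h1, integral_fintype_prod_volume_eq_prod
    (fun (i : Fin 3) (t : ℝ) => (if i = 2 then t ^ n else 1) * Real.exp (-t ^ 2))]
  have h2 : ∫ x : ℝ, Real.exp (-x ^ 2) = √Real.pi := by
    have := integral_gaussian 1
    simpa using this
  simp only [Fin.prod_univ_three]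
  simp only [show (0 : Fin 3) ≠ 2 by decide, show (1 : Fin 3) ≠ 2 by decide, if_false, if_true,
    one_mul, h2, integral_pow_mul_exp_neg_sq]
  rw [Real.mul_self_sqrt Real.pi_pos.le]

/-- In polar coordinates `v 2` is the radius times the height; the Jacobian `r²` raises the radial
moment from `n` to `n + 2`. -/
theorem integral_coord_gaussian_polar (n : ℕ) :
    ∫ v : E3, (v 2) ^ n * Real.exp (-‖v‖ ^ 2)
      = (∫ x : S2, ((x : E3) 2) ^ n ∂lam) * gaussMoment (n + 2) := by
  calc
    _ = ∫ v : ({(0)}ᶜ : Set E3), ((v.1 2) ^ n * Real.exp (-‖v.1‖ ^ 2))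
          ∂((volume : Measure E3).comap (↑)) := by
      rw [integral_subtype_comap (measurableSet_singleton _).compl
        fun v : E3 => (v 2) ^ n * Real.exp (-‖v‖ ^ 2), restrict_compl_singleton]
    _ = ∫ q : S2 × Set.Ioi (0 : ℝ), ((q.1 : E3) 2) ^ n * (q.2.1 ^ n * Real.exp (-q.2.1 ^ 2))
          ∂lam.prod (.volumeIoiPow (Module.finrank ℝ E3 - 1)) := by
      rw [lam, ← (volume : Measure E3).measurePreserving_homeomorphUnitSphereProd.integral_comp
        (Homeomorph.measurableEmbedding _)]
      refine integral_congr_ae (Eventually.of_forall fun v => ?_)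
      have hv : ‖v.1‖ ≠ 0 := norm_ne_zero_iff.2 v.2
      simp only [homeomorphUnitSphereProd_apply_fst_coe, homeomorphUnitSphereProd_apply_snd_coe,
        PiLp.smul_apply, smul_eq_mul]
      rw [← mul_assoc, ← mul_pow]
      field_simp
    _ = (∫ x : S2, ((x : E3) 2) ^ n ∂lam) *
          ∫ r : Set.Ioi (0 : ℝ), (r.1 ^ n * Real.exp (-r.1 ^ 2))
            ∂(.volumeIoiPow (Module.finrank ℝ E3 - 1)) :=
      integral_prod_mul (fun x : S2 => ((x : E3) 2) ^ n)
        (fun r : Set.Ioi (0 : ℝ) => r.1 ^ n * Real.exp (-r.1 ^ 2))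
    _ = _ := by
      congr 1
      rw [finrank_E3]
      simp only [Measure.volumeIoiPow, ENNReal.ofReal]
      rw [integral_withDensity_eq_integral_smul,
        integral_subtype_comap measurableSet_Ioi fun a : ℝ =>
          Real.toNNReal (a ^ (3 - 1)) • (a ^ n * Real.exp (-a ^ 2)), gaussMoment]
      · refine setIntegral_congr_fun measurableSet_Ioi fun x hx => ?_
        simp only [NNReal.smul_def, Real.coe_toNNReal _ (pow_nonneg (le_of_lt hx) _), smul_eq_mul]
        ring
      · exact (measurable_subtype_coe.pow_const _).real_toNNReal

theorem integral_height_pow (n : ℕ) :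
    ∫ x : S2, ((x : E3) 2) ^ n ∂lam = 2 * Real.pi * ∫ z in (-1 : ℝ)..1, z ^ n := by
  have h := (integral_coord_gaussian_polar n).symm.trans (integral_coord_gaussian n)
  have hp := gaussMoment_pos n
  rw [gaussMoment_add_two] at h
  rw [integral_pow]
  split_ifs at h with he
  · have h1 : (-1 : ℝ) ^ (n + 1) = -1 := he.add_one.neg_one_pow
    rw [h1]
    have : (n : ℝ) + 1 ≠ 0 := by positivity
    field_simp at h ⊢
    simp only [one_pow]
    linear_combination h
  · have h1 : (-1 : ℝ) ^ (n + 1) = 1 := (Nat.not_even_iff_odd.1 he).add_one.neg_one_pow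
    rw [h1]
    have h3 : ((n : ℝ) + 1) / 2 * gaussMoment n ≠ 0 := by positivity
    rw [mul_zero, mul_eq_zero] at h
    simp [h.resolve_right h3]

theorem integrable_of_continuous {F : Type*} [NormedAddCommGroup F] {f : S2 → F}
    (hf : Continuous f) : Integrable f lam :=
  hf.integrable_of_hasCompactSupport (HasCompactSupport.of_compactSpace f)

/-- Archimedes: the height is uniformly distributed on the sphere. -/
theorem integral_height_polynomial (p : Polynomial ℝ) :
    ∫ x : S2, p.eval ((x : E3) 2) ∂lam = 2 * Real.pi * ∫ z in (-1 : ℝ)..1, p.eval z := by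
  induction p using Polynomial.induction_on' with
  | add p q hp hq =>
    simp only [Polynomial.eval_add]
    rw [integral_add (integrable_of_continuous (by fun_prop))
      (integrable_of_continuous (by fun_prop)), hp, hq, intervalIntegral.integral_add, mul_add]
    · apply Continuous.intervalIntegrable; fun_prop
    · apply Continuous.intervalIntegrable; fun_prop
  | monomial n a =>
    simp only [Polynomial.eval_monomial]
    rw [integral_const_mul, intervalIntegral.integral_const_mul, integral_height_pow]
    ring

/-- The rotation by the angle `θ` about the vertical axis. -/
def rotZ (θ : ℝ) : E3 ≃ₗᵢ[ℝ] E3 :=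
  LinearIsometry.toLinearIsometryEquiv
    { toFun := fun v => !₂[Real.cos θ * v 0 - Real.sin θ * v 1,
        Real.sin θ * v 0 + Real.cos θ * v 1, v 2]
      map_add' := fun v w => by ext i; fin_cases i <;> simp <;> ring
      map_smul' := fun c v => by ext i; fin_cases i <;> simp <;> ring
      norm_map' := fun v => by
        rw [← sq_eq_sq₀ (norm_nonneg _) (norm_nonneg _), EuclideanSpace.norm_sq_eq,
          EuclideanSpace.norm_sq_eq]
        simp [Fin.sum_univ_three]
        linear_combination ((v 0) ^ 2 + (v 1) ^ 2) * Real.sin_sq_add_cos_sq θ } rfl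

theorem rotZ_apply (θ : ℝ) (v : E3) : rotZ θ v = !₂[Real.cos θ * v 0 - Real.sin θ * v 1,
    Real.sin θ * v 0 + Real.cos θ * v 1, v 2] := rfl

/-! ### Orthonormality of the spherical harmonics -/

/-- The real normalised associated Legendre factor of the spherical harmonics. -/
def legendreFactor (l k : ℕ) (z : ℝ) : ℝ :=
  Real.sqrt ((2 * l + 1) / (4 * Real.pi) *
        (((l - k).factorial : ℝ) / ((l + k).factorial : ℝ))) *
      ((-1) ^ k * ((Polynomial.derivative)^[k] (legendreQ l)).eval z)

theorem sphHarmNonneg_eq (l k : ℕ) (x : S2) : sphHarmNonneg l k x =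
    (legendreFactor l k ((x : E3) 2) : ℂ) * (((x : E3) 0 : ℂ) + Complex.I * ((x : E3) 1 : ℂ)) ^ k :=
  rfl

theorem continuous_sphHarmNonneg (l k : ℕ) : Continuous (sphHarmNonneg l k) := by
  unfold sphHarmNonneg
  fun_prop

theorem continuous_sphHarm (l : ℕ) (m : ℤ) : Continuous (sphHarm l m) := by
  unfold sphHarm
  split_ifs
  · exact continuous_sphHarmNonneg _ _
  · exact continuous_const.mul (Complex.continuous_conj.comp (continuous_sphHarmNonneg _ _))

theorem sphHarmNonneg_rotZ (l k : ℕ) (θ : ℝ) (x : S2) :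
    sphHarmNonneg l k (rotate (rotZ θ) x) = Complex.exp (k * θ * Complex.I) * sphHarmNonneg l k x := by
  have h0 : ((rotate (rotZ θ) x : S2) : E3) = rotZ θ x := rfl
  rw [sphHarmNonneg_eq, sphHarmNonneg_eq, h0, rotZ_apply]
  have h1 : ((Real.cos θ * (x : E3) 0 - Real.sin θ * (x : E3) 1 : ℝ) : ℂ) +
      Complex.I * ((Real.sin θ * (x : E3) 0 + Real.cos θ * (x : E3) 1 : ℝ) : ℂ) =
      Complex.exp (θ * Complex.I) * (((x : E3) 0 : ℂ) + Complex.I * ((x : E3) 1 : ℂ)) := by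
    rw [Complex.exp_mul_I]
    push_cast
    linear_combination (-Complex.sin θ * ((x : E3) 1 : ℂ)) * Complex.I_sq
  simp only [Matrix.cons_val_zero, Matrix.cons_val_one, Matrix.cons_val]
  rw [h1, mul_pow, ← Complex.exp_nat_mul]
  ring_nf

theorem sphHarm_rotZ (l : ℕ) (m : ℤ) (θ : ℝ) (x : S2) :
    sphHarm l m (rotate (rotZ θ) x) = Complex.exp (m * θ * Complex.I) * sphHarm l m x := by
  unfold sphHarm
  split_ifs with h
  · rw [sphHarmNonneg_rotZ]
    have : ((m.toNat : ℤ) : ℂ) = m := by rw [Int.toNat_of_nonneg h]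
    rw [Int.cast_natCast] at this
    rw [this]
  · rw [sphHarmNonneg_rotZ, map_mul, ← Complex.exp_conj]
    have : (((-m).toNat : ℤ) : ℂ) = -m := by rw [Int.toNat_of_nonneg (by omega)]; push_cast; ring
    rw [Int.cast_natCast] at this
    simp only [map_mul, Complex.conj_ofReal, Complex.conj_I, this, map_neg, map_intCast]
    ring_nf

theorem sphere_sq_sum (x : S2) : ((x : E3) 0) ^ 2 + ((x : E3) 1) ^ 2 = 1 - ((x : E3) 2) ^ 2 := by
  have h : ‖(x : E3)‖ = 1 := by simp
  have h2 := EuclideanSpace.norm_sq_eq (x : E3)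
  rw [h, Fin.sum_univ_three] at h2
  simp only [Real.norm_eq_abs, sq_abs] at h2
  linarith

theorem abs_height_le (x : S2) : |(x : E3) 2| ≤ 1 := by
  rw [← sq_le_one_iff_abs_le_one]
  nlinarith [sphere_sq_sum x, sq_nonneg ((x : E3) 0), sq_nonneg ((x : E3) 1)]

theorem xy_mul_conj (x : S2) : (((x : E3) 0 : ℂ) + Complex.I * ((x : E3) 1 : ℂ)) *
    (starRingEnd ℂ) (((x : E3) 0 : ℂ) + Complex.I * ((x : E3) 1 : ℂ)) =
      ((1 - ((x : E3) 2) ^ 2 : ℝ) : ℂ) := by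
  rw [← sphere_sq_sum]
  simp only [map_add, map_mul, Complex.conj_ofReal, Complex.conj_I]
  push_cast
  linear_combination (-((x : E3) 1 : ℂ) ^ 2) * Complex.I_sq

/-- For equal orders the phases cancel, leaving `|x 0 + i x 1|^(2k) = (1 - z²)^k`. The integrand is
thus a polynomial in the height, and Archimedes' theorem turns the integral into `legendreInner`. -/
theorem integral_sphHarmNonneg_mul_conj (l l' k : ℕ) (hk : k ≤ l') :
    ∫ x, sphHarmNonneg l k x * (starRingEnd ℂ) (sphHarmNonneg l' k x) ∂lam
      = if l = l' then 1 else 0 := by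
  set c : ℕ → ℝ := fun l => Real.sqrt ((2 * l + 1) / (4 * Real.pi) *
        (((l - k).factorial : ℝ) / ((l + k).factorial : ℝ))) with hc
  set p : ℕ → Polynomial ℝ := fun l => (Polynomial.derivative)^[k] (legendreQ l)
  have h1 : ∀ x : S2, sphHarmNonneg l k x * (starRingEnd ℂ) (sphHarmNonneg l' k x) =
      ((c l * c l' * ((1 - Polynomial.X ^ 2) ^ k * (p l * p l')).eval ((x : E3) 2) : ℝ) : ℂ) := by
    intro x
    rw [sphHarmNonneg_eq, sphHarmNonneg_eq, map_mul, map_pow, Complex.conj_ofReal]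
    calc _ = ((legendreFactor l k ((x : E3) 2) * legendreFactor l' k ((x : E3) 2) : ℝ) : ℂ) *
        ((((x : E3) 0 : ℂ) + Complex.I * ((x : E3) 1 : ℂ)) *
          (starRingEnd ℂ) (((x : E3) 0 : ℂ) + Complex.I * ((x : E3) 1 : ℂ))) ^ k := by
          rw [mul_pow]; push_cast; ring
      _ = _ := by
          rw [xy_mul_conj, ← Complex.ofReal_pow, ← Complex.ofReal_mul]
          congr 1
          have : ((-1 : ℝ) ^ k) * (-1) ^ k = 1 := by rw [← mul_pow]; norm_num
          simp only [legendreFactor, Polynomial.eval_mul, Polynomial.eval_pow, Polynomial.eval_sub,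
            Polynomial.eval_one, Polynomial.eval_X, hc, p]
          linear_combination (c l * c l' * (p l).eval ((x : E3) 2) * (p l').eval ((x : E3) 2) *
            (1 - ((x : E3) 2) ^ 2) ^ k) * this
  rw [integral_congr_ae (Eventually.of_forall h1), integral_complex_ofReal, integral_const_mul, integral_height_polynomial]
  have h2 : ∫ z in (-1 : ℝ)..1, ((1 - Polynomial.X ^ 2) ^ k * (p l * p l')).eval z
      = legendreInner k l l' := by
    simp [legendreInner, p]
  rw [h2, legendreInner_value l l' k hk]
  split_ifs with h
  · subst h
    have h3 : c l * c l = (2 * l + 1) / (4 * Real.pi) *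
        (((l - k).factorial : ℝ) / ((l + k).factorial : ℝ)) :=
      Real.mul_self_sqrt (by positivity)
    rw [h3, ← Complex.ofReal_one]
    congr 1
    have h4 := Nat.factorial_ne_zero (l + k)
    have h5 := Nat.factorial_ne_zero (l - k)
    have h6 := Real.pi_ne_zero
    field_simp
    norm_num
  · simp

/-- The spherical harmonics are orthonormal. -/
theorem integral_sphHarm_mul_conj (l l' : ℕ) (m m' : ℤ) (hm' : |m'| ≤ l') :
    ∫ x, sphHarm l m x * (starRingEnd ℂ) (sphHarm l' m' x) ∂lam
      = if l = l' ∧ m = m' then 1 else 0 := by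
  by_cases hmm : m = m'
  · subst hmm
    simp only [and_true]
    unfold sphHarm
    split_ifs with h1 h2 h2
    · rw [integral_sphHarmNonneg_mul_conj _ _ _ (by rw [abs_of_nonneg h1] at hm'; omega), if_pos h2]
    · rw [integral_sphHarmNonneg_mul_conj _ _ _ (by rw [abs_of_nonneg h1] at hm'; omega), if_neg h2]
    all_goals
      rw [abs_of_neg (by omega)] at hm'
      have h3 := congrArg (starRingEnd ℂ)
        (integral_sphHarmNonneg_mul_conj l l' (-m).toNat (by omega))
      rw [← integral_conj] at h3
      refine Eq.trans ?_ (h3.trans (by simp [h2]))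
      congr 1
      ext x
      have h4 : ((-1 : ℂ) ^ (-m).toNat) * (-1) ^ (-m).toNat = 1 := by rw [← mul_pow]; norm_num
      simp only [map_mul, map_pow, map_neg, map_one, Complex.conj_conj]
      linear_combination ((starRingEnd ℂ) (sphHarmNonneg l (-m).toNat x) *
        sphHarmNonneg l' (-m).toNat x) * h4
  · rw [if_neg (fun h => hmm h.2)]
    have hd : ((m : ℂ) - m') ≠ 0 := sub_ne_zero.2 (by exact_mod_cast hmm)
    -- Rotation by this angle multiplies the integrand by `e^{i(m-m')θ} = -1`, so the integral
    -- equals its own negative.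
    set θ : ℝ := Real.pi / (m - m') with hθ
    have h1 := integral_comp_rotate (rotZ θ)
      (f := fun x => sphHarm l m x * (starRingEnd ℂ) (sphHarm l' m' x))
      ((continuous_sphHarm _ _).mul (Complex.continuous_conj.comp (continuous_sphHarm _ _)))
    have h2 : Complex.exp (m * θ * Complex.I) *
        (starRingEnd ℂ) (Complex.exp (m' * θ * Complex.I)) = -1 := by
      rw [← Complex.exp_conj, ← Complex.exp_add, ← Complex.exp_pi_mul_I]
      congr 1
      simp only [map_mul, Complex.conj_ofReal, Complex.conj_I, map_intCast, hθ]
      push_cast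
      field_simp
      ring
    simp only [sphHarm_rotZ, map_mul] at h1
    rw [← self_eq_neg, ← integral_neg, ← h1]
    congr 1
    ext x
    linear_combination (sphHarm l m x * (starRingEnd ℂ) (sphHarm l' m' x)) * h2

/-! ### Uniform bounds, projection kernels and the heat kernel. -/

/-- A crude bound for the spherical harmonics of degree `l`. -/
def harmBound (l : ℕ) : ℝ := (2 * l + 1) ^ (2 * l + 1)

theorem harmBound_nonneg (l : ℕ) : 0 ≤ harmBound l := by unfold harmBound; positivity

theorem norm_sphHarmNonneg_le (l k : ℕ) (hk : k ≤ l) (x : S2) :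
    ‖sphHarmNonneg l k x‖ ≤ harmBound l := by
  have hxy : ‖(((x : E3) 0 : ℂ) + Complex.I * ((x : E3) 1 : ℂ))‖ ≤ 1 := by
    rw [← sq_le_one_iff₀ (norm_nonneg _), Complex.sq_norm, Complex.normSq_apply]
    simp
    nlinarith [sphere_sq_sum x, sq_nonneg ((x : E3) 2)]
  have hsq : Real.sqrt ((2 * l + 1) / (4 * Real.pi) *
        (((l - k).factorial : ℝ) / ((l + k).factorial : ℝ))) ≤ 2 * l + 1 := by
    rw [Real.sqrt_le_left (by positivity)]
    have h1 : (((l - k).factorial : ℝ) / ((l + k).factorial : ℝ)) ≤ 1 := by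
      rw [div_le_one (by positivity)]
      exact_mod_cast Nat.factorial_le (by omega)
    have h2 : (2 * (l : ℝ) + 1) / (4 * Real.pi) ≤ 2 * l + 1 :=
      div_le_self (by positivity) (by nlinarith [Real.pi_gt_three])
    calc _ ≤ (2 * (l : ℝ) + 1) * 1 := mul_le_mul h2 h1 (by positivity) (by positivity)
      _ ≤ _ := by nlinarith [(Nat.cast_nonneg l : (0 : ℝ) ≤ l)]
  have hpow : ((2 : ℝ) * l) ^ (l + k) ≤ (2 * l + 1) ^ (2 * l) := by
    calc ((2 : ℝ) * l) ^ (l + k) ≤ (2 * l + 1) ^ (l + k) := by gcongr; linarith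
      _ ≤ _ := pow_le_pow_right₀ (by linarith [(Nat.cast_nonneg l : (0 : ℝ) ≤ l)]) (by omega)
  rw [sphHarmNonneg_eq, norm_mul, norm_pow, Complex.norm_real]
  calc _ ≤ ‖legendreFactor l k ((x : E3) 2)‖ * 1 := by
        gcongr
        exact pow_le_one₀ (norm_nonneg _) hxy
    _ ≤ (2 * l + 1) * (2 * l + 1) ^ (2 * l) := by
        rw [mul_one, legendreFactor, norm_mul, Real.norm_of_nonneg (Real.sqrt_nonneg _), norm_mul,
          norm_pow, norm_neg, norm_one, one_pow, one_mul]
        refine mul_le_mul hsq ?_ (norm_nonneg _) (by positivity)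
        exact (abs_eval_iterate_derivative_legendreQ_le l k (abs_height_le x)).trans hpow
    _ = harmBound l := by rw [harmBound, pow_succ']

theorem norm_sphHarm_le {l : ℕ} {m : ℤ} (hm : |m| ≤ l) (x : S2) :
    ‖sphHarm l m x‖ ≤ harmBound l := by
  rw [abs_le] at hm
  unfold sphHarm
  split_ifs with h
  · exact norm_sphHarmNonneg_le l _ (by omega) x
  · rw [norm_mul, norm_pow, norm_neg, norm_one, one_pow, one_mul, RCLike.norm_conj]
    exact norm_sphHarmNonneg_le l _ (by omega) x

theorem sphHarm_neg (l : ℕ) (m : ℤ) (x : S2) :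
    sphHarm l (-m) x = (-1) ^ m.natAbs * (starRingEnd ℂ) (sphHarm l m x) := by
  have h1 : ∀ n : ℕ, ((-1 : ℂ) ^ n) * (-1) ^ n = 1 := fun n => by rw [← mul_pow]; norm_num
  rcases lt_trichotomy m 0 with h | h | h
  · have h2 : m.natAbs = (-m).toNat := by omega
    rw [sphHarm, if_pos (by omega), sphHarm, if_neg (by omega), h2]
    simp only [map_mul, map_pow, map_neg, map_one, Complex.conj_conj]
    linear_combination (-sphHarmNonneg l (-m).toNat x) * h1 (-m).toNat
  · subst h
    simp [sphHarm, sphHarmNonneg]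
  · have h2 : m.natAbs = m.toNat := by omega
    rw [sphHarm, if_neg (by omega), sphHarm, if_pos (by omega), h2, neg_neg]

/-- The projection kernel onto the spherical harmonics of degree `l`. -/
def projKer (l : ℕ) (x y : S2) : ℝ :=
  (∑ m ∈ Finset.Icc (-(l : ℤ)) (l : ℤ), sphHarm l m x * (starRingEnd ℂ) (sphHarm l m y)).re

theorem ofReal_projKer (l : ℕ) (x y : S2) : (projKer l x y : ℂ) =
    ∑ m ∈ Finset.Icc (-(l : ℤ)) (l : ℤ), sphHarm l m x * (starRingEnd ℂ) (sphHarm l m y) := by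
  rw [projKer]
  refine Complex.conj_eq_iff_re.1 ?_
  rw [map_sum]
  refine Finset.sum_nbij' (fun m => -m) (fun m => -m) ?_ ?_ ?_ ?_ ?_
  · intro m hm; rw [Finset.mem_Icc] at hm ⊢; omega
  · intro m hm; rw [Finset.mem_Icc] at hm ⊢; omega
  · intro m _; simp
  · intro m _; simp
  · intro m _
    have h1 : ((-1 : ℂ) ^ m.natAbs) * (-1) ^ m.natAbs = 1 := by rw [← mul_pow]; norm_num
    rw [sphHarm_neg, sphHarm_neg]
    simp only [map_mul, map_pow, map_neg, map_one, Complex.conj_conj]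
    linear_combination (-(starRingEnd ℂ) (sphHarm l m x) * sphHarm l m y) * h1

theorem projKer_comm (l : ℕ) (x y : S2) : projKer l x y = projKer l y x := by
  simp only [projKer, Complex.re_sum]
  refine Finset.sum_congr rfl fun m _ => ?_
  simp
  ring

theorem continuous_projKer (l : ℕ) : Continuous fun p : S2 × S2 => projKer l p.1 p.2 := by
  unfold projKer
  refine Complex.continuous_re.comp (continuous_finsetSum _ fun m _ => ?_)
  exact ((continuous_sphHarm l m).comp continuous_fst).mul
    (Complex.continuous_conj.comp ((continuous_sphHarm l m).comp continuous_snd))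

theorem continuous_projKer_right (l : ℕ) (x : S2) : Continuous fun y : S2 => projKer l x y := by
  have h := (continuous_projKer l).comp (Continuous.prodMk_right x)
  simpa only [Function.comp_def] using h

theorem abs_projKer_le (l : ℕ) (x y : S2) : |projKer l x y| ≤ (2 * l + 1) * harmBound l ^ 2 := by
  refine (Complex.abs_re_le_norm _).trans ((norm_sum_le _ _).trans ?_)
  calc _ ≤ ∑ m ∈ Finset.Icc (-(l : ℤ)) (l : ℤ), harmBound l ^ 2 := by
        refine Finset.sum_le_sum fun m hm => ?_
        have hm' : |m| ≤ (l : ℤ) := abs_le.2 (Finset.mem_Icc.1 hm)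
        rw [norm_mul, RCLike.norm_conj, sq]
        exact mul_le_mul (norm_sphHarm_le hm' x) (norm_sphHarm_le hm' y) (norm_nonneg _)
          (harmBound_nonneg l)
    _ = _ := by
        rw [Finset.sum_const, Int.card_Icc, nsmul_eq_mul]
        congr 1
        rw [show ((l : ℤ) + 1 - -(l : ℤ)).toNat = 2 * l + 1 by omega]
        push_cast; ring

theorem eigMu_nonneg (l : ℕ) : 0 ≤ eigMu l := by unfold eigMu; positivity

theorem summable_heat_bound {s : ℝ} (hs : 0 < s) :
    Summable fun l : ℕ => Real.exp (-s * eigMu l) * ((2 * l + 1) * harmBound l ^ 2) := by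
  -- The term to be summed is `exp(-s l(l+1) + (4l+3) log(2l+1))`, and `4l + 3 ≤ 7l` for `l ≥ 1`, so
  -- this inequality bounds it by `e^{-l}`.
  have hlog : ∀ᶠ l : ℕ in atTop, 7 * Real.log (2 * l + 1) + 1 ≤ s * (l : ℝ) := by
    have h1 : Tendsto (fun l : ℕ => (2 * (l : ℝ) + 1)) atTop atTop :=
      tendsto_atTop_add_const_right _ _
        (tendsto_natCast_atTop_atTop.const_mul_atTop two_pos)
    -- Since `2l + 1 ≤ 3l`, the constant `s / 42` gives `7 log(2l+1) ≤ s l / 2`; the other half of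
    -- `s l` absorbs the `1` once `l ≥ 2 / s`.
    have h2 := (Real.isLittleO_log_id_atTop.comp_tendsto h1).bound
      (show (0 : ℝ) < s / 42 by positivity)
    filter_upwards [h2, eventually_ge_atTop 1, tendsto_natCast_atTop_atTop.eventually_ge_atTop (2 / s)]
      with l hl hl1 hls
    have hl1' : (1 : ℝ) ≤ l := by exact_mod_cast hl1
    rw [div_le_iff₀ hs] at hls
    simp only [Function.comp, id, Real.norm_eq_abs] at hl
    rw [abs_of_nonneg (Real.log_nonneg (by linarith)), abs_of_nonneg (by linarith)] at hl
    nlinarith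
  refine summable_of_isBigO_nat (Real.summable_exp_neg_nat) (Asymptotics.IsBigO.of_bound 1 ?_)
  filter_upwards [hlog, eventually_ge_atTop 1] with l hl hl1
  have hl1' : (1 : ℝ) ≤ l := by exact_mod_cast hl1
  have hpos : (0 : ℝ) < 2 * l + 1 := by positivity
  have h1 : (2 * (l : ℝ) + 1) * harmBound l ^ 2 = Real.exp ((4 * l + 3) * Real.log (2 * l + 1)) := by
    have : (4 * (l : ℝ) + 3) = ((4 * l + 3 : ℕ) : ℝ) := by push_cast; ring
    rw [this, mul_comm (((4 * l + 3 : ℕ) : ℝ)), Real.exp_mul, Real.exp_log hpos, Real.rpow_natCast, harmBound]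
    ring
  rw [h1, ← Real.exp_add, one_mul, Real.norm_of_nonneg (Real.exp_pos _).le,
    Real.norm_of_nonneg (Real.exp_pos _).le, Real.exp_le_exp]
  have hlogn : 0 ≤ Real.log (2 * l + 1) := Real.log_nonneg (by linarith)
  unfold eigMu
  nlinarith

theorem heatKernel_eq (s : ℝ) (x y : S2) :
    heatKernel s x y = ∑' l : ℕ, Real.exp (-s * eigMu l) * projKer l x y := rfl

theorem summable_heatKernel {s : ℝ} (hs : 0 < s) (x y : S2) :
    Summable fun l : ℕ => Real.exp (-s * eigMu l) * projKer l x y := by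
  refine Summable.of_norm_bounded (summable_heat_bound hs) fun l => ?_
  rw [norm_mul, Real.norm_of_nonneg (Real.exp_pos _).le]
  gcongr
  exact abs_projKer_le l x y

theorem heatKernel_comm (s : ℝ) (x y : S2) : heatKernel s x y = heatKernel s y x := by
  simp only [heatKernel_eq, projKer_comm _ x y]

theorem exists_heatKernel_bound {s : ℝ} (hs : 0 < s) : ∃ C, ∀ x y, |heatKernel s x y| ≤ C := by
  refine ⟨∑' l : ℕ, Real.exp (-s * eigMu l) * ((2 * l + 1) * harmBound l ^ 2), fun x y => ?_⟩
  rw [heatKernel_eq, ← Real.norm_eq_abs]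
  refine tsum_of_norm_bounded (summable_heat_bound hs).hasSum fun l => ?_
  rw [norm_mul, Real.norm_of_nonneg (Real.exp_pos _).le]
  gcongr
  exact abs_projKer_le l x y

/-- Joint measurability of the heat kernel at positive times. -/
theorem measurable_heatKernel : Measurable fun p : ℝ × S2 × S2 =>
    if 0 < p.1 then heatKernel p.1 p.2.1 p.2.2 else 0 := by
  have hset : MeasurableSet {p : ℝ × S2 × S2 | 0 < p.1} := measurableSet_lt measurable_const measurable_fst
  refine measurable_of_tendsto_metrizable (f := fun n (p : ℝ × S2 × S2) => if 0 < p.1 then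
    ∑ l ∈ Finset.range n, Real.exp (-p.1 * eigMu l) * projKer l p.2.1 p.2.2 else 0) ?_ ?_
  · intro n
    refine Measurable.ite hset (Finset.measurable_fun_sum _ fun l _ => ?_) measurable_const
    exact (by fun_prop : Measurable fun p : ℝ × S2 × S2 => Real.exp (-p.1 * eigMu l)).mul
      ((continuous_projKer l).measurable.comp measurable_snd)
  · rw [tendsto_pi_nhds]
    intro p
    split_ifs with h
    · exact (summable_heatKernel h _ _).hasSum.tendsto_sum_nat
    · exact tendsto_const_nhds

theorem measurable_heatKernel_right {s : ℝ} (hs : 0 < s) (x : S2) :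
    Measurable fun y => heatKernel s x y := by
  have := measurable_heatKernel.comp (show Measurable fun y : S2 => (s, x, y) by fun_prop)
  simpa [Function.comp_def, hs] using this

theorem measurable_heatKernel_uncurry {s : ℝ} (hs : 0 < s) :
    Measurable fun p : S2 × S2 => heatKernel s p.1 p.2 := by
  have := measurable_heatKernel.comp (show Measurable fun p : S2 × S2 => (s, p) by fun_prop)
  simpa [Function.comp_def, hs] using this

/-- The uniform bound on the terms of the kernel permits termwise integration against any integrable
`F`. In particular `P_s F` depends only on the Fourier coefficients of `F`, which is how
completeness will be proved. -/
theorem hasSum_integral_heatKernel {s : ℝ} (hs : 0 < s) {F : S2 → ℂ} (hF : Integrable F lam) (x : S2) :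
    HasSum (fun l : ℕ => (Real.exp (-s * eigMu l) : ℂ) *
        ∑ m ∈ Finset.Icc (-(l : ℤ)) (l : ℤ),
          (∫ y, F y * (starRingEnd ℂ) (sphHarm l m y) ∂lam) * sphHarm l m x)
      (∫ y, (heatKernel s x y : ℂ) * F y ∂lam) := by
  have hint : ∀ l (m : ℤ), Integrable (fun y => F y * (starRingEnd ℂ) (sphHarm l m y)) lam := by
    intro l m
    obtain ⟨C, hC⟩ := (isCompact_range (continuous_sphHarm l m)).isBounded.exists_norm_le
    refine hF.mul_bdd (c := C) (Complex.continuous_conj.comp (continuous_sphHarm l m)).aestronglyMeasurable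
      (Eventually.of_forall fun y => ?_)
    simpa using hC _ ⟨y, rfl⟩
  have hint' : ∀ l, Integrable (fun y => ((Real.exp (-s * eigMu l) * projKer l x y : ℝ) : ℂ) * F y)
      lam := by
    intro l
    refine hF.bdd_mul (c := Real.exp (-s * eigMu l) * ((2 * l + 1) * harmBound l ^ 2)) ?_
      (Eventually.of_forall fun y => ?_)
    · exact (Complex.continuous_ofReal.comp
        (continuous_const.mul (continuous_projKer_right l x))).aestronglyMeasurable
    · rw [Complex.norm_real, norm_mul, Real.norm_of_nonneg (Real.exp_pos _).le]
      gcongr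
      exact abs_projKer_le l x y
  have key := hasSum_integral_of_summable_integral_norm hint' ?_
  · convert! key using 1
    · ext l
      calc _ = ∫ y, (Real.exp (-s * eigMu l) : ℂ) * ∑ m ∈ Finset.Icc (-(l : ℤ)) (l : ℤ),
            (F y * (starRingEnd ℂ) (sphHarm l m y)) * sphHarm l m x ∂lam := by
            rw [integral_const_mul, integral_finsetSum _ fun m _ => (hint l m).mul_const _]
            simp_rw [integral_mul_const]
        _ = _ := by
            congr 1; ext y
            push_cast
            rw [ofReal_projKer, mul_assoc, Finset.sum_mul]
            congr 1
            exact Finset.sum_congr rfl fun m _ => by ring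
    · congr 1; ext y
      rw [tsum_mul_right, heatKernel_eq, Complex.ofReal_tsum]
  · refine Summable.of_nonneg_of_le (fun l => integral_nonneg fun y => norm_nonneg _)
      (fun l => ?_) ((summable_heat_bound hs).mul_right (∫ y, ‖F y‖ ∂lam))
    rw [← integral_const_mul]
    refine integral_mono (hint' l).norm (hF.norm.const_mul _) fun y => ?_
    simp only [norm_mul, Complex.norm_real, Real.norm_of_nonneg (Real.exp_pos _).le]
    gcongr
    exact abs_projKer_le l x y

/-- The spherical harmonics are eigenfunctions of the heat semigroup. -/
theorem integral_heatKernel_mul_sphHarm {s : ℝ} (hs : 0 < s) (l : ℕ) (m : ℤ) (hm : |m| ≤ l)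
    (x : S2) : ∫ y, (heatKernel s x y : ℂ) * sphHarm l m y ∂lam
      = Real.exp (-s * eigMu l) * sphHarm l m x := by
  refine HasSum.unique (hasSum_integral_heatKernel hs
    (integrable_of_continuous (continuous_sphHarm l m)) x) ?_
  convert! hasSum_single l ?_ using 1
  · congr 1
    rw [Finset.sum_eq_single m]
    · rw [integral_sphHarm_mul_conj _ _ _ _ hm]; simp
    · intro m' hm' hne
      rw [integral_sphHarm_mul_conj _ _ _ _ (abs_le.2 (Finset.mem_Icc.1 hm')), if_neg (by tauto),
        zero_mul]
    · intro h; exact absurd (Finset.mem_Icc.2 (abs_le.1 hm)) h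
  · intro l' hl'
    rw [Finset.sum_eq_zero, mul_zero]
    intro m' hm'
    rw [integral_sphHarm_mul_conj _ _ _ _ (abs_le.2 (Finset.mem_Icc.1 hm')), if_neg (by tauto),
        zero_mul]

/-! ### The transition kernel of the rotational Brownian motion -/

open Classical in
/-- The transition kernel `(s, x) ↦ p_s(x, ·)` of the heat semigroup, with `p_0(x, ·) = δ_x`. -/
def transKer : Kernel (ℝ≥0 × S2) S2 :=
  Kernel.piecewise (s := Prod.fst ⁻¹' {(0 : ℝ≥0)}) (measurable_fst (measurableSet_singleton 0))
    (Kernel.deterministic Prod.snd measurable_snd)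
    (Kernel.withDensity (Kernel.const _ lam)
      fun p y => ENNReal.ofReal (if 0 < (p.1 : ℝ) then heatKernel p.1 p.2 y else 0))

open Classical in
theorem transKer_zero (x : S2) : transKer (0, x) = Measure.dirac x := by
  rw [transKer, Kernel.piecewise_apply, if_pos (by simp), Kernel.deterministic_apply]

open Classical in
theorem transKer_pos {s : ℝ≥0} (hs : 0 < s) (x : S2) :
    transKer (s, x) = lam.withDensity fun y => ENNReal.ofReal (heatKernel s x y) := by
  rw [transKer, Kernel.piecewise_apply, if_neg (by simp [hs.ne']), Kernel.withDensity_apply,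
    Kernel.const_apply]
  · simp [hs]
  · refine ENNReal.measurable_ofReal.comp (measurable_heatKernel.comp
      (g := fun p : ℝ × S2 × S2 => if 0 < p.1 then heatKernel p.1 p.2.1 p.2.2 else 0)
      (f := fun q : (ℝ≥0 × S2) × S2 => ((q.1.1 : ℝ), q.1.2, q.2)) (by fun_prop))

theorem integrable_heatKernel {s : ℝ} (hs : 0 < s) (x : S2) :
    Integrable (fun y => heatKernel s x y) lam := by
  obtain ⟨C, hC⟩ := exists_heatKernel_bound hs
  exact Integrable.of_bound (measurable_heatKernel_right hs x).aestronglyMeasurable C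
    (Eventually.of_forall fun y => hC x y)

section BrownianMotion

variable {Ω : Type*} [mΩ : MeasurableSpace Ω] {P : Measure Ω} [IsProbabilityMeasure P]

theorem sigmaOf_le {ι β : Type*} [MeasurableSpace β] {X : ι → Ω → β} (hX : ∀ i, Measurable (X i)) :
    sigmaOf X ≤ mΩ :=
  iSup_le fun i => (hX i).comap_le

theorem IsSphereBM.integral_comp {B : ℝ≥0 → Ω → S2} {x : S2} (hB : IsSphereBM P B x) {t : ℝ≥0}
    (ht : 0 < t) {f : S2 → ℝ} (hf : Measurable f) (hb : ∃ C, ∀ y, |f y| ≤ C) :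
    ∫ ω, f (B t ω) ∂P = heatOp t f x := by
  have h := hB.markov 0 t ht f hf hb
  rw [zero_add] at h
  have hle : sigmaOf (fun r : Set.Iic (0 : ℝ≥0) => B r) ≤ mΩ := sigmaOf_le fun r => hB.measurable r
  rw [← integral_condExp hle, integral_congr_ae h]
  have : ∀ᵐ ω ∂P, heatOp t f (B 0 ω) = heatOp t f x := by
    filter_upwards [hB.start] with ω hω
    rw [hω]
  rw [integral_congr_ae this]
  simp

theorem IsSphereBM.map_real_apply {B : ℝ≥0 → Ω → S2} {x : S2} (hB : IsSphereBM P B x)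
    {s : ℝ≥0} (hs : 0 < s) {A : Set S2} (hA : MeasurableSet A) :
    (P.map (B s)).real A = ∫ y in A, heatKernel s x y ∂lam := by
  have h := hB.integral_comp hs (f := A.indicator 1) (measurable_one.indicator hA)
    ⟨1, fun y => by by_cases h : y ∈ A <;> simp [h]⟩
  rw [← integral_map (hB.measurable s).aemeasurable (f := A.indicator (1 : S2 → ℝ))
    (measurable_one.indicator hA).aestronglyMeasurable, integral_indicator_one hA] at h
  rw [h, heatOp, ← integral_indicator hA]
  congr 1
  ext y
  by_cases hy : y ∈ A <;> simp [hy]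

/-- Positivity is not visible from the series; it is inherited from the law of `B s`, whose masses
are the integrals of the kernel. Hence the `ENNReal.ofReal` in `transKer` loses nothing almost
everywhere. -/
theorem IsSphereBM.heatKernel_nonneg {B : ℝ≥0 → Ω → S2} {x : S2} (hB : IsSphereBM P B x)
    {s : ℝ≥0} (hs : 0 < s) : ∀ᵐ y ∂lam, 0 ≤ heatKernel s x y := by
  refine ae_nonneg_of_forall_setIntegral_nonneg
    (integrable_heatKernel (NNReal.coe_pos.2 hs) x) fun A hA _ => ?_
  rw [← hB.map_real_apply hs hA]
  exact measureReal_nonneg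

theorem IsSphereBM.map_eq_transKer {B : ℝ≥0 → Ω → S2} {x : S2} (hB : IsSphereBM P B x) (s : ℝ≥0) :
    P.map (B s) = transKer (s, x) := by
  rcases eq_or_ne s 0 with rfl | hs
  · rw [transKer_zero, Measure.map_congr (g := fun _ => x) hB.start, Measure.map_const]
    simp
  have hs : 0 < s := pos_iff_ne_zero.2 hs
  rw [transKer_pos hs]
  have : IsProbabilityMeasure (P.map (B s)) :=
    Measure.isProbabilityMeasure_map (hB.measurable s).aemeasurable
  ext A hA
  rw [withDensity_apply _ hA, ← ofReal_integral_eq_lintegral_ofReal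
    (integrable_heatKernel (NNReal.coe_pos.2 hs) x).integrableOn
    (ae_restrict_of_ae (hB.heatKernel_nonneg hs)), ← hB.map_real_apply hs hA]
  simp

theorem IsSphereBM.isProbabilityMeasure_transKer {B : ℝ≥0 → Ω → S2} {x : S2}
    (hB : IsSphereBM P B x) (s : ℝ≥0) : IsProbabilityMeasure (transKer (s, x)) := by
  rw [← hB.map_eq_transKer]
  exact Measure.isProbabilityMeasure_map (hB.measurable s).aemeasurable

theorem isMarkovKernel_transKer {B : S2 → ℝ≥0 → Ω → S2} (hB : ∀ x, IsSphereBM P (B x) x) :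
    IsMarkovKernel transKer :=
  ⟨fun p => (hB p.2).isProbabilityMeasure_transKer p.1⟩

theorem IsSphereBM.integral_transKer {B : ℝ≥0 → Ω → S2} {x : S2} (hB : IsSphereBM P B x)
    {s : ℝ≥0} (hs : 0 < s) {F : Type*} [NormedAddCommGroup F] [NormedSpace ℝ F] (f : S2 → F) :
    ∫ y, f y ∂(transKer (s, x)) = ∫ y, heatKernel s x y • f y ∂lam := by
  rw [transKer_pos hs, integral_withDensity_eq_integral_toReal_smul
    (measurable_heatKernel_right (NNReal.coe_pos.2 hs) x).ennreal_ofReal (by simp)]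
  refine integral_congr_ae ?_
  filter_upwards [hB.heatKernel_nonneg hs] with y hy
  rw [ENNReal.toReal_ofReal hy]

theorem IsSphereBM.heatOp_eq {B : ℝ≥0 → Ω → S2} {x : S2} (hB : IsSphereBM P B x)
    {s : ℝ≥0} (hs : 0 < s) (f : S2 → ℝ) : heatOp s f x = ∫ y, f y ∂(transKer (s, x)) := by
  rw [hB.integral_transKer hs]; rfl

theorem IsSphereBM.integral_sphHarm_transKer {B : ℝ≥0 → Ω → S2} {x : S2} (hB : IsSphereBM P B x)
    (s : ℝ≥0) {l : ℕ} {m : ℤ} (hm : |m| ≤ l) :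
    ∫ y, sphHarm l m y ∂(transKer (s, x)) = Real.exp (-s * eigMu l) * sphHarm l m x := by
  rcases eq_or_ne s 0 with rfl | hs
  · rw [transKer_zero, integral_dirac]; simp
  have hs : 0 < s := pos_iff_ne_zero.2 hs
  rw [hB.integral_transKer hs, ← integral_heatKernel_mul_sphHarm (NNReal.coe_pos.2 hs) l m hm]
  rfl

/-- Continuity of the heat semigroup at time zero. -/
theorem IsSphereBM.tendsto_integral_transKer {B : ℝ≥0 → Ω → S2} {x : S2} (hB : IsSphereBM P B x)
    {φ : S2 → ℂ} (hφ : Continuous φ) :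
    Tendsto (fun s : ℝ≥0 => ∫ y, φ y ∂(transKer (s, x))) (𝓝 0) (𝓝 (φ x)) := by
  obtain ⟨C, hC⟩ := (isCompact_range hφ).isBounded.exists_norm_le
  have h1 : ∀ s, ∫ y, φ y ∂(transKer (s, x)) = ∫ ω, φ (B s ω) ∂P := fun s => by
    rw [← hB.map_eq_transKer, integral_map (hB.measurable s).aemeasurable
      hφ.aestronglyMeasurable]
  have h2 : φ x = ∫ ω, φ (B 0 ω) ∂P := by
    rw [← h1, transKer_zero, integral_dirac]
  simp_rw [h1]
  rw [h2]
  refine tendsto_integral_filter_of_dominated_convergence (fun _ => C) ?_ ?_ (integrable_const C) ?_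
  · exact Eventually.of_forall fun s => (hφ.measurable.comp (hB.measurable s)).aestronglyMeasurable
  · exact Eventually.of_forall fun s => Eventually.of_forall fun ω => hC _ ⟨_, rfl⟩
  · exact Eventually.of_forall fun ω => (hφ.comp (hB.continuous ω)).tendsto 0

/-- The spherical harmonics form a complete system. -/
theorem integral_mul_eq_zero_of_coeff {B : S2 → ℝ≥0 → Ω → S2} (hB : ∀ x, IsSphereBM P (B x) x)
    {h : S2 → ℂ} (hh : Integrable h lam)
    (h0 : ∀ (l : ℕ) (m : ℤ), |m| ≤ l → ∫ y, h y * (starRingEnd ℂ) (sphHarm l m y) ∂lam = 0)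
    {φ : S2 → ℂ} (hφ : Continuous φ) : ∫ x, h x * φ x ∂lam = 0 := by
  obtain ⟨C, hC⟩ := (isCompact_range hφ).isBounded.exists_norm_le
  -- All coefficients of `h` vanish, so `P_s h = 0`; symmetry of the kernel moves `P_s` onto `φ`.
  -- Letting `s → 0`, where `P_s φ → φ` by continuity of the Brownian paths, gives the claim.
  have h1 : ∀ s : ℝ≥0, 0 < s → ∫ x, h x * ∫ y, φ y ∂(transKer (s, x)) ∂lam = 0 := by
    intro s hs
    have h2 : ∀ x, ∫ y, (heatKernel s x y : ℂ) * h y ∂lam = 0 := by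
      intro x
      refine (hasSum_integral_heatKernel hs hh x).unique ?_
      convert! hasSum_zero with l
      rw [Finset.sum_eq_zero, mul_zero]
      intro m hm
      rw [h0 l m (abs_le.2 (Finset.mem_Icc.1 hm)), zero_mul]
    obtain ⟨K, hK⟩ := exists_heatKernel_bound (show (0 : ℝ) < s from hs)
    have hprod : Integrable (fun p : S2 × S2 => h p.1 * ((heatKernel s p.1 p.2 : ℂ) * φ p.2))
        (lam.prod lam) := by
      refine (hh.comp_fst lam).mul_bdd (c := K * C) ?_ (Eventually.of_forall fun p => ?_)
      · exact ((Complex.measurable_ofReal.comp (measurable_heatKernel_uncurry hs)).mul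
          (hφ.measurable.comp measurable_snd)).aestronglyMeasurable
      · rw [norm_mul, Complex.norm_real]
        exact mul_le_mul (hK _ _) (hC _ ⟨_, rfl⟩) (norm_nonneg _) ((abs_nonneg _).trans (hK p.1 p.2))
    calc ∫ x, h x * ∫ y, φ y ∂(transKer (s, x)) ∂lam
        = ∫ x, ∫ y, h x * ((heatKernel s x y : ℂ) * φ y) ∂lam ∂lam := by
          congr 1; ext x
          rw [(hB x).integral_transKer hs, ← integral_const_mul]
          rfl
      _ = ∫ y, ∫ x, h x * ((heatKernel s x y : ℂ) * φ y) ∂lam ∂lam :=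
          integral_integral_swap hprod
      _ = ∫ y, φ y * ∫ x, (heatKernel s y x : ℂ) * h x ∂lam ∂lam := by
          congr 1; ext y
          rw [← integral_const_mul]
          congr 1; ext x
          rw [heatKernel_comm s x y]
          ring
      _ = 0 := by simp [h2]
  have h3 : Tendsto (fun s : ℝ≥0 => ∫ x, h x * ∫ y, φ y ∂(transKer (s, x)) ∂lam) (𝓝[>] 0)
      (𝓝 (∫ x, h x * φ x ∂lam)) := by
    have : IsMarkovKernel transKer := isMarkovKernel_transKer hB
    refine tendsto_integral_filter_of_dominated_convergence (fun x => ‖h x‖ * C) ?_ ?_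
      (hh.norm.mul_const C) ?_
    · refine Eventually.of_forall fun s => hh.aestronglyMeasurable.mul ?_
      have : StronglyMeasurable fun p : ℝ≥0 × S2 => ∫ y, φ y ∂(transKer p) :=
        hφ.stronglyMeasurable.integral_kernel
      exact (this.comp_measurable measurable_prodMk_left).aestronglyMeasurable
    · refine Eventually.of_forall fun s => Eventually.of_forall fun x => ?_
      rw [norm_mul]
      gcongr
      refine (norm_integral_le_of_norm_le_const
        (Eventually.of_forall fun y => hC (φ y) ⟨_, rfl⟩)).trans ?_
      simp
    · exact Eventually.of_forall fun x =>
        (((hB x).tendsto_integral_transKer hφ).mono_left nhdsWithin_le_nhds).const_mul _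
  refine tendsto_nhds_unique h3 (tendsto_const_nhds.congr' ?_)
  filter_upwards [self_mem_nhdsWithin] with s hs
  exact (h1 s hs).symm

end BrownianMotion

/-! ### Parseval's identity -/

/-- The indices `(l, m)`, `|m| ≤ l`, of the spherical harmonics. -/
abbrev HarmIdx : Type := Σ l : ℕ, Finset.Icc (-(l : ℤ)) (l : ℤ)

theorem HarmIdx.abs_le (i : HarmIdx) : |(i.2 : ℤ)| ≤ i.1 := _root_.abs_le.2 (Finset.mem_Icc.1 i.2.2)

theorem memLp_of_continuous {F : Type*} [NormedAddCommGroup F] {f : S2 → F} (hf : Continuous f)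
    (p : ℝ≥0∞) : MemLp f p lam := by
  obtain ⟨C, hC⟩ := (isCompact_range hf).isBounded.exists_norm_le
  exact MemLp.of_bound (hf.stronglyMeasurable_of_hasCompactSupport
    (HasCompactSupport.of_compactSpace f)).aestronglyMeasurable C
    (Eventually.of_forall fun x => hC _ ⟨x, rfl⟩)

/-- The spherical harmonics as elements of `L²`. -/
def harmLp (i : HarmIdx) : Lp ℂ 2 lam :=
  (memLp_of_continuous (continuous_sphHarm i.1 i.2) 2).toLp _

theorem inner_harmLp (i : HarmIdx) {F : S2 → ℂ} (hF : MemLp F 2 lam) :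
    inner ℂ (harmLp i) (hF.toLp F) = ∫ x, F x * (starRingEnd ℂ) (sphHarm i.1 i.2 x) ∂lam := by
  rw [L2.inner_def]
  refine integral_congr_ae ?_
  filter_upwards [hF.coeFn_toLp,
    (memLp_of_continuous (continuous_sphHarm i.1 i.2) 2).coeFn_toLp] with x h1 h2
  rw [h1, harmLp, h2]
  simp

theorem orthonormal_harmLp : Orthonormal ℂ harmLp := by
  classical
  rw [orthonormal_iff_ite]
  intro i j
  rw [show harmLp j = (memLp_of_continuous (continuous_sphHarm j.1 j.2) 2).toLp _ from rfl,
    inner_harmLp, integral_sphHarm_mul_conj _ _ _ _ i.abs_le]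
  by_cases h : i = j
  · subst h; simp
  · rw [if_neg h, if_neg]
    rintro ⟨h1, h2⟩
    obtain ⟨l, m⟩ := i
    obtain ⟨l', m'⟩ := j
    dsimp only at h1
    subst h1
    exact h (congrArg (Sigma.mk _) (Subtype.ext h2.symm))

section BrownianMotion

variable {Ω : Type*} [mΩ : MeasurableSpace Ω] {P : Measure Ω} [IsProbabilityMeasure P]
  {B : S2 → ℝ≥0 → Ω → S2}

/-- A vector orthogonal to all harmonics pairs to zero with every continuous function, and these are
dense in `L²`. -/
theorem orthogonal_span_harmLp (hB : ∀ x, IsSphereBM P (B x) x) :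
    (Submodule.span ℂ (Set.range harmLp))ᗮ = ⊥ := by
  rw [Submodule.eq_bot_iff]
  intro h hh
  have hmem : MemLp (h : S2 → ℂ) 2 lam := Lp.memLp h
  have h0 : ∀ (l : ℕ) (m : ℤ), |m| ≤ l →
      ∫ y, h y * (starRingEnd ℂ) (sphHarm l m y) ∂lam = 0 := by
    intro l m hm
    have := hh (harmLp ⟨l, m, Finset.mem_Icc.2 (_root_.abs_le.1 hm)⟩)
      (Submodule.subset_span ⟨_, rfl⟩)
    rwa [← Lp.toLp_coeFn h hmem, inner_harmLp] at this
  refine (ContinuousMap.toLp_denseRange ℂ lam ℂ (p := 2) (by simp)).eq_zero_of_inner_right ℂ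
    fun φ => ?_
  have h1 := integral_mul_eq_zero_of_coeff hB (hmem.integrable (by simp)) h0
    (Complex.continuous_conj.comp φ.continuous)
  rw [L2.inner_def, ← h1]
  refine integral_congr_ae ?_
  filter_upwards [ContinuousMap.coeFn_toLp (p := 2) (𝕜 := ℂ) lam φ] with x hx
  rw [hx]
  simp

theorem hasSum_norm_sq_integral_conj (hB : ∀ x, IsSphereBM P (B x) x)
    {F : S2 → ℂ} (hF : MemLp F 2 lam) :
    HasSum (fun i : HarmIdx => ‖∫ x, F x * (starRingEnd ℂ) (sphHarm i.1 i.2 x) ∂lam‖ ^ 2)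
      (∫ x, ‖F x‖ ^ 2 ∂lam) := by
  set b := HilbertBasis.mkOfOrthogonalEqBot orthonormal_harmLp (orthogonal_span_harmLp hB)
  have h := b.hasSum_inner_mul_inner (hF.toLp F) (hF.toLp F)
  rw [← Complex.hasSum_ofReal]
  convert! h using 1
  · ext i
    rw [show b i = harmLp i by simp [b], ← inner_conj_symm, inner_harmLp, mul_comm,
      Complex.mul_conj, Complex.normSq_eq_norm_sq]
  · rw [L2.inner_def, ← integral_complex_ofReal]
    refine integral_congr_ae ?_
    filter_upwards [hF.coeFn_toLp] with x h1
    rw [h1, inner_self_eq_norm_sq_to_K]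
    norm_cast

/-- Parseval's identity. -/
theorem hasSum_norm_sq_coeff (hB : ∀ x, IsSphereBM P (B x) x)
    {f : S2 → ℝ} (hf : MemLp f 2 lam) :
    HasSum (fun i : HarmIdx => ‖coeff f i.1 i.2‖ ^ 2) (∫ x, f x ^ 2 ∂lam) := by
  convert! hasSum_norm_sq_integral_conj hB hf.ofReal using 1
  congr 1; ext x
  simp

/-- The truncation error of the expansion in spherical harmonics. -/
theorem hasSum_norm_sq_coeff_tail (hB : ∀ x, IsSphereBM P (B x) x)
    {f : S2 → ℝ} (hf : MemLp f 2 lam) (N : ℕ) :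
    HasSum (fun i : HarmIdx => if i.1 < N then 0 else ‖coeff f i.1 i.2‖ ^ 2)
      (∫ x, ‖(f x : ℂ) - ∑ l ∈ Finset.range N, component f l x‖ ^ 2 ∂lam) := by
  have hcont : Continuous fun x => ∑ l ∈ Finset.range N, component f l x := by
    unfold component
    exact continuous_finsetSum _ fun l _ => continuous_finsetSum _ fun m _ =>
      continuous_const.mul (continuous_sphHarm l m)
  have hint : ∀ (l : ℕ) (m : ℤ), Integrable (fun x => (f x : ℂ) * (starRingEnd ℂ) (sphHarm l m x)) lam :=
    fun l m => MemLp.integrable_mul (p := 2) (q := 2) hf.ofReal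
      (memLp_of_continuous (Complex.continuous_conj.comp (continuous_sphHarm l m)) 2)
  convert! hasSum_norm_sq_integral_conj hB (hf.ofReal.sub (memLp_of_continuous hcont 2)) using 1
  ext i
  have h1 : ∫ x, (∑ l ∈ Finset.range N, component f l x) *
      (starRingEnd ℂ) (sphHarm i.1 i.2 x) ∂lam = if i.1 < N then coeff f i.1 i.2 else 0 := by
    calc _ = ∫ x, ∑ l ∈ Finset.range N, ∑ m ∈ Finset.Icc (-(l : ℤ)) (l : ℤ), coeff f l m *
          (sphHarm l m x * (starRingEnd ℂ) (sphHarm i.1 i.2 x)) ∂lam := by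
          congr 1; ext x
          simp_rw [component, Finset.sum_mul, mul_assoc]
      _ = ∑ l ∈ Finset.range N, ∑ m ∈ Finset.Icc (-(l : ℤ)) (l : ℤ), coeff f l m *
          (if l = i.1 ∧ m = i.2 then 1 else 0) := by
          have hi : ∀ (l : ℕ) (m : ℤ), Integrable (fun x => coeff f l m *
            (sphHarm l m x * (starRingEnd ℂ) (sphHarm i.1 i.2 x))) lam := fun l m =>
            integrable_of_continuous (continuous_const.mul ((continuous_sphHarm l m).mul
              (Complex.continuous_conj.comp (continuous_sphHarm _ _))))
          rw [integral_finsetSum _ fun l _ => integrable_finsetSum _ fun m _ => hi l m]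
          refine Finset.sum_congr rfl fun l _ => ?_
          rw [integral_finsetSum _ fun m _ => hi l m]
          refine Finset.sum_congr rfl fun m _ => ?_
          rw [integral_const_mul, integral_sphHarm_mul_conj _ _ _ _ i.abs_le]
      _ = _ := by
          split_ifs with h
          · rw [Finset.sum_eq_single i.1, Finset.sum_eq_single (i.2 : ℤ)]
            · simp
            · intro m _ hm; simp [hm]
            · intro hm; exact absurd i.2.2 hm
            · intro l _ hl; simp [hl]
            · intro hl; exact absurd (Finset.mem_range.2 h) hl
          · refine Finset.sum_eq_zero fun l hl => Finset.sum_eq_zero fun m _ => ?_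
            rw [if_neg, mul_zero]
            rintro ⟨rfl, -⟩
            exact h (Finset.mem_range.1 hl)
  have h2 : ∫ x, ((fun x => (f x : ℂ)) - fun x => ∑ l ∈ Finset.range N, component f l x) x *
      (starRingEnd ℂ) (sphHarm i.1 i.2 x) ∂lam =
      coeff f i.1 i.2 - if i.1 < N then coeff f i.1 i.2 else 0 := by
    rw [← h1, coeff, ← integral_sub (hint _ _)]
    · congr 1; ext x
      simp [sub_mul]
    · exact integrable_of_continuous (hcont.mul
        (Complex.continuous_conj.comp (continuous_sphHarm _ _)))
  refine Eq.trans ?_ (congrArg (fun z => ‖z‖ ^ 2) h2).symm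
  split_ifs <;> simp

end BrownianMotion

/-! ### Reversible kernels -/

section Reversible

variable {α : Type*} [MeasurableSpace α] {π : Measure α} {κ : Kernel α α} [IsMarkovKernel κ]

/-- Reversibility states this on rectangles, which determine a finite measure on the product. -/
theorem map_swap_compProd_of_isReversible [IsFiniteMeasure π] (h : κ.IsReversible π) :
    (π ⊗ₘ κ).map Prod.swap = π ⊗ₘ κ := by
  refine Measure.ext_prod fun {A B} hA hB => ?_
  rw [Measure.map_apply measurable_swap (hA.prod hB), Set.preimage_swap_prod,
    Measure.compProd_apply_prod hB hA, Measure.compProd_apply_prod hA hB, h hA hB]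

theorem lintegral_lintegral_of_isReversible (h : κ.IsReversible π) {f : α → ℝ≥0∞}
    (hf : Measurable f) : ∫⁻ x, ∫⁻ y, f y ∂κ x ∂π = ∫⁻ x, f x ∂π := by
  have h1 := Measure.lintegral_bind (m := π) (μ := κ) κ.aemeasurable hf.aemeasurable
  rw [← h1]
  congr 1
  exact h.invariant

theorem ae_memLp_of_isReversible (h : κ.IsReversible π) {f : α → ℝ} (hf : Measurable f)
    (hf2 : MemLp f 2 π) : ∀ᵐ x ∂π, MemLp f 2 (κ x) := by
  have h1 := lintegral_lintegral_of_isReversible h (f := fun y => ‖f y‖ₑ ^ 2) (by fun_prop)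
  have h2 : ∫⁻ x, ‖f x‖ₑ ^ 2 ∂π < ∞ := by
    have := (memLp_two_iff_integrable_sq hf.aestronglyMeasurable).1 hf2
    simpa [HasFiniteIntegral, enorm_pow] using this.2
  rw [← h1] at h2
  filter_upwards [ae_lt_top (Measurable.lintegral_kernel (by fun_prop)) h2.ne] with x hx
  refine (memLp_two_iff_integrable_sq hf.aestronglyMeasurable).2
    ⟨(by fun_prop : Measurable fun y => f y ^ 2).aestronglyMeasurable, ?_⟩
  simpa [HasFiniteIntegral, enorm_pow] using hx

theorem sq_integral_le {ν : Measure α} [IsProbabilityMeasure ν] {f : α → ℝ} (hf : MemLp f 2 ν) :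
    (∫ y, f y ∂ν) ^ 2 ≤ ∫ y, f y ^ 2 ∂ν := by
  have h1 := hf.integrable (by norm_num)
  have h2 := hf.integrable_sq
  set c := ∫ y, f y ∂ν with hc
  have h3 : 0 ≤ ∫ y, (f y - c) ^ 2 ∂ν := integral_nonneg fun y => sq_nonneg _
  have h4 : ∫ y, (f y - c) ^ 2 ∂ν = ∫ y, (f y ^ 2 - (2 * c) * f y + c ^ 2) ∂ν := by
    congr 1; ext y; ring
  have h5 : Integrable (fun y => f y ^ 2 - (2 * c) * f y) ν := h2.sub (h1.const_mul _)
  rw [h4, integral_add h5 (integrable_const _),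
    integral_sub h2 (h1.const_mul _), integral_const_mul, ← hc] at h3
  simp at h3
  nlinarith

/-- Jensen's inequality for `κ x`, integrated with the invariance of `π`. It applies only for
`π`-a.e. `x`, where `f` is square integrable under `κ x`; the default value of the integral
elsewhere does no harm. -/
theorem memLp_integral_kernel (h : κ.IsReversible π) {f : α → ℝ} (hf : Measurable f)
    (hf2 : MemLp f 2 π) : MemLp (fun x => ∫ y, f y ∂κ x) 2 π := by
  have hm : StronglyMeasurable fun x => ∫ y, f y ∂κ x :=
    hf.stronglyMeasurable.integral_kernel
  refine (memLp_two_iff_integrable_sq hm.aestronglyMeasurable).2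
    ⟨(hm.pow 2).aestronglyMeasurable, ?_⟩
  have h2 : ∫⁻ x, ‖f x ^ 2‖ₑ ∂π < ∞ :=
    ((memLp_two_iff_integrable_sq hf.aestronglyMeasurable).1 hf2).2
  rw [← lintegral_lintegral_of_isReversible h (f := fun y => ‖f y ^ 2‖ₑ) (by fun_prop)] at h2
  refine lt_of_le_of_lt (lintegral_mono_ae ?_) h2
  filter_upwards [ae_memLp_of_isReversible h hf hf2] with x hx
  rw [← ofReal_norm, Real.norm_of_nonneg (sq_nonneg _)]
  refine (ENNReal.ofReal_le_ofReal (sq_integral_le hx)).trans ?_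
  rw [ofReal_integral_eq_lintegral_ofReal hx.integrable_sq (Eventually.of_forall fun _ => sq_nonneg _)]
  refine lintegral_mono fun y => ?_
  rw [← ofReal_norm]
  exact ENNReal.ofReal_le_ofReal (le_abs_self _)

/-- A reversible kernel acts as a symmetric operator. -/
theorem integral_mul_integral_kernel [IsFiniteMeasure π] (h : κ.IsReversible π) {f : α → ℂ} (hf : Measurable f)
    (hfi : Integrable f π) {g : α → ℂ} (hg : Measurable g) {C : ℝ} (hC : ∀ x, ‖g x‖ ≤ C) :
    ∫ x, (∫ y, f y ∂κ x) * g x ∂π = ∫ x, f x * ∫ y, g y ∂κ x ∂π := by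
  have hi : Integrable (fun p : α × α => f p.1 * g p.2) (π ⊗ₘ κ) := by
    refine Integrable.mul_bdd (c := C) ?_ (by fun_prop : Measurable fun p : α × α => g p.2).aestronglyMeasurable
      (Eventually.of_forall fun p => hC _)
    refine ⟨(by fun_prop : Measurable fun p : α × α => f p.1).aestronglyMeasurable, ?_⟩
    rw [HasFiniteIntegral, Measure.lintegral_compProd (by fun_prop)]
    simpa [HasFiniteIntegral] using hfi.2
  have hswap := map_swap_compProd_of_isReversible h
  have hi' : Integrable (fun p : α × α => f p.2 * g p.1) (π ⊗ₘ κ) := by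
    rw [← hswap] at hi
    exact hi.comp_measurable measurable_swap
  calc ∫ x, (∫ y, f y ∂κ x) * g x ∂π = ∫ x, ∫ y, f y * g x ∂κ x ∂π := by
        simp_rw [integral_mul_const]
    _ = ∫ p, f p.2 * g p.1 ∂(π ⊗ₘ κ) := (Measure.integral_compProd hi').symm
    _ = ∫ p, f p.1 * g p.2 ∂(π ⊗ₘ κ) := by
        conv_rhs => rw [← hswap]
        rw [integral_map measurable_swap.aemeasurable (by fun_prop : Measurable fun p : α × α =>
          f p.1 * g p.2).aestronglyMeasurable]
        rfl
    _ = ∫ x, ∫ y, f x * g y ∂κ x ∂π := Measure.integral_compProd hi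
    _ = _ := by simp_rw [integral_const_mul]

end Reversible

/-- The action of a reversible kernel on the Fourier coefficients. -/
theorem coeff_integral_kernel {κ : Kernel S2 S2} [IsMarkovKernel κ] (h : κ.IsReversible lam)
    {l : ℕ} {m : ℤ} {c : ℝ}
    (hc : ∀ x, ∫ y, sphHarm l m y ∂κ x = c * sphHarm l m x) {f : S2 → ℝ}
    (hf : Measurable f) (hfi : Integrable f lam) :
    coeff (fun x => ∫ y, f y ∂κ x) l m = c * coeff f l m := by
  obtain ⟨C, hC⟩ := (isCompact_range (continuous_sphHarm l m)).isBounded.exists_norm_le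
  have h1 := integral_mul_integral_kernel h (f := fun x => (f x : ℂ)) (by fun_prop) hfi.ofReal
    (g := fun x => (starRingEnd ℂ) (sphHarm l m x))
    (Complex.continuous_conj.comp (continuous_sphHarm l m)).measurable (C := C)
    (fun x => by simpa using hC _ ⟨x, rfl⟩)
  simp_rw [integral_complex_ofReal, integral_conj, hc] at h1
  rw [coeff, h1, coeff, ← integral_const_mul]
  congr 1; ext x
  simp
  ring

/-! ### Subordination -/

/-- The transition kernel at an independent random time with law `ν`. -/
def subKer (ν : Measure ℝ≥0) : Kernel S2 S2 :=
  transKer ∘ₖ (Kernel.const S2 ν ×ₖ Kernel.id)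

theorem lintegral_subKer (ν : Measure ℝ≥0) [IsProbabilityMeasure ν] (x : S2) {f : S2 → ℝ≥0∞}
    (hf : Measurable f) :
    ∫⁻ y, f y ∂subKer ν x = ∫⁻ s, ∫⁻ y, f y ∂transKer (s, x) ∂ν := by
  rw [subKer, Kernel.lintegral_comp _ _ _ hf, Kernel.prod_apply, Kernel.const_apply,
    Kernel.id_apply, lintegral_prod _ (Measurable.lintegral_kernel hf).aemeasurable]
  refine lintegral_congr fun s => ?_
  rw [lintegral_dirac']
  exact (Measurable.lintegral_kernel hf).comp measurable_prodMk_left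

theorem subKer_apply (ν : Measure ℝ≥0) [IsProbabilityMeasure ν] (x : S2) {A : Set S2}
    (hA : MeasurableSet A) : subKer ν x A = ∫⁻ s, transKer (s, x) A ∂ν := by
  have h := lintegral_subKer ν x (f := A.indicator 1) (measurable_one.indicator hA)
  simpa [lintegral_indicator_one hA] using h

theorem subKer_dirac (s : ℝ≥0) (x : S2) : subKer (Measure.dirac s) x = transKer (s, x) := by
  ext A hA
  rw [subKer_apply _ _ hA, lintegral_dirac']
  exact (transKer.measurable_coe hA).comp measurable_prodMk_right

theorem isMarkovKernel_subKer [IsMarkovKernel transKer] (ν : Measure ℝ≥0) [IsProbabilityMeasure ν] :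
    IsMarkovKernel (subKer ν) := by
  unfold subKer
  infer_instance

theorem setLIntegral_transKer_comm (s : ℝ≥0) {A B : Set S2} (hA : MeasurableSet A)
    (hB : MeasurableSet B) :
    ∫⁻ x in A, transKer (s, x) B ∂lam = ∫⁻ x in B, transKer (s, x) A ∂lam := by
  rcases eq_or_ne s 0 with rfl | hs
  · simp_rw [transKer_zero, Measure.dirac_apply' _ hA, Measure.dirac_apply' _ hB]
    rw [lintegral_indicator_one hB, lintegral_indicator_one hA, Measure.restrict_apply hB,
      Measure.restrict_apply hA, Set.inter_comm]
  · have hs : 0 < s := pos_iff_ne_zero.2 hs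
    simp_rw [transKer_pos hs, withDensity_apply _ hA, withDensity_apply _ hB]
    rw [lintegral_lintegral_swap]
    · simp_rw [heatKernel_comm s _ _]
    · exact (measurable_heatKernel_uncurry (NNReal.coe_pos.2 hs)).ennreal_ofReal.aemeasurable

/-- Each `p_s` is reversible because the heat kernel is symmetric, and reversibility survives
averaging over `s`. -/
theorem isReversible_subKer [IsMarkovKernel transKer] (ν : Measure ℝ≥0) [IsProbabilityMeasure ν] :
    (subKer ν).IsReversible lam := by
  intro A B hA hB
  simp_rw [subKer_apply ν _ hA, subKer_apply ν _ hB]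
  have hm : ∀ C, MeasurableSet C → Measurable fun p : S2 × ℝ≥0 => transKer (p.2, p.1) C :=
    fun C hC => (transKer.measurable_coe hC).comp measurable_swap
  exact (lintegral_lintegral_swap (hm B hB).aemeasurable).trans
    ((lintegral_congr fun s => setLIntegral_transKer_comm s hA hB).trans
      (lintegral_lintegral_swap (hm A hA).aemeasurable).symm)

theorem integral_subKer [IsMarkovKernel transKer] (ν : Measure ℝ≥0) [IsProbabilityMeasure ν] (x : S2)
    {F : Type*} [NormedAddCommGroup F] [NormedSpace ℝ F] [CompleteSpace F] {f : S2 → F}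
    (hf : Continuous f) : ∫ y, f y ∂subKer ν x = ∫ s, ∫ y, f y ∂transKer (s, x) ∂ν := by
  have := isMarkovKernel_subKer ν
  obtain ⟨C, hC⟩ := (isCompact_range hf).isBounded.exists_norm_le
  have hfm : StronglyMeasurable f :=
    hf.stronglyMeasurable_of_hasCompactSupport (HasCompactSupport.of_compactSpace f)
  have hint : Integrable f (subKer ν x) := Integrable.of_bound hfm.aestronglyMeasurable C
    (Eventually.of_forall fun y => hC _ ⟨y, rfl⟩)
  have hm : StronglyMeasurable fun p : ℝ≥0 × S2 => ∫ y, f y ∂transKer p := hfm.integral_kernel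
  rw [subKer, Kernel.integral_comp hint, Kernel.prod_apply, Kernel.const_apply,
    Kernel.id_apply, integral_prod]
  · refine integral_congr_ae (Eventually.of_forall fun s => ?_)
    exact integral_dirac' _ _ (hm.comp_measurable measurable_prodMk_left)
  · refine Integrable.of_bound hm.aestronglyMeasurable C (Eventually.of_forall fun p => ?_)
    refine (norm_integral_le_of_norm_le_const
        (Eventually.of_forall fun y => hC (f y) ⟨_, rfl⟩)).trans ?_
    simp

/-! ### Independence and freezing. -/

section Independence

variable {Ω Ω' E : Type*} [mΩ : MeasurableSpace Ω] [MeasurableSpace Ω'] [MeasurableSpace E]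
  {P : Measure Ω} [IsProbabilityMeasure P] {X : Ω → E} {Z : Ω → Ω'}

theorem lintegral_comp_of_indepFun (hX : Measurable X) (hZ : Measurable Z) (h : IndepFun X Z P)
    {F : E × Ω' → ℝ≥0∞} (hF : Measurable F) :
    ∫⁻ ω, F (X ω, Z ω) ∂P = ∫⁻ e, ∫⁻ ω, F (e, Z ω) ∂P ∂(P.map X) := by
  have h1 := (indepFun_iff_map_prod_eq_prod_map_map hX.aemeasurable hZ.aemeasurable).1 h
  rw [← lintegral_map (f := F) (g := fun ω => (X ω, Z ω)) hF (hX.prodMk hZ), h1,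
    lintegral_prod _ hF.aemeasurable]
  refine lintegral_congr fun e => ?_
  exact lintegral_map (hF.comp measurable_prodMk_left) hZ

theorem integrable_prod_of_indepFun (hX : Measurable X) (hZ : Measurable Z) (h : IndepFun X Z P)
    {F : E × Ω' → ℝ} (hF : Measurable F) :
    Integrable F ((P.map X).prod (P.map Z)) ↔ Integrable (fun ω => F (X ω, Z ω)) P := by
  rw [← (indepFun_iff_map_prod_eq_prod_map_map hX.aemeasurable hZ.aemeasurable).1 h,
    integrable_map_measure hF.aestronglyMeasurable (hX.prodMk hZ).aemeasurable]
  rfl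

theorem integral_comp_of_indepFun (hX : Measurable X) (hZ : Measurable Z) (h : IndepFun X Z P)
    {F : E × Ω' → ℝ} (hF : Measurable F) (hi : Integrable (fun ω => F (X ω, Z ω)) P) :
    ∫ ω, F (X ω, Z ω) ∂P = ∫ ω, ∫ e, F (e, Z ω) ∂(P.map X) ∂P := by
  have h1 := (indepFun_iff_map_prod_eq_prod_map_map hX.aemeasurable hZ.aemeasurable).1 h
  have hmap : IsProbabilityMeasure (P.map X) := Measure.isProbabilityMeasure_map hX.aemeasurable
  have hmapZ : IsProbabilityMeasure (P.map Z) := Measure.isProbabilityMeasure_map hZ.aemeasurable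
  rw [← integral_map (f := F) (φ := fun ω => (X ω, Z ω)) (hX.prodMk hZ).aemeasurable
    hF.aestronglyMeasurable, h1, integral_prod_symm _
    ((integrable_prod_of_indepFun hX hZ h hF).2 hi), integral_map hZ.aemeasurable]
  have : StronglyMeasurable fun q : Ω' × E => F (q.2, q.1) :=
    (hF.comp measurable_swap).stronglyMeasurable
  exact this.integral_prod_right.aestronglyMeasurable

/-- Freezing: conditioning on a variable independent of `X` integrates `X` out. -/
theorem condExp_comp_of_indepFun (hX : Measurable X) (hZ : Measurable Z) (h : IndepFun X Z P)
    {F : E × Ω' → ℝ} (hF : Measurable F) (hi : Integrable (fun ω => F (X ω, Z ω)) P) :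
    (fun ω => ∫ e, F (e, Z ω) ∂(P.map X)) =ᵐ[P]
      P[fun ω => F (X ω, Z ω) | MeasurableSpace.comap Z inferInstance] := by
  have hmap : IsProbabilityMeasure (P.map X) := Measure.isProbabilityMeasure_map hX.aemeasurable
  have hmapZ : IsProbabilityMeasure (P.map Z) := Measure.isProbabilityMeasure_map hZ.aemeasurable
  have hsm : StronglyMeasurable fun z => ∫ e, F (e, z) ∂(P.map X) := by
    have : StronglyMeasurable fun q : Ω' × E => F (q.2, q.1) :=
      (hF.comp measurable_swap).stronglyMeasurable
    exact this.integral_prod_right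
  have hint : Integrable (fun ω => ∫ e, F (e, Z ω) ∂(P.map X)) P := by
    have h2 := ((integrable_prod_of_indepFun hX hZ h hF).2 hi).integral_prod_right
    rw [integrable_map_measure hsm.aestronglyMeasurable hZ.aemeasurable] at h2
    exact h2
  refine ae_eq_condExp_of_forall_setIntegral_eq hZ.comap_le hi (fun s _ _ => hint.integrableOn) ?_ ?_
  · rintro s ⟨A, hA, rfl⟩ -
    set G : E × Ω' → ℝ := fun p => A.indicator 1 p.2 * F p with hG
    have hGm : Measurable G := ((measurable_one.indicator hA).comp measurable_snd).mul hF
    have hind : ∀ ω, A.indicator (1 : Ω' → ℝ) (Z ω) = (Z ⁻¹' A).indicator 1 ω := fun ω => rfl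
    have hGi : Integrable (fun ω => G (X ω, Z ω)) P := by
      refine (hi.indicator (hZ hA)).congr (Eventually.of_forall fun ω => ?_)
      by_cases hω : Z ω ∈ A <;> simp [hG, hω]
    have h3 := integral_comp_of_indepFun hX hZ h hGm hGi
    rw [← integral_indicator (hZ hA), ← integral_indicator (hZ hA)]
    refine Eq.trans (integral_congr_ae (Eventually.of_forall fun ω => ?_))
      (h3.symm.trans (integral_congr_ae (Eventually.of_forall fun ω => ?_)))
    · by_cases hω : Z ω ∈ A <;> simp [hG, hω]
    · by_cases hω : Z ω ∈ A <;> simp [hG, hω]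
  · exact (hsm.comp_measurable (comap_measurable Z)).aestronglyMeasurable

end Independence

/-- A σ-algebra `m` is encoded as the random variable `id` with values in `(Ω, m)`, so that the
freezing lemmas apply to independence of σ-algebras. -/
theorem indepFun_id_of_indep {Ω E : Type*} [MeasurableSpace E] (mΩ m : MeasurableSpace Ω)
    {P : @Measure Ω mΩ} {X : Ω → E}
    (h : @Indep Ω (MeasurableSpace.comap X inferInstance) m mΩ P) :
    @IndepFun Ω E Ω mΩ _ m X id P := by
  refine (@IndepFun_iff_Indep Ω E Ω mΩ _ m X id P).2 ?_
  rwa [MeasurableSpace.comap_id]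

/-- Continuity of paths gives joint measurability for the σ-algebra of `B` itself. The ambient one
would not do, since independence is known only for the former. -/
theorem measurable_uncurry_sigmaOf {Ω : Type*} {B : ℝ≥0 → Ω → S2}
    (hB : ∀ ω, Continuous fun t => B t ω) :
    Measurable[(inferInstance : MeasurableSpace ℝ≥0).prod (sigmaOf B)] (Function.uncurry B) := by
  let _ : MeasurableSpace Ω := sigmaOf B
  exact measurable_uncurry_of_continuous_of_measurable hB
    fun i => Measurable.mono (comap_measurable (B i)) (le_iSup (fun i =>
      MeasurableSpace.comap (B i) inferInstance) i) le_rfl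

section BrownianMotion

variable {Ω : Type*} [mΩ : MeasurableSpace Ω] {P : Measure Ω}

theorem IsSphereBM.measurable_comp {B : ℝ≥0 → Ω → S2} {x : S2} (hB : IsSphereBM P B x)
    {τ : Ω → ℝ≥0} (hτ : Measurable τ) : Measurable fun ω => B (τ ω) ω := by
  have h : Measurable (Function.uncurry B) :=
    measurable_uncurry_of_continuous_of_measurable hB.continuous hB.measurable
  exact h.comp (hτ.prodMk measurable_id)

variable [IsProbabilityMeasure P]

/-- The law of the Brownian motion at an independent random time. -/
theorem IsSphereBM.map_comp_eq_subKer {B : ℝ≥0 → Ω → S2} {x : S2} (hB : IsSphereBM P B x)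
    {τ : Ω → ℝ≥0} (hτ : Measurable τ)
    (h : Indep (sigmaOf B) (MeasurableSpace.comap τ inferInstance) P) :
    P.map (fun ω => B (τ ω) ω) = subKer (P.map τ) x := by
  have hle : sigmaOf B ≤ mΩ := sigmaOf_le hB.measurable
  have : IsProbabilityMeasure (P.map τ) := Measure.isProbabilityMeasure_map hτ.aemeasurable
  ext A hA
  rw [subKer_apply _ _ hA, Measure.map_apply (hB.measurable_comp hτ) hA,
    ← lintegral_indicator_one ((hB.measurable_comp hτ) hA)]
  have hZ : @Measurable Ω Ω mΩ (sigmaOf B) id := measurable_id'' hle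
  have hind : @IndepFun Ω ℝ≥0 Ω mΩ _ (sigmaOf B) τ id P :=
    indepFun_id_of_indep mΩ (sigmaOf B) h.symm
  have h1 := @lintegral_comp_of_indepFun Ω Ω ℝ≥0 mΩ (sigmaOf B) _ P _ τ id hτ hZ hind
    (fun p => A.indicator 1 (Function.uncurry B p))
    (@Measurable.comp (ℝ≥0 × Ω) S2 ℝ≥0∞ ((inferInstance : MeasurableSpace ℝ≥0).prod (sigmaOf B))
      _ _ (A.indicator 1) (Function.uncurry B) (measurable_one.indicator hA)
      (measurable_uncurry_sigmaOf hB.continuous))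
  refine Eq.trans ?_ (h1.trans (lintegral_congr fun s => ?_))
  · rfl
  · rw [← hB.map_eq_transKer, Measure.map_apply (hB.measurable s) hA,
      ← lintegral_indicator_one (hB.measurable s hA)]
    rfl

theorem integral_sphHarm_subKer {B : S2 → ℝ≥0 → Ω → S2} (hB : ∀ x, IsSphereBM P (B x) x)
    (ν : Measure ℝ≥0) [IsProbabilityMeasure ν] {l : ℕ} {m : ℤ} (hm : |m| ≤ l) (x : S2) :
    ∫ y, sphHarm l m y ∂subKer ν x
      = (∫ s, Real.exp (-(s : ℝ) * eigMu l) ∂ν : ℝ) * sphHarm l m x := by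
  have := isMarkovKernel_transKer hB
  rw [integral_subKer ν x (continuous_sphHarm l m), ← integral_complex_ofReal, ← integral_mul_const]
  exact integral_congr_ae (Eventually.of_forall fun s => (hB x).integral_sphHarm_transKer s hm)

end BrownianMotion

/-! ### Laplace exponents. -/

section Subordinator

variable {M : Measure ℝ}

theorem IsSubLevyMeasure.integrableOn (hM : IsSubLevyMeasure M) {μ : ℝ} (hμ : 0 ≤ μ) :
    IntegrableOn (fun y => 1 - Real.exp (-μ * y)) (Set.Ioi 0) M := by
  -- The majorant: `1 - e^{-μy}` is at most `μ y` for `y ≤ 1` and at most `1` otherwise.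
  have h1 : IntegrableOn (fun y : ℝ => (μ + 1) * min y 1) (Set.Ioi 0) M := by
    refine Integrable.const_mul ⟨(by fun_prop : Measurable fun y : ℝ => min y 1).aestronglyMeasurable,
      lt_of_le_of_lt ?_ hM.integrable_min⟩ _
    refine (setLIntegral_mono' measurableSet_Ioi fun y hy => ?_).trans
      (setLIntegral_le_lintegral (Set.Ioi 0) _)
    rw [← ofReal_norm, Real.norm_of_nonneg (le_min (le_of_lt hy) zero_le_one)]
  refine h1.mono' (by fun_prop : Measurable fun y : ℝ => 1 - Real.exp (-μ * y)).aestronglyMeasurable ?_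
  filter_upwards [ae_restrict_mem measurableSet_Ioi] with y hy
  have hy' : (0 : ℝ) < y := hy
  have h2 : Real.exp (-μ * y) ≤ 1 := Real.exp_le_one_iff.2 (by nlinarith)
  have h3 := Real.add_one_le_exp (-μ * y)
  have h4 := Real.exp_pos (-μ * y)
  rw [Real.norm_of_nonneg (by linarith)]
  rcases le_total y 1 with h | h
  · rw [min_eq_left h]; nlinarith
  · rw [min_eq_right h]; nlinarith

theorem laplaceExp_nonneg {μ : ℝ} (hμ : 0 ≤ μ) : 0 ≤ laplaceExp M μ := by
  refine setIntegral_nonneg measurableSet_Ioi fun y hy => ?_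
  have hy' : (0 : ℝ) < y := hy
  have h2 : Real.exp (-μ * y) ≤ 1 := Real.exp_le_one_iff.2 (by nlinarith)
  linarith

theorem laplaceExp_zero : laplaceExp M 0 = 0 := by simp [laplaceExp]

variable {Ω : Type*} [mΩ : MeasurableSpace Ω] {P : Measure Ω} [IsProbabilityMeasure P]
  {D : ℝ≥0 → Ω → ℝ≥0}

theorem IsSubordinator.integral_exp (hD : IsSubordinator P M D) (t : ℝ≥0) {μ : ℝ} (hμ : 0 ≤ μ) :
    ∫ s, Real.exp (-(s : ℝ) * μ) ∂(P.map (D t)) = Real.exp (-(t : ℝ) * laplaceExp M μ) := by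
  have : IsProbabilityMeasure (P.map (D t)) :=
    Measure.isProbabilityMeasure_map (hD.measurable t).aemeasurable
  -- The value `μ = 0`, needed for degree `l = 0`, is outside the range of the Laplace identity for
  -- `D`.
  rcases hμ.eq_or_lt with rfl | hμ
  · simp [laplaceExp_zero]
  · rw [integral_map (hD.measurable t).aemeasurable
      (by fun_prop : Measurable fun s : ℝ≥0 => Real.exp (-(s : ℝ) * μ)).aestronglyMeasurable,
      ← hD.laplace 0 t μ hμ]
    refine integral_congr_ae ?_
    filter_upwards [hD.start] with ω hω
    rw [hω, zero_add]
    congr 1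
    simp
    ring

end Subordinator

/-! ### The Fourier coefficients on `L²` -/

/-- The Fourier coefficient as a continuous linear functional on real `L²`. -/
def coeffCLM (i : HarmIdx) : Lp ℝ 2 lam →L[ℝ] ℂ :=
  ((innerSL ℂ (harmLp i)).restrictScalars ℝ).comp (Complex.ofRealCLM.compLpL 2 lam)

theorem coeffCLM_apply (i : HarmIdx) (u : Lp ℝ 2 lam) : coeffCLM i u = coeff u i.1 i.2 := by
  have h1 : Complex.ofRealCLM.compLpL 2 lam u
      = ((Lp.memLp u).ofReal (K := ℂ)).toLp (fun x => ((u x : ℝ) : ℂ)) := by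
    refine Lp.ext ?_
    filter_upwards [Complex.ofRealCLM.coeFn_compLp u,
      ((Lp.memLp u).ofReal (K := ℂ)).coeFn_toLp] with x h1 h2
    exact h1.trans h2.symm
  rw [coeffCLM, ContinuousLinearMap.comp_apply, h1]
  exact inner_harmLp i _

theorem coeff_congr {f g : S2 → ℝ} (h : f =ᵐ[lam] g) (l : ℕ) (m : ℤ) : coeff f l m = coeff g l m := by
  refine integral_congr_ae ?_
  filter_upwards [h] with x hx
  rw [hx]

theorem coeffCLM_toLp (i : HarmIdx) {f : S2 → ℝ} (hf : MemLp f 2 lam) :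
    coeffCLM i (hf.toLp f) = coeff f i.1 i.2 := by
  rw [coeffCLM_apply, coeff_congr hf.coeFn_toLp]

/-- The image of an element of `L²` under the transition operator at a random time of law `ν`. -/
def subLp [IsMarkovKernel transKer] (ν : Measure ℝ≥0) [IsProbabilityMeasure ν] (u : Lp ℝ 2 lam) :
    Lp ℝ 2 lam :=
  have := isMarkovKernel_subKer ν
  (memLp_integral_kernel (isReversible_subKer ν) (Lp.stronglyMeasurable u).measurable
    (Lp.memLp u)).toLp fun x => ∫ y, u y ∂subKer ν x

theorem coeFn_subLp [IsMarkovKernel transKer] (ν : Measure ℝ≥0) [IsProbabilityMeasure ν]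
    (u : Lp ℝ 2 lam) : subLp ν u =ᵐ[lam] fun x => ∫ y, u y ∂subKer ν x := by
  unfold subLp
  exact MemLp.coeFn_toLp _

theorem norm_sq_eq_integral (u : Lp ℝ 2 lam) : ‖u‖ ^ 2 = ∫ x, u x ^ 2 ∂lam := by
  rw [← real_inner_self_eq_norm_sq, L2.inner_def]
  congr 1; ext x
  simp [sq]

section BrownianMotion

variable {Ω : Type*} [mΩ : MeasurableSpace Ω] {P : Measure Ω} [IsProbabilityMeasure P]
  {B : S2 → ℝ≥0 → Ω → S2}

theorem coeffCLM_subLp (hB : ∀ x, IsSphereBM P (B x) x) [IsMarkovKernel transKer] (ν : Measure ℝ≥0)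
    [IsProbabilityMeasure ν] (u : Lp ℝ 2 lam) (i : HarmIdx) : coeffCLM i (subLp ν u)
      = (∫ s, Real.exp (-(s : ℝ) * eigMu i.1) ∂ν : ℝ) * coeffCLM i u := by
  have := isMarkovKernel_subKer ν
  rw [coeffCLM_apply, coeffCLM_apply, coeff_congr (coeFn_subLp ν u)]
  exact coeff_integral_kernel (isReversible_subKer ν)
    (integral_sphHarm_subKer hB ν i.abs_le) (Lp.stronglyMeasurable u).measurable
    ((Lp.memLp u).integrable (by norm_num))

theorem coeffCLM_subLp_dirac (hB : ∀ x, IsSphereBM P (B x) x) [IsMarkovKernel transKer] (s : ℝ≥0)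
    (u : Lp ℝ 2 lam) (i : HarmIdx) : coeffCLM i (subLp (Measure.dirac s) u)
      = Real.exp (-(s : ℝ) * eigMu i.1) * coeffCLM i u := by
  rw [coeffCLM_subLp hB, integral_dirac]

theorem hasSum_norm_sq_coeffCLM (hB : ∀ x, IsSphereBM P (B x) x) (u : Lp ℝ 2 lam) :
    HasSum (fun i => ‖coeffCLM i u‖ ^ 2) (‖u‖ ^ 2) := by
  rw [norm_sq_eq_integral]
  simp_rw [coeffCLM_apply]
  exact hasSum_norm_sq_coeff hB (Lp.memLp u)

/-- Parseval turns a coefficientwise bound into an operator-type bound with the same constant; the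
estimates for the Cauchy problem pass through it. -/
theorem norm_le_of_coeffCLM (hB : ∀ x, IsSphereBM P (B x) x) {g h : Lp ℝ 2 lam} {a : ℝ}
    (ha : 0 ≤ a) (hgh : ∀ i, ‖coeffCLM i g‖ ≤ a * ‖coeffCLM i h‖) : ‖g‖ ≤ a * ‖h‖ := by
  rw [← sq_le_sq₀ (norm_nonneg _) (by positivity), mul_pow]
  refine hasSum_le (fun i => ?_) (hasSum_norm_sq_coeffCLM hB g)
    ((hasSum_norm_sq_coeffCLM hB h).mul_left (a ^ 2))
  rw [← mul_pow]
  exact pow_le_pow_left₀ (norm_nonneg _) (hgh i) 2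

theorem eq_of_coeffCLM (hB : ∀ x, IsSphereBM P (B x) x) {g h : Lp ℝ 2 lam}
    (hgh : ∀ i, coeffCLM i g = coeffCLM i h) : g = h := by
  rw [← sub_eq_zero, ← norm_le_zero_iff, ← zero_mul ‖g‖]
  refine norm_le_of_coeffCLM hB le_rfl fun i => ?_
  rw [map_sub, hgh, sub_self]
  simp

/-- Dominated convergence in Parseval's sum, the coefficients of the fixed `h` serving as square
summable majorant. -/
theorem tendsto_of_coeffCLM (hB : ∀ x, IsSphereBM P (B x) x) {α : Type*} {F : Filter α}
    {u : α → Lp ℝ 2 lam} {v h : Lp ℝ 2 lam}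
    (hb : ∀ a i, ‖coeffCLM i (u a)‖ ≤ ‖coeffCLM i h‖) (hv : ∀ i, ‖coeffCLM i v‖ ≤ ‖coeffCLM i h‖)
    (ht : ∀ i, Tendsto (fun a => coeffCLM i (u a)) F (𝓝 (coeffCLM i v))) : Tendsto u F (𝓝 v) := by
  rw [tendsto_iff_norm_sub_tendsto_zero]
  have h1 : Tendsto (fun a => ∑' i, ‖coeffCLM i (u a - v)‖ ^ 2) F (𝓝 (∑' _ : HarmIdx, (0 : ℝ))) := by
    refine tendsto_tsum_of_dominated_convergence
      ((hasSum_norm_sq_coeffCLM hB h).summable.mul_left 4) (fun i => ?_)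
      (Eventually.of_forall fun a i => ?_)
    · have := ((ht i).sub_const (coeffCLM i v)).norm.pow 2
      simpa using this
    · rw [map_sub, Real.norm_of_nonneg (by positivity)]
      have h3 : ‖coeffCLM i (u a) - coeffCLM i v‖ ≤ 2 * ‖coeffCLM i h‖ :=
        (norm_sub_le _ _).trans (by linarith [hb a i, hv i])
      calc _ ≤ (2 * ‖coeffCLM i h‖) ^ 2 := pow_le_pow_left₀ (norm_nonneg _) h3 2
        _ = _ := by ring
  simp_rw [(hasSum_norm_sq_coeffCLM hB _).tsum_eq, tsum_zero] at h1
  have h2 := h1.sqrt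
  simpa [Real.sqrt_sq (norm_nonneg _)] using h2

theorem continuous_subLp_dirac (hB : ∀ x, IsSphereBM P (B x) x) [IsMarkovKernel transKer]
    (u : Lp ℝ 2 lam) : Continuous fun s : ℝ≥0 => subLp (Measure.dirac s) u := by
  rw [continuous_iff_continuousAt]
  intro s
  have hb : ∀ (s : ℝ≥0) i, ‖coeffCLM i (subLp (Measure.dirac s) u)‖ ≤ ‖coeffCLM i u‖ := by
    intro s i
    rw [coeffCLM_subLp_dirac hB, norm_mul, Complex.norm_real, Real.norm_of_nonneg (Real.exp_pos _).le]
    refine mul_le_of_le_one_left (norm_nonneg _) (Real.exp_le_one_iff.2 ?_)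
    have := mul_nonneg s.2 (eigMu_nonneg i.1)
    simpa using this
  refine tendsto_of_coeffCLM hB hb (hb s) fun i => ?_
  simp_rw [coeffCLM_subLp_dirac hB]
  have : Continuous fun s : ℝ≥0 => (Real.exp (-(s : ℝ) * eigMu i.1) : ℂ) * coeffCLM i u := by fun_prop
  exact this.tendsto s

theorem heatOp_eq_integral_subKer (hB : ∀ x, IsSphereBM P (B x) x) {s : ℝ≥0} (hs : 0 < s)
    (f : S2 → ℝ) (x : S2) : heatOp s f x = ∫ y, f y ∂subKer (Measure.dirac s) x := by
  rw [subKer_dirac, (hB x).heatOp_eq hs]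

theorem eLpNorm_heatOp_sub (hB : ∀ x, IsSphereBM P (B x) x) [IsMarkovKernel transKer] {s : ℝ≥0}
    (hs : 0 < s) (u : Lp ℝ 2 lam) : eLpNorm (fun x => heatOp s u x - u x) 2 lam
      = ‖subLp (Measure.dirac s) u - u‖ₑ := by
  rw [Lp.enorm_def]
  refine eLpNorm_congr_ae ?_
  filter_upwards [coeFn_subLp (Measure.dirac s) u, Lp.coeFn_sub (subLp (Measure.dirac s) u) u]
    with x h1 h2
  rw [h2, Pi.sub_apply, h1, heatOp_eq_integral_subKer hB hs]

end BrownianMotion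

/-! ### The fractional operator -/

/-- On `(0, ∞)` the weight `min y 1` is positive and makes `M` finite; dividing it out again by a
finite density recovers `M`. Fubini for the fractional operator needs this. -/
theorem IsSubLevyMeasure.sigmaFinite {M : Measure ℝ} (hM : IsSubLevyMeasure M) :
    SigmaFinite (M.restrict (Set.Ioi 0)) := by
  set f : ℝ → ℝ≥0∞ := fun y => ENNReal.ofReal (min y 1) with hf
  have hfm : Measurable f := by fun_prop
  have h1 : IsFiniteMeasure ((M.restrict (Set.Ioi 0)).withDensity f) :=
    isFiniteMeasure_withDensity
      (lt_of_le_of_lt (setLIntegral_le_lintegral _ _) hM.integrable_min).ne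
  have h0 : ∀ᵐ y ∂(M.restrict (Set.Ioi 0)), f y ≠ 0 := by
    filter_upwards [ae_restrict_mem measurableSet_Ioi] with y hy
    have hy' : (0 : ℝ) < y := hy
    simp [hf, hy']
  rw [← withDensity_inv_same hfm h0 (by simp [hf])]
  refine SigmaFinite.withDensity_of_ne_top ?_
  rw [ae_withDensity_iff hfm]
  exact Eventually.of_forall fun y hy => ENNReal.inv_ne_top.2 hy

section BrownianMotion

variable {Ω : Type*} [mΩ : MeasurableSpace Ω] {P : Measure Ω} [IsProbabilityMeasure P]
  {B : S2 → ℝ≥0 → Ω → S2} {M : Measure ℝ}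

theorem InDomain.integrableOn (hB : ∀ x, IsSphereBM P (B x) x) [IsMarkovKernel transKer]
    {g : Lp ℝ 2 lam} (hg : InDomain M g) :
    IntegrableOn (fun s : ℝ => subLp (Measure.dirac s.toNNReal) g - g) (Set.Ioi 0) M := by
  have hcont : Continuous fun s : ℝ => subLp (Measure.dirac s.toNNReal) g - g :=
    ((continuous_subLp_dirac hB g).comp continuous_real_toNNReal).sub continuous_const
  refine ⟨hcont.aestronglyMeasurable, lt_of_le_of_lt (le_of_eq ?_) hg⟩
  refine setLIntegral_congr_fun measurableSet_Ioi fun s hs => ?_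
  have hs' : 0 < s.toNNReal := Real.toNNReal_pos.2 hs
  have := eLpNorm_heatOp_sub hB hs' g
  rw [Real.coe_toNNReal _ (le_of_lt hs)] at this
  exact this.symm

/-- On its domain, the fractional operator takes values in `L²` and multiplies the Fourier
coefficients of degree `l` by `-Ψ(μ_l)`. -/
theorem InDomain.exists_fracOp (hB : ∀ x, IsSphereBM P (B x) x) (hM : IsSubLevyMeasure M)
    {g : Lp ℝ 2 lam} (hg : InDomain M g) : ∃ W : Lp ℝ 2 lam, W =ᵐ[lam] fracOp M g ∧
      ∀ i, coeffCLM i W = -(laplaceExp M (eigMu i.1) : ℂ) * coeffCLM i g := by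
  have hmarkov : IsMarkovKernel transKer := isMarkovKernel_transKer hB
  have hσ := hM.sigmaFinite
  have hint := hg.integrableOn hB
  set G : ℝ → Lp ℝ 2 lam := fun s => subLp (Measure.dirac s.toNNReal) g - g with hG
  -- The Bochner integral in `L²` commutes with the functionals `coeffCLM i`, which yields the
  -- multiplier. It agrees a.e. with the pointwise integral because both have the same integral over
  -- each measurable set, by Fubini for the jointly measurable version `H`.
  refine ⟨∫ s in Set.Ioi 0, G s ∂M, ?_, fun i => ?_⟩
  · set H : ℝ × S2 → ℝ := fun p => ∫ y, g y ∂transKer (p.1.toNNReal, p.2) - g p.2 with hH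
    have hgm := Lp.stronglyMeasurable g
    have hHm : StronglyMeasurable H := by
      have h1 : StronglyMeasurable fun q : ℝ≥0 × S2 => ∫ y, g y ∂transKer q := hgm.integral_kernel
      exact (h1.comp_measurable (by fun_prop : Measurable fun p : ℝ × S2 => (p.1.toNNReal, p.2))).sub
        (hgm.comp_measurable measurable_snd)
    have hHG : ∀ s, (fun x => H (s, x)) =ᵐ[lam] G s := by
      intro s
      filter_upwards [coeFn_subLp (Measure.dirac s.toNNReal) g,
        Lp.coeFn_sub (subLp (Measure.dirac s.toNNReal) g) g] with x h1 h2
      rw [h2, Pi.sub_apply, h1, subKer_dirac]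
    have hfrac : ∀ x, fracOp M g x = ∫ s in Set.Ioi 0, H (s, x) ∂M := by
      intro x
      refine setIntegral_congr_fun measurableSet_Ioi fun s hs => ?_
      have hs' : 0 < s.toNNReal := Real.toNNReal_pos.2 hs
      have := (hB x).heatOp_eq hs' g
      rw [Real.coe_toNNReal _ (le_of_lt hs)] at this
      simp only [hH, this]
    -- On the finite measure `lam`, the `L¹` norm is at most `λ(S²)^(1/2)` times the `L²` norm,
    -- which is `M`-integrable on the domain.
    have hHi : Integrable H ((M.restrict (Set.Ioi 0)).prod lam) := by
      rw [integrable_prod_iff hHm.aestronglyMeasurable]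
      refine ⟨Eventually.of_forall fun s => ?_, ?_⟩
      · exact ((Lp.memLp (G s)).integrable (by norm_num)).congr (hHG s).symm
      · refine Integrable.mono' (hint.norm.const_mul (lam.real Set.univ ^ (1 / 2 : ℝ)))
          (hHm.norm.integral_prod_right).aestronglyMeasurable (Eventually.of_forall fun s => ?_)
        have h2 : ∫ x, ‖H (s, x)‖ ∂lam = (∫⁻ x, ‖H (s, x)‖ₑ ∂lam).toReal :=
          integral_norm_eq_lintegral_enorm
            (hHm.comp_measurable measurable_prodMk_left).aestronglyMeasurable
        rw [Real.norm_of_nonneg (integral_nonneg fun x => norm_nonneg _), h2,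
          ← eLpNorm_one_eq_lintegral_enorm, eLpNorm_congr_ae (hHG s)]
        have h3 := eLpNorm_le_eLpNorm_mul_rpow_measure_univ (p := 1) (q := 2) (by norm_num)
          (Lp.aestronglyMeasurable (G s))
        rw [mul_comm, Lp.norm_def, measureReal_def, ENNReal.toReal_rpow, ← ENNReal.toReal_mul]
        refine ENNReal.toReal_mono ?_ (h3.trans (le_of_eq ?_))
        · refine ENNReal.mul_ne_top (Lp.eLpNorm_ne_top _) ?_
          exact ENNReal.rpow_ne_top_of_nonneg (by norm_num) (measure_ne_top _ _)
        · norm_num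
    have hfi : Integrable (fracOp M g) lam := by
      have := hHi.integral_prod_right
      exact this.congr (Eventually.of_forall fun x => (hfrac x).symm)
    refine Integrable.ae_eq_of_forall_setIntegral_eq _ _
      ((Lp.memLp _).integrable (by norm_num)) hfi fun A hA hAfin => ?_
    have h4 : ∀ u : Lp ℝ 2 lam, innerSL ℝ (indicatorConstLp 2 hA hAfin.ne (1 : ℝ)) u
        = ∫ x in A, u x ∂lam := fun u => by
      rw [innerSL_apply_apply, L2.inner_indicatorConstLp_one]
    rw [← h4, ← (innerSL ℝ (indicatorConstLp 2 hA hAfin.ne (1 : ℝ))).integral_comp_comm hint]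
    simp_rw [h4, hfrac]
    have hHA : Integrable H ((M.restrict (Set.Ioi 0)).prod (lam.restrict A)) := by
      have : (M.restrict (Set.Ioi 0)).prod (lam.restrict A)
          = ((M.restrict (Set.Ioi 0)).prod lam).restrict (Set.univ ×ˢ A) := by
        rw [← Measure.prod_restrict, Measure.restrict_univ]
      rw [this]
      exact hHi.integrableOn
    rw [← integral_integral_swap (f := fun s x => H (s, x)) hHA]
    refine integral_congr_ae (Eventually.of_forall fun s => ?_)
    exact integral_congr_ae (ae_restrict_of_ae (hHG s).symm)
  · rw [← (coeffCLM i).integral_comp_comm hint]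
    have h5 : ∀ s ∈ Set.Ioi (0 : ℝ), coeffCLM i (G s)
        = ((-(1 - Real.exp (-eigMu i.1 * s)) : ℝ) : ℂ) * coeffCLM i g := by
      intro s hs
      rw [hG, map_sub, coeffCLM_subLp_dirac hB, Real.coe_toNNReal _ (le_of_lt hs)]
      rw [show -s * eigMu i.1 = -eigMu i.1 * s by ring]
      push_cast
      ring
    rw [setIntegral_congr_fun measurableSet_Ioi h5, integral_mul_const, integral_complex_ofReal,
      integral_neg, laplaceExp]
    push_cast
    rfl

end BrownianMotion

/-! ### The Cauchy problem -/

section Cauchy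

variable {Ω : Type*} [mΩ : MeasurableSpace Ω] {P : Measure Ω} [IsProbabilityMeasure P]
  {B : S2 → ℝ≥0 → Ω → S2} {M : Measure ℝ}

theorem eigMu_mono : Monotone eigMu := by
  intro l l' h
  unfold eigMu
  have : (l : ℝ) ≤ l' := by exact_mod_cast h
  gcongr

/-- The supremum of `1 - e^{-s μ_l}` over those `l` with `Ψ(μ_l) < k + 1`. -/
def levelSup (M : Measure ℝ) (k : ℕ) (s : ℝ) : ℝ≥0∞ :=
  ⨆ l : {l : ℕ // laplaceExp M (eigMu l) < k + 1}, ENNReal.ofReal (1 - Real.exp (-eigMu l * s))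

theorem measurable_levelSup (k : ℕ) : Measurable (levelSup M k) :=
  Measurable.iSup fun l => by fun_prop

/-- The functions `1 - e^{-μ_l s}` increase with `l`, so monotone convergence takes the supremum out
of the integral, where each term is `Ψ(μ_l) < k + 1`. The level may contain infinitely many `l`, as
happens when `Ψ` is bounded. -/
theorem lintegral_levelSup_le (hM : IsSubLevyMeasure M) (k : ℕ) :
    ∫⁻ s in Set.Ioi 0, levelSup M k s ∂M ≤ ENNReal.ofReal (k + 1) := by
  set f : {l : ℕ // laplaceExp M (eigMu l) < k + 1} → ℝ → ℝ≥0∞ := fun l =>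
    (Set.Ioi (0 : ℝ)).indicator fun s => ENNReal.ofReal (1 - Real.exp (-eigMu l * s)) with hf
  have hmono : Monotone f := by
    intro l l' h s
    by_cases hs : s ∈ Set.Ioi (0 : ℝ)
    · simp only [hf, Set.indicator_of_mem hs]
      have h1 := mul_le_mul_of_nonneg_right (eigMu_mono h) (le_of_lt hs)
      refine ENNReal.ofReal_le_ofReal (sub_le_sub_left (Real.exp_le_exp.2 ?_) 1)
      simp only [neg_mul]
      linarith
    · simp [hf, hs]
  have h1 : ∫⁻ s in Set.Ioi 0, levelSup M k s ∂M = ∫⁻ s, ⨆ l, f l s ∂M := by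
    rw [← lintegral_indicator measurableSet_Ioi]
    refine lintegral_congr fun s => ?_
    by_cases hs : s ∈ Set.Ioi (0 : ℝ)
    · simp only [hf, Set.indicator_of_mem hs, levelSup]
    · simp [hf, hs]
  have hmeas : ∀ l, Measurable (f l) := fun l =>
    (by fun_prop : Measurable fun s =>
      ENNReal.ofReal (1 - Real.exp (-eigMu l * s))).indicator measurableSet_Ioi
  rw [h1, lintegral_iSup_directed (fun l => (hmeas l).aemeasurable) hmono.directed_le]
  refine iSup_le fun l => ?_
  rw [hf, lintegral_indicator measurableSet_Ioi, ← ofReal_integral_eq_lintegral_ofReal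
    (hM.integrableOn (eigMu_nonneg l))]
  · exact ENNReal.ofReal_le_ofReal l.2.le
  · filter_upwards [ae_restrict_mem measurableSet_Ioi] with s hs
    have hs' : (0 : ℝ) < s := hs
    have := mul_nonneg (eigMu_nonneg l) hs'.le
    have h2 : Real.exp (-eigMu l * s) ≤ 1 := Real.exp_le_one_iff.2 (by linarith)
    simpa using h2

theorem levelSup_le_one (k : ℕ) (s : ℝ) : levelSup M k s ≤ 1 :=
  iSup_le fun l => by
    rw [← ENNReal.ofReal_one]
    exact ENNReal.ofReal_le_ofReal (by linarith [Real.exp_pos (-eigMu l * s)])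

theorem tsum_levelSup_ne_top {t : ℝ} (ht : 0 < t) (s : ℝ) :
    ∑' k : ℕ, ENNReal.ofReal (Real.exp (-t * k)) * levelSup M k s ≠ ∞ := by
  have h1 : Summable fun k : ℕ => Real.exp (-t * k) := by
    have := Real.summable_exp_nat_mul_iff.2 (neg_neg_of_pos ht)
    exact this.congr fun k => by rw [mul_comm]
  refine ne_top_of_le_ne_top h1.tsum_ofReal_ne_top (ENNReal.tsum_le_tsum fun k => ?_)
  exact mul_le_of_le_one_right' (levelSup_le_one k s)

theorem lintegral_tsum_levelSup_lt_top (hM : IsSubLevyMeasure M) {t : ℝ} (ht : 0 < t) :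
    ∫⁻ s in Set.Ioi 0, ∑' k : ℕ, ENNReal.ofReal (Real.exp (-t * k)) * levelSup M k s ∂M < ∞ := by
  rw [lintegral_tsum fun k => ((measurable_levelSup k).const_mul _).aemeasurable]
  have h1 : Summable fun k : ℕ => Real.exp (-t * k) * (k + 1) := by
    have h2 := Real.summable_pow_mul_exp_neg_nat_mul 1 ht
    have h3 := Real.summable_pow_mul_exp_neg_nat_mul 0 ht
    exact (h2.add h3).congr fun k => by ring
  refine lt_of_le_of_lt (ENNReal.tsum_le_tsum fun k => ?_) (h1.tsum_ofReal_lt_top)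
  rw [lintegral_const_mul _ (measurable_levelSup k), ENNReal.ofReal_mul (Real.exp_pos _).le]
  gcongr
  exact lintegral_levelSup_le hM k

/-- The domain asks for the integral of a norm, so for each `s` the supremum over `l` of `(1 -
e^{-μ_l s}) e^{-tΨ(μ_l)}` must be controlled before integrating. Grouping the `l` by the integer
part `k` of `Ψ(μ_l)` bounds it by `∑ e^{-tk} levelSup M k s`, whose `M`-integral is at most `∑ (k +
1) e^{-tk}`. -/
theorem inDomain_of_coeffCLM (hB : ∀ x, IsSphereBM P (B x) x) (hM : IsSubLevyMeasure M)
    {F u : Lp ℝ 2 lam} {t : ℝ} (ht : 0 < t)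
    (hu : ∀ i, coeffCLM i u = (Real.exp (-t * laplaceExp M (eigMu i.1)) : ℂ) * coeffCLM i F) :
    InDomain M u := by
  have hmarkov : IsMarkovKernel transKer := isMarkovKernel_transKer hB
  have hle : ∀ s ∈ Set.Ioi (0 : ℝ), eLpNorm (fun x => heatOp s u x - u x) 2 lam ≤
      (∑' k : ℕ, ENNReal.ofReal (Real.exp (-t * k)) * levelSup M k s) * ‖F‖ₑ := by
    intro s hs
    have hs' : 0 < s.toNNReal := Real.toNNReal_pos.2 hs
    have h1 := eLpNorm_heatOp_sub hB hs' u
    rw [Real.coe_toNNReal _ (le_of_lt hs)] at h1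
    have hfin := tsum_levelSup_ne_top (M := M) ht s
    rw [h1, ← ofReal_norm, ← ofReal_norm, ← ENNReal.ofReal_toReal hfin,
      ← ENNReal.ofReal_mul ENNReal.toReal_nonneg]
    refine ENNReal.ofReal_le_ofReal (norm_le_of_coeffCLM hB ENNReal.toReal_nonneg fun i => ?_)
    set Ψ := laplaceExp M (eigMu i.1) with hΨ
    have hΨ0 : 0 ≤ Ψ := laplaceExp_nonneg (eigMu_nonneg i.1)
    have hexp1 : Real.exp (-eigMu i.1 * s) ≤ 1 := by
      have := mul_nonneg (eigMu_nonneg i.1) (le_of_lt hs)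
      exact Real.exp_le_one_iff.2 (by linarith)
    have h2 : coeffCLM i (subLp (Measure.dirac s.toNNReal) u - u) =
        ((-((1 - Real.exp (-eigMu i.1 * s)) * Real.exp (-t * Ψ)) : ℝ) : ℂ) * coeffCLM i F := by
      rw [map_sub, coeffCLM_subLp_dirac hB, hu, Real.coe_toNNReal _ (le_of_lt hs),
        show -s * eigMu i.1 = -eigMu i.1 * s by ring]
      push_cast
      ring
    rw [h2, norm_mul, Complex.norm_real, norm_neg, Real.norm_of_nonneg
      (mul_nonneg (by linarith) (Real.exp_pos _).le)]
    refine mul_le_mul_of_nonneg_right ?_ (norm_nonneg _)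
    rw [← ENNReal.ofReal_le_iff_le_toReal hfin]
    refine le_trans ?_ (ENNReal.le_tsum ⌊Ψ⌋₊)
    rw [mul_comm, ENNReal.ofReal_mul (Real.exp_pos _).le]
    gcongr ?_ * ?_
    · refine ENNReal.ofReal_le_ofReal (Real.exp_le_exp.2 ?_)
      nlinarith [Nat.floor_le hΨ0]
    · exact le_iSup (fun l : {l : ℕ // laplaceExp M (eigMu l) < (⌊Ψ⌋₊ : ℝ) + 1} =>
        ENNReal.ofReal (1 - Real.exp (-eigMu l * s))) ⟨i.1, Nat.lt_floor_add_one Ψ⟩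
  refine lt_of_le_of_lt (setLIntegral_mono' measurableSet_Ioi hle) ?_
  rw [lintegral_mul_const' _ _ enorm_ne_top]
  exact ENNReal.mul_lt_top (lintegral_tsum_levelSup_lt_top hM ht) enorm_lt_top

theorem abs_exp_sub_one_sub_le (x : ℝ) : |Real.exp x - 1 - x| ≤ x ^ 2 * Real.exp |x| := by
  have h1 := Real.add_one_le_exp x
  have h2 := Real.add_one_le_exp (-x)
  have h3 : (1 - x) * Real.exp x ≤ 1 := by
    have := mul_le_mul_of_nonneg_right h2 (Real.exp_pos x).le
    rw [← Real.exp_add] at this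
    simp at this
    linarith
  have h4 : 1 ≤ Real.exp |x| := Real.one_le_exp (abs_nonneg x)
  rw [abs_of_nonneg (by linarith)]
  rcases le_total 0 x with h | h
  · rw [abs_of_nonneg h] at h4 ⊢
    nlinarith
  · nlinarith [sq_nonneg x]

theorem sq_mul_exp_neg_le {a ψ : ℝ} (ha : 0 < a) (hψ : 0 ≤ ψ) :
    ψ ^ 2 * Real.exp (-a * ψ) ≤ 2 / a ^ 2 := by
  have h1 := Real.quadratic_le_exp_of_nonneg (mul_nonneg ha.le hψ)
  rw [neg_mul, Real.exp_neg, ← div_eq_mul_inv, div_le_div_iff₀ (Real.exp_pos _) (by positivity)]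
  nlinarith [mul_nonneg ha.le hψ]

/-- Uniformity in `ψ` is the point: it makes the solution differentiable in `L²` although the
multipliers `Ψ(μ_l)` may be unbounded. Half of the decay `e^{-tψ}` absorbs `e^{|h|ψ}`, the other
half absorbs `ψ²`. -/
theorem exp_remainder_le {t h ψ : ℝ} (ht : 0 < t) (hh : |h| ≤ t / 2) (hψ : 0 ≤ ψ) :
    |Real.exp (-(t + h) * ψ) - Real.exp (-t * ψ) + h * ψ * Real.exp (-t * ψ)|
      ≤ 8 / t ^ 2 * |h| ^ 2 := by
  have h1 : Real.exp (-(t + h) * ψ) - Real.exp (-t * ψ) + h * ψ * Real.exp (-t * ψ)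
      = Real.exp (-t * ψ) * (Real.exp (-(h * ψ)) - 1 - -(h * ψ)) := by
    rw [show -(t + h) * ψ = -t * ψ + -(h * ψ) by ring, Real.exp_add]
    ring
  rw [h1, abs_mul, abs_of_pos (Real.exp_pos _)]
  calc _ ≤ Real.exp (-t * ψ) * ((-(h * ψ)) ^ 2 * Real.exp |-(h * ψ)|) := by
        gcongr
        exact abs_exp_sub_one_sub_le _
    _ ≤ Real.exp (-t * ψ) * ((-(h * ψ)) ^ 2 * Real.exp (t / 2 * ψ)) := by
        gcongr
        rw [abs_neg, abs_mul, abs_of_nonneg hψ]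
        gcongr
    _ = |h| ^ 2 * (ψ ^ 2 * Real.exp (-(t / 2) * ψ)) := by
        rw [show -t * ψ = -(t / 2) * ψ + -(t / 2 * ψ) by ring, Real.exp_add, Real.exp_neg (t / 2 * ψ),
          sq_abs]
        field_simp
    _ ≤ |h| ^ 2 * (2 / (t / 2) ^ 2) := by
        gcongr
        exact sq_mul_exp_neg_le (by positivity) hψ
    _ = _ := by field_simp; ring

theorem isCauchySolution_of_coeffCLM (hB : ∀ x, IsSphereBM P (B x) x) (hM : IsSubLevyMeasure M)
    {F : Lp ℝ 2 lam} {f : S2 → ℝ} (hF : F =ᵐ[lam] f) {u : ℝ≥0 → Lp ℝ 2 lam}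
    (hu : ∀ t i, coeffCLM i (u t)
      = (Real.exp (-(t : ℝ) * laplaceExp M (eigMu i.1)) : ℂ) * coeffCLM i F) :
    IsCauchySolution M f u where
  continuous := by
    have hb : ∀ t i, ‖coeffCLM i (u t)‖ ≤ ‖coeffCLM i F‖ := by
      intro t i
      rw [hu, norm_mul, Complex.norm_real, Real.norm_of_nonneg (Real.exp_pos _).le]
      refine mul_le_of_le_one_left (norm_nonneg _) (Real.exp_le_one_iff.2 ?_)
      have := mul_nonneg t.2 (laplaceExp_nonneg (M := M) (eigMu_nonneg i.1))
      simpa using this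
    rw [continuous_iff_continuousAt]
    intro t
    refine tendsto_of_coeffCLM hB hb (hb t) fun i => ?_
    simp_rw [hu]
    have : Continuous fun t : ℝ≥0 =>
      (Real.exp (-(t : ℝ) * laplaceExp M (eigMu i.1)) : ℂ) * coeffCLM i F := by fun_prop
    exact this.tendsto t
  initial := by
    have : u 0 = F := eq_of_coeffCLM hB fun i => by rw [hu]; simp
    rw [this]
    exact hF
  inDomain := fun t ht => inDomain_of_coeffCLM hB hM (NNReal.coe_pos.2 ht) (hu t)
  hasDeriv := by
    intro t ht
    have ht' : (0 : ℝ) < t := ht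
    obtain ⟨W, hW, hWc⟩ := (inDomain_of_coeffCLM hB hM ht' (hu t)).exists_fracOp hB hM
    refine ⟨W, hW, ?_⟩
    rw [hasDerivAt_iff_isLittleO]
    refine Asymptotics.IsBigO.trans_isLittleO (Asymptotics.IsBigO.of_bound (8 / (t : ℝ) ^ 2 * ‖F‖) ?_)
      (Asymptotics.isLittleO_pow_sub_sub (t : ℝ) (show 1 < 2 by norm_num))
    -- Within `t / 2` of `t` the remainder estimate applies and `r` is nonnegative, so `toNNReal`
    -- does not truncate.
    filter_upwards [Metric.closedBall_mem_nhds (t : ℝ) (half_pos ht')] with r hr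
    rw [Metric.mem_closedBall, Real.dist_eq] at hr
    have hr0 : 0 ≤ r := by linarith [(abs_le.1 hr).1]
    rw [norm_pow, norm_norm, mul_right_comm]
    refine norm_le_of_coeffCLM hB (by positivity) fun i => ?_
    have h1 : coeffCLM i (u r.toNNReal - u (t : ℝ).toNNReal - (r - (t : ℝ)) • W) =
        ((Real.exp (-(t + (r - t)) * laplaceExp M (eigMu i.1))
          - Real.exp (-t * laplaceExp M (eigMu i.1))
          + (r - t) * laplaceExp M (eigMu i.1) * Real.exp (-t * laplaceExp M (eigMu i.1)) : ℝ) : ℂ)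
          * coeffCLM i F := by
      rw [map_sub, map_sub, map_smul, hWc, Real.toNNReal_coe, hu, hu, Real.coe_toNNReal _ hr0,
        add_sub_cancel, Complex.real_smul]
      push_cast
      ring
    rw [h1, norm_mul, Complex.norm_real]
    gcongr
    exact exp_remainder_le ht' hr (laplaceExp_nonneg (eigMu_nonneg i.1))

/-- A continuous functional commutes with the derivative and `𝔻_M` is diagonal, so each coefficient
solves `c' = -Ψ c`; the integrating factor `e^{sΨ}` makes the product constant. -/
theorem coeffCLM_of_isCauchySolution (hB : ∀ x, IsSphereBM P (B x) x) (hM : IsSubLevyMeasure M)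
    {f : S2 → ℝ} {v : ℝ≥0 → Lp ℝ 2 lam} (hv : IsCauchySolution M f v) (t : ℝ≥0) (i : HarmIdx) :
    coeffCLM i (v t)
      = (Real.exp (-(t : ℝ) * laplaceExp M (eigMu i.1)) : ℂ) * coeffCLM i (v 0) := by
  set Ψ := laplaceExp M (eigMu i.1) with hΨ
  set φ : ℝ → ℂ := fun s => (Real.exp (s * Ψ) : ℂ) * coeffCLM i (v s.toNNReal) with hφ
  have hvc : Continuous fun s : ℝ => coeffCLM i (v s.toNNReal) :=
    (coeffCLM i).continuous.comp (hv.continuous.comp continuous_real_toNNReal)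
  have hcont : Continuous φ := by fun_prop
  have hderiv : ∀ s : ℝ, 0 < s → HasDerivAt φ 0 s := by
    intro s hs
    have hs' : 0 < s.toNNReal := Real.toNNReal_pos.2 hs
    obtain ⟨W, hW, hWd⟩ := hv.hasDeriv _ hs'
    obtain ⟨W', hW', hWc⟩ := (hv.inDomain _ hs').exists_fracOp hB hM
    have hWW : W = W' := Lp.ext (hW.trans hW'.symm)
    rw [Real.coe_toNNReal _ hs.le] at hWd
    have h1 : HasDerivAt (fun r : ℝ => coeffCLM i (v r.toNNReal)) (coeffCLM i W) s :=
      (coeffCLM i).hasFDerivAt.comp_hasDerivAt s hWd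
    have h2 : HasDerivAt (fun r : ℝ => (Real.exp (r * Ψ) : ℂ)) ((Real.exp (s * Ψ) * Ψ : ℝ) : ℂ) s := by
      have h3 : HasDerivAt (fun r : ℝ => Real.exp (r * Ψ)) (Real.exp (s * Ψ) * Ψ) s := by
        have := ((hasDerivAt_id s).mul_const Ψ).exp
        simpa using this
      exact h3.ofReal_comp
    refine (h2.mul h1).congr_deriv ?_
    rw [hWW, hWc]
    push_cast
    ring
  have hconst : φ t = φ 0 := by
    rcases t.2.eq_or_lt with h | h
    · exact congrArg φ h.symm
    -- The equation holds only for positive times; continuity at `0` then reaches the initial value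
    -- as `ε → 0`.
    have h1 : ∀ ε ∈ Set.Ioo (0 : ℝ) t, φ t = φ ε := by
      intro ε hε
      refine constant_of_has_deriv_right_zero hcont.continuousOn (fun s hs => ?_) (t : ℝ)
        ⟨hε.2.le, le_rfl⟩
      exact (hderiv s (hε.1.trans_le hs.1)).hasDerivWithinAt
    have h2 : Tendsto φ (𝓝[>] 0) (𝓝 (φ 0)) := (hcont.tendsto 0).mono_left nhdsWithin_le_nhds
    refine tendsto_nhds_unique (tendsto_const_nhds.congr' ?_) h2
    filter_upwards [Ioo_mem_nhdsGT h] with ε hε using h1 ε hε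
  simp only [hφ, Real.toNNReal_coe, zero_mul, Real.exp_zero, Complex.ofReal_one, one_mul,
    Real.toNNReal_zero] at hconst
  rw [← hconst, ← mul_assoc, ← Complex.ofReal_mul, ← Real.exp_add]
  simp

theorem isCauchySolution_unique (hB : ∀ x, IsSphereBM P (B x) x) (hM : IsSubLevyMeasure M)
    {f : S2 → ℝ} {u v : ℝ≥0 → Lp ℝ 2 lam} (hu : IsCauchySolution M f u)
    (hv : IsCauchySolution M f v) : v = u := by
  funext t
  refine eq_of_coeffCLM hB fun i => ?_
  rw [coeffCLM_of_isCauchySolution hB hM hu, coeffCLM_of_isCauchySolution hB hM hv,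
    Lp.ext (hv.initial.trans hu.initial.symm)]

end Cauchy

/-! ### The closed linear span of a Gaussian process -/

section GaussianSpan

variable {Ω : Type*} [mΩ : MeasurableSpace Ω] {P : Measure Ω}
  {ι : Type*} {X : ι → Ω → ℝ}

/-- The closed linear span in `L²(P)` of a family of square integrable random variables. -/
def closedSpan (hX : ∀ i, MemLp (X i) 2 P) : Submodule ℝ (Lp ℝ 2 P) :=
  (Submodule.span ℝ (Set.range fun i => (hX i).toLp)).topologicalClosure

variable [IsProbabilityMeasure P]

theorem lipschitzWith_integral_exp (t : ℝ) :
    LipschitzWith ‖t‖₊ fun u : Lp ℝ 2 P => ∫ ω, Complex.exp (t * u ω * Complex.I) ∂P := by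
  intro u v
  have hi : ∀ w : Lp ℝ 2 P, Integrable (fun ω => Complex.exp (t * w ω * Complex.I)) P := fun w => by
    refine Integrable.of_bound (C := 1) ?_ (Eventually.of_forall fun ω => ?_)
    · have := (Lp.aestronglyMeasurable w).aemeasurable
      exact (by fun_prop : AEMeasurable (fun ω => Complex.exp (t * w ω * Complex.I)) P).aestronglyMeasurable
    · rw [← Complex.ofReal_mul, Complex.norm_exp_ofReal_mul_I]
  have hb : ∀ a b : ℝ, ‖Complex.exp (t * a * Complex.I) - Complex.exp (t * b * Complex.I)‖ₑ
      ≤ ‖t‖₊ * ‖a - b‖ₑ := fun a b => by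
    have h1 : Complex.exp (t * a * Complex.I) - Complex.exp (t * b * Complex.I)
        = Complex.exp ((t * b : ℝ) * Complex.I) * (Complex.exp (Complex.I * (t * (a - b) : ℝ)) - 1) := by
      rw [mul_sub, mul_one, ← Complex.exp_add]
      push_cast
      ring_nf
    rw [h1, enorm_mul, ← ofReal_norm (Complex.exp _), Complex.norm_exp_ofReal_mul_I,
      ENNReal.ofReal_one, one_mul]
    refine Real.enorm_exp_I_mul_ofReal_sub_one_le.trans ?_
    rw [enorm_mul]
    rfl
  rw [edist_eq_enorm_sub, ← integral_sub (hi u) (hi v)]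
  calc _ ≤ ∫⁻ ω, ‖t‖₊ * ‖(u - v : Lp ℝ 2 P) ω‖ₑ ∂P := by
        refine (enorm_integral_le_lintegral_enorm _).trans (lintegral_mono_ae ?_)
        filter_upwards [Lp.coeFn_sub u v] with ω hω
        rw [hω]
        exact hb _ _
    _ = ‖t‖₊ * eLpNorm (u - v : Lp ℝ 2 P) 1 P := by
        rw [lintegral_const_mul' _ _ ENNReal.coe_ne_top, eLpNorm_one_eq_lintegral_enorm]
    _ ≤ ‖t‖₊ * eLpNorm (u - v : Lp ℝ 2 P) 2 P := by
        gcongr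
        exact eLpNorm_le_eLpNorm_of_exponent_le (by norm_num) (Lp.aestronglyMeasurable _)
    _ = _ := by
        rw [edist_eq_enorm_sub, Lp.enorm_def]

theorem hasGaussianLaw_of_mem_span (hX : ∀ i, MemLp (X i) 2 P) (hG : IsGaussianProcess X P)
    (h0 : ∀ i, ∫ ω, X i ω ∂P = 0) {u : Lp ℝ 2 P}
    (hu : u ∈ Submodule.span ℝ (Set.range fun i => (hX i).toLp)) :
    HasGaussianLaw u P ∧ ∫ ω, u ω ∂P = 0 := by
  obtain ⟨c, rfl⟩ := Finsupp.mem_span_range_iff_exists_finsupp.1 hu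
  have hae : (fun ω => ∑ i ∈ c.support, c i • X i ω) =ᵐ[P]
      (c.sum fun i a => a • (hX i).toLp : Lp ℝ 2 P) := by
    have h1 : ∀ᵐ ω ∂P, ∀ i ∈ c.support, (c i • (hX i).toLp : Lp ℝ 2 P) ω = c i • X i ω := by
      rw [Finset.eventually_all]
      intro i _
      filter_upwards [Lp.coeFn_smul (c i) (hX i).toLp, (hX i).coeFn_toLp] with ω h1 h2
      rw [h1, Pi.smul_apply, h2]
    filter_upwards [h1, Lp.coeFn_finsetSum c.support fun i => c i • (hX i).toLp] with ω h1 h2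
    rw [Finsupp.sum, h2, Finset.sum_apply]
    exact (Finset.sum_congr rfl h1).symm
  refine ⟨((hG.smul c).hasGaussianLaw_fun_sum (I := c.support)).congr hae, ?_⟩
  rw [← integral_congr_ae hae, integral_finsetSum]
  · simp [integral_const_mul, h0]
  · exact fun i _ => ((hX i).integrable (by norm_num)).smul (c i)

/-- The elements of the closed linear span of a centred Gaussian process are Gaussian. -/
theorem map_eq_gaussianReal_of_mem_closedSpan (hX : ∀ i, MemLp (X i) 2 P)
    (hG : IsGaussianProcess X P) (h0 : ∀ i, ∫ ω, X i ω ∂P = 0) {u : Lp ℝ 2 P}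
    (hu : u ∈ closedSpan hX) : P.map u = gaussianReal 0 (‖u‖ ^ 2).toNNReal := by
  have hchar : ∀ (w : Lp ℝ 2 P) (t : ℝ),
      charFun (P.map w) t = ∫ ω, Complex.exp (t * w ω * Complex.I) ∂P := fun w t => by
    rw [charFun_apply_real, integral_map (Lp.aestronglyMeasurable w).aemeasurable
      (by fun_prop : Measurable fun x : ℝ => Complex.exp (t * x * Complex.I)).aestronglyMeasurable]
  have key : ∀ t : ℝ, ∫ ω, Complex.exp (t * u ω * Complex.I) ∂P
      = charFun (gaussianReal 0 (‖u‖ ^ 2).toNNReal) t := by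
    intro t
    -- Both the characteristic function and the variance `‖w‖²` are continuous on `L²`, so the
    -- Gaussian identity passes from the span to its closure.
    have hcl : IsClosed {w : Lp ℝ 2 P | ∫ ω, Complex.exp (t * w ω * Complex.I) ∂P
        = charFun (gaussianReal 0 (‖w‖ ^ 2).toNNReal) t} := by
      refine isClosed_eq (lipschitzWith_integral_exp t).continuous ?_
      simp_rw [charFun_gaussianReal]
      fun_prop
    refine closure_minimal (fun w hw => ?_) hcl hu
    obtain ⟨hw1, hw2⟩ := hasGaussianLaw_of_mem_span hX hG h0 hw
    have hvar : Var[w; P] = ‖w‖ ^ 2 := by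
      rw [variance_of_integral_eq_zero (Lp.aestronglyMeasurable w).aemeasurable hw2,
        ← real_inner_self_eq_norm_sq, L2.inner_def]
      congr 1; ext ω
      simp [pow_two]
    have := hw1.map_eq_gaussianReal
    rw [hw2, hvar] at this
    rw [Set.mem_ofPred_eq, ← hchar, this]
  have := Measure.isProbabilityMeasure_map (μ := P) (Lp.aestronglyMeasurable u).aemeasurable
  exact Measure.ext_of_charFun (funext fun t => (hchar u t).trans (key t))

/-- A family of random variables in the closed linear span of a centred Gaussian process is a
Gaussian process. -/
theorem isGaussianProcess_of_mem_closedSpan (hX : ∀ i, MemLp (X i) 2 P)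
    (hG : IsGaussianProcess X P) (h0 : ∀ i, ∫ ω, X i ω ∂P = 0) {κ : Type*} {Z : κ → Ω → ℝ}
    (hZ : ∀ k, ∃ u ∈ closedSpan hX, u =ᵐ[P] Z k) : IsGaussianProcess Z P := by
  classical
  choose u hu hZu using hZ
  have hmeas : ∀ k, AEMeasurable (Z k) P := fun k =>
    (Lp.aestronglyMeasurable (u k)).aemeasurable.congr (hZu k)
  refine ⟨fun I => ⟨isGaussian_of_map_eq_gaussianReal fun L => ?_⟩⟩
  -- A finite-dimensional law is Gaussian once every linear functional of it is, and the functional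
  -- `L` is represented by this element of the closed span.
  set w : Lp ℝ 2 P := ∑ k : I, L (Pi.single k 1) • u k with hw
  have hwm : w ∈ closedSpan hX := Submodule.sum_mem _ fun k _ => Submodule.smul_mem _ _ (hu k)
  have hae : (w : Ω → ℝ) =ᵐ[P] fun ω => L (I.restrict (Z · ω)) := by
    have h1 : ∀ᵐ ω ∂P, ∀ k : I, (L (Pi.single k 1) • u k : Lp ℝ 2 P) ω
        = L (Pi.single k 1) * Z k ω := by
      rw [ae_all_iff]
      intro k
      filter_upwards [Lp.coeFn_smul (L (Pi.single k 1)) (u k), hZu k] with ω h1 h2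
      rw [h1, Pi.smul_apply, h2, smul_eq_mul]
    filter_upwards [h1, Lp.coeFn_finsetSum Finset.univ fun k : I => L (Pi.single k 1) • u k]
      with ω h1 h2
    rw [hw, h2, Finset.sum_apply, Finset.sum_congr rfl fun k _ => h1 k]
    conv_rhs => rw [pi_eq_sum_univ' (I.restrict (Z · ω)), map_sum]
    refine Finset.sum_congr rfl fun k _ => ?_
    rw [map_smul, smul_eq_mul, mul_comm, Finset.restrict]
  refine ⟨0, (‖w‖ ^ 2).toNNReal, ?_⟩
  rw [← map_eq_gaussianReal_of_mem_closedSpan hX hG h0 hwm, Measure.map_congr hae,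
    AEMeasurable.map_map_of_aemeasurable L.continuous.measurable.aemeasurable]
  · rfl
  · exact aemeasurable_pi_lambda _ fun k => hmeas k

end GaussianSpan

/-- The classes with an `m`-measurable representative form a closed subspace of `L²`. Applied to `m
= σ(T)`, this bypasses joint measurability, which is assumed only for `𝓔`. -/
theorem aestronglyMeasurable_of_mem_closedSpan {Ω ι : Type*} {m : MeasurableSpace Ω}
    [mΩ : MeasurableSpace Ω] {P : Measure Ω} {X : ι → Ω → ℝ} (hX : ∀ i, MemLp (X i) 2 P)
    (hm : m ≤ mΩ) (hXm : ∀ i, Measurable[m] (X i)) {u : Lp ℝ 2 P}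
    (hu : u ∈ closedSpan hX) : AEStronglyMeasurable[m] u P := by
  have h1 : Submodule.span ℝ (Set.range fun i => (hX i).toLp) ≤ lpMeas ℝ ℝ m 2 P := by
    refine Submodule.span_le.2 ?_
    rintro _ ⟨i, rfl⟩
    refine mem_lpMeas_iff_aestronglyMeasurable.2 ⟨X i, (hXm i).stronglyMeasurable, ?_⟩
    exact (hX i).coeFn_toLp
  have h2 : IsClosed (lpMeas ℝ ℝ m 2 P : Set (Lp ℝ 2 P)) := isClosed_aestronglyMeasurable hm
  exact mem_lpMeas_iff_aestronglyMeasurable.1 (Submodule.topologicalClosure_minimal _ h1 h2 hu)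

/-! ### Averages of a random field -/

section Average

variable {Ω E : Type*} [mΩ : MeasurableSpace Ω] [MeasurableSpace E] {P : Measure Ω}
  [IsProbabilityMeasure P] {X : E → Ω → ℝ} {ν : Measure E}

theorem lintegral_enorm_sq_prod [IsFiniteMeasure ν] (hm : Measurable (Function.uncurry X)) {C : ℝ≥0∞}
    (hC : ∀ x, ∫⁻ ω, ‖X x ω‖ₑ ^ 2 ∂P = C) :
    ∫⁻ p, ‖Function.uncurry X p‖ₑ ^ 2 ∂(ν.prod P) = C * ν Set.univ := by
  rw [lintegral_prod _ (by fun_prop)]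
  simp [Function.uncurry, hC]

theorem memLp_uncurry [IsFiniteMeasure ν] (hm : Measurable (Function.uncurry X)) {C : ℝ≥0∞} (hCt : C < ∞)
    (hC : ∀ x, ∫⁻ ω, ‖X x ω‖ₑ ^ 2 ∂P = C) : MemLp (Function.uncurry X) 2 (ν.prod P) := by
  rw [memLp_two_iff_integrable_sq hm.aestronglyMeasurable]
  refine ⟨(hm.pow_const 2).aestronglyMeasurable, ?_⟩
  simp only [HasFiniteIntegral, enorm_pow]
  rw [lintegral_enorm_sq_prod hm hC]
  exact ENNReal.mul_lt_top hCt (measure_lt_top _ _)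

theorem ae_memLp_path [IsFiniteMeasure ν] (hm : Measurable (Function.uncurry X)) {C : ℝ≥0∞} (hCt : C < ∞)
    (hC : ∀ x, ∫⁻ ω, ‖X x ω‖ₑ ^ 2 ∂P = C) : ∀ᵐ ω ∂P, MemLp (fun x => X x ω) 2 ν := by
  have h1 := ((memLp_uncurry (ν := ν) hm hCt hC).integrable_sq).swap.prod_right_ae
  filter_upwards [h1] with ω hω
  have hmω : Measurable fun x => X x ω := hm.comp measurable_prodMk_right
  exact (memLp_two_iff_integrable_sq hmω.aestronglyMeasurable).2 hω

/-- The average of a square integrable random field lies in its closed linear span. -/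
theorem exists_mem_closedSpan_average [IsProbabilityMeasure ν] (hm : Measurable (Function.uncurry X))
    {C : ℝ≥0∞} (hCt : C < ∞) (hC : ∀ x, ∫⁻ ω, ‖X x ω‖ₑ ^ 2 ∂P = C)
    (hX : ∀ x, MemLp (X x) 2 P) :
    ∃ u ∈ closedSpan hX, u =ᵐ[P] fun ω => ∫ x, X x ω ∂ν := by
  have h2 := memLp_uncurry (ν := ν) hm hCt hC
  have hG : StronglyMeasurable fun ω => ∫ x, X x ω ∂ν :=
    hm.stronglyMeasurable.integral_prod_left
  have hG2 : MemLp (fun ω => ∫ x, X x ω ∂ν) 2 P := by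
    refine (memLp_two_iff_integrable_sq hG.aestronglyMeasurable).2 ?_
    refine Integrable.mono' h2.integrable_sq.swap.integral_prod_left
      (hG.pow 2).aestronglyMeasurable ?_
    filter_upwards [ae_memLp_path (ν := ν) hm hCt hC] with ω hω
    rw [Real.norm_of_nonneg (sq_nonneg _)]
    exact sq_integral_le hω
  refine ⟨hG2.toLp, ?_, hG2.coeFn_toLp⟩
  -- By duality it suffices that every `v` orthogonal to all `X x` is orthogonal to the average,
  -- which is Fubini; no regularity of `X` in `x` is needed.
  rw [closedSpan, ← Submodule.orthogonal_orthogonal_eq_closure, Submodule.mem_orthogonal]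
  intro v hv
  have hv' : ∀ x, ∫ ω, X x ω * v ω ∂P = 0 := fun x => by
    have h3 := (Submodule.mem_orthogonal _ _).1 hv (hX x).toLp (Submodule.subset_span ⟨x, rfl⟩)
    rw [L2.inner_def] at h3
    rw [← h3]
    refine integral_congr_ae ?_
    filter_upwards [(hX x).coeFn_toLp] with ω hω
    simp [hω, mul_comm]
  have hi : Integrable (fun p : E × Ω => X p.1 p.2 * v p.2) (ν.prod P) :=
    MemLp.integrable_mul (p := 2) (q := 2) h2
      ((Lp.memLp v).comp_measurePreserving (measurePreserving_snd (μ := ν) (ν := P)))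
  rw [L2.inner_def]
  calc _ = ∫ ω, ∫ x, X x ω * v ω ∂ν ∂P := by
        refine integral_congr_ae ?_
        filter_upwards [hG2.coeFn_toLp] with ω hω
        rw [hω, integral_mul_const]
        simp
    _ = ∫ x, ∫ ω, X x ω * v ω ∂P ∂ν := (integral_integral_swap hi).symm
    _ = 0 := by simp [hv']

end Average

/-! ### Isotropic fields -/

/-- The half-turn about a line negates a plane, so its determinant is `(-1)² = 1`. About the
bisector `x + y` it sends `x` to `y`; if `y = -x`, any axis orthogonal to `x` will do. -/
theorem exists_rotate_eq (x y : S2) : ∃ g : E3 ≃ₗᵢ[ℝ] E3,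
    LinearMap.det (g.toLinearEquiv : E3 →ₗ[ℝ] E3) = 1 ∧ rotate g x = y := by
  have hx : ‖(x : E3)‖ = 1 := norm_eq_of_mem_sphere x
  have hy : ‖(y : E3)‖ = 1 := norm_eq_of_mem_sphere y
  have hdet : ∀ w : E3, w ≠ 0 →
      LinearMap.det (((ℝ ∙ w).reflection.toLinearEquiv : E3 ≃ₗ[ℝ] E3) : E3 →ₗ[ℝ] E3) = 1 := fun w hw => by
    have h1 := (ℝ ∙ w).det_reflection
    have h2 := (ℝ ∙ w).finrank_add_finrank_orthogonal
    rw [finrank_span_singleton hw, finrank_E3] at h2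
    have h3 : Module.finrank ℝ (ℝ ∙ w)ᗮ = 2 := by omega
    rw [h3] at h1
    simpa using h1
  by_cases hxy : (x : E3) + y = 0
  · have hn : ∃ w : E3, w ≠ 0 ∧ inner ℝ w (x : E3) = 0 := by
      have h2 := (ℝ ∙ (x : E3)).finrank_add_finrank_orthogonal
      have hx0 : (x : E3) ≠ 0 := by
        intro h; simp [h] at hx
      rw [finrank_span_singleton hx0, finrank_E3] at h2
      have : Nontrivial (ℝ ∙ (x : E3))ᗮ := Module.nontrivial_of_finrank_pos (R := ℝ) (by omega)
      obtain ⟨⟨w, hw⟩, hw0⟩ := exists_ne (0 : (ℝ ∙ (x : E3))ᗮ)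
      refine ⟨w, fun h => hw0 (Subtype.ext h), ?_⟩
      rw [real_inner_comm]
      exact Submodule.mem_orthogonal_singleton_iff_inner_right.1 hw
    obtain ⟨w, hw0, hwx⟩ := hn
    refine ⟨(ℝ ∙ w).reflection, hdet w hw0, Subtype.ext ?_⟩
    change (ℝ ∙ w).reflection (x : E3) = y
    rw [Submodule.reflection_singleton_apply, hwx]
    simpa using (eq_neg_of_add_eq_zero_right hxy).symm
  · refine ⟨(ℝ ∙ ((x : E3) + y)).reflection, hdet _ hxy, Subtype.ext ?_⟩
    change (ℝ ∙ ((x : E3) + y)).reflection (x : E3) = y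
    rw [Submodule.reflection_singleton_apply]
    have h0 : ‖(x : E3) + y‖ ^ 2 ≠ 0 := pow_ne_zero _ (norm_ne_zero_iff.2 hxy)
    have h1 : inner ℝ ((x : E3) + y) (x : E3) = ‖(x : E3) + y‖ ^ 2 / 2 := by
      rw [norm_add_sq_real, hx, hy, inner_add_left, real_inner_self_eq_norm_sq, hx,
        real_inner_comm]
      ring
    rw [h1]
    have h2 : ‖(x : E3) + y‖ ^ 2 / 2 / ((‖(x : E3) + y‖ : ℝ) : ℝ) ^ 2 = 1 / 2 := by
      field_simp
    have h3 : (2 : ℕ) • ((‖(x : E3) + y‖ ^ 2 / 2 / ((‖(x : E3) + y‖ : ℝ) : ℝ) ^ 2)) = 1 := by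
      rw [h2]; norm_num
    rw [← smul_assoc]
    exact (congrArg (fun c : ℝ => c • ((x : E3) + y) - (x : E3)) h3).trans
      (by rw [one_smul, add_sub_cancel_left])

section Isotropic

variable {Ω : Type*} [mΩ : MeasurableSpace Ω] {P : Measure Ω} {T : S2 → Ω → ℝ}

theorem IsIsotropicGaussianField.memLp (hT : IsIsotropicGaussianField P T) (x : S2) :
    MemLp (T x) 2 P := (hT.gaussian.hasGaussianLaw_eval x).memLp_two

/-- Rotations act transitively and preserve the law, so the second moment is the same everywhere. It
is through this constant that isotropy enters. -/
theorem IsIsotropicGaussianField.exists_lintegral_enorm_sq_eq (hT : IsIsotropicGaussianField P T)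
    (hm : ∀ x, Measurable (T x)) : ∃ C < ∞, ∀ x, ∫⁻ ω, ‖T x ω‖ₑ ^ 2 ∂P = C := by
  have x₀ : S2 := ⟨EuclideanSpace.single 0 1, by simp⟩
  refine ⟨∫⁻ ω, ‖T x₀ ω‖ₑ ^ 2 ∂P, ?_, fun x => ?_⟩
  · have := (hT.memLp x₀).integrable_sq.2
    simpa [HasFiniteIntegral, enorm_pow] using this
  · obtain ⟨g, hg, rfl⟩ := exists_rotate_eq x₀ x
    have h1 := congrArg (fun μ : Measure (S2 → ℝ) => ∫⁻ f, ‖f x₀‖ₑ ^ 2 ∂μ) (hT.isotropic g hg)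
    beta_reduce at h1
    rwa [lintegral_map (by fun_prop) (measurable_pi_lambda _ fun y => hm _),
      lintegral_map (by fun_prop) (measurable_pi_lambda _ fun y => hm _)] at h1

end Isotropic

/-! ### The solution started from a square integrable function -/

section Evolution

variable {Ω : Type*} [mΩ : MeasurableSpace Ω] {P : Measure Ω} [IsProbabilityMeasure P]
  {M : Measure ℝ} {D : ℝ≥0 → Ω → ℝ≥0} {B : S2 → ℝ≥0 → Ω → S2}

/-- The transition operator `ℙ_t f(x) = E f(B^x_{D_t})` of the subordinate Brownian motion. -/
def evolve (P : Measure Ω) (D : ℝ≥0 → Ω → ℝ≥0) (t : ℝ≥0) (f : S2 → ℝ) (x : S2) : ℝ :=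
  ∫ y, f y ∂subKer (P.map (D t)) x

theorem evolve_zero (hB : ∀ x, IsSphereBM P (B x) x) (hD : IsSubordinator P M D) (f : S2 → ℝ)
    (x : S2) : evolve P D 0 f x = f x := by
  have hmarkov : IsMarkovKernel transKer := isMarkovKernel_transKer hB
  have h : P.map (D 0) = Measure.dirac 0 := by
    rw [Measure.map_congr hD.start, Measure.map_const, measure_univ, one_smul]
  rw [evolve, h, subKer_dirac, transKer_zero, integral_dirac]

theorem coeff_evolve (hB : ∀ x, IsSphereBM P (B x) x) (hD : IsSubordinator P M D) {f : S2 → ℝ}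
    (hf : Measurable f) (hf2 : MemLp f 2 lam) (t : ℝ≥0) {l : ℕ} {m : ℤ} (hm : |m| ≤ l) :
    coeff (evolve P D t f) l m
      = Real.exp (-(t : ℝ) * laplaceExp M (eigMu l)) * coeff f l m := by
  have hmarkov : IsMarkovKernel transKer := isMarkovKernel_transKer hB
  have := Measure.isProbabilityMeasure_map (μ := P) (hD.measurable t).aemeasurable
  have := isMarkovKernel_subKer (P.map (D t))
  rw [← hD.integral_exp t (eigMu_nonneg l)]
  exact coeff_integral_kernel (isReversible_subKer _)
    (fun x => integral_sphHarm_subKer hB _ hm x) hf (hf2.integrable (by norm_num))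

theorem memLp_evolve (hB : ∀ x, IsSphereBM P (B x) x) (hD : IsSubordinator P M D) {f : S2 → ℝ}
    (hf : Measurable f) (hf2 : MemLp f 2 lam) (t : ℝ≥0) : MemLp (evolve P D t f) 2 lam := by
  have hmarkov : IsMarkovKernel transKer := isMarkovKernel_transKer hB
  have := Measure.isProbabilityMeasure_map (μ := P) (hD.measurable t).aemeasurable
  have := isMarkovKernel_subKer (P.map (D t))
  exact memLp_integral_kernel (isReversible_subKer _) hf hf2

theorem exists_isCauchySolution (hB : ∀ x, IsSphereBM P (B x) x) (hM : IsSubLevyMeasure M)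
    (hD : IsSubordinator P M D) {f : S2 → ℝ} (hf : Measurable f) (hf2 : MemLp f 2 lam) :
    ∃ u : ℝ≥0 → Lp ℝ 2 lam, IsCauchySolution M f u ∧ (∀ v, IsCauchySolution M f v → v = u) ∧
      ∀ t, u t =ᵐ[lam] evolve P D t f := by
  have hu : IsCauchySolution M f fun t => (memLp_evolve hB hD hf hf2 t).toLp := by
    refine isCauchySolution_of_coeffCLM hB hM hf2.coeFn_toLp fun t i => ?_
    rw [coeffCLM_toLp, coeffCLM_toLp, coeff_evolve hB hD hf hf2 t i.abs_le]
  exact ⟨_, hu, fun v hv => isCauchySolution_unique hB hM hu hv,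
    fun t => (memLp_evolve hB hD hf hf2 t).coeFn_toLp⟩

/-- The truncation error of the expansion of `ℙ_t f` in spherical harmonics. -/
def truncError (P : Measure Ω) (M : Measure ℝ) (D : ℝ≥0 → Ω → ℝ≥0) (t : ℝ≥0) (N : ℕ) (f : S2 → ℝ) :
    ℝ≥0∞ :=
  ∫⁻ x, ‖(evolve P D t f x : ℂ) - ∑ l ∈ Finset.range N,
    (Real.exp (-(t : ℝ) * laplaceExp M (eigMu l)) : ℂ) * component f l x‖ₑ ^ 2 ∂lam

theorem truncError_eq (hB : ∀ x, IsSphereBM P (B x) x) (hD : IsSubordinator P M D) {f : S2 → ℝ}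
    (hf : Measurable f) (hf2 : MemLp f 2 lam) (t : ℝ≥0) (N : ℕ) :
    truncError P M D t N f = ENNReal.ofReal
      (∑' i : HarmIdx, if i.1 < N then 0 else ‖coeff (evolve P D t f) i.1 i.2‖ ^ 2) := by
  have hg := memLp_evolve hB hD hf hf2 t
  have hcomp : ∀ l x, (Real.exp (-(t : ℝ) * laplaceExp M (eigMu l)) : ℂ) * component f l x
      = component (evolve P D t f) l x := fun l x => by
    rw [component, component, Finset.mul_sum]
    refine Finset.sum_congr rfl fun m hm => ?_
    rw [coeff_evolve hB hD hf hf2 t (abs_le.2 (Finset.mem_Icc.1 hm)), mul_assoc]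
  have hcont : Continuous fun x => ∑ l ∈ Finset.range N, component (evolve P D t f) l x := by
    unfold component
    exact continuous_finsetSum _ fun l _ => continuous_finsetSum _ fun m _ =>
      continuous_const.mul (continuous_sphHarm l m)
  rw [(hasSum_norm_sq_coeff_tail hB hg N).tsum_eq, truncError]
  simp_rw [hcomp]
  have h2 : MemLp (fun x => (evolve P D t f x : ℂ) - ∑ l ∈ Finset.range N,
      component (evolve P D t f) l x) 2 lam := hg.ofReal.sub (memLp_of_continuous hcont 2)
  rw [ofReal_integral_eq_lintegral_ofReal
    ((memLp_two_iff_integrable_sq_norm h2.aestronglyMeasurable).1 h2)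
    (Eventually.of_forall fun _ => sq_nonneg _)]
  refine lintegral_congr fun x => ?_
  rw [← ofReal_norm, ENNReal.ofReal_pow (norm_nonneg _)]

theorem summable_norm_sq_coeff_evolve (hB : ∀ x, IsSphereBM P (B x) x) (hD : IsSubordinator P M D)
    {f : S2 → ℝ} (hf : Measurable f) (hf2 : MemLp f 2 lam) (t : ℝ≥0) :
    Summable fun i : HarmIdx => ‖coeff (evolve P D t f) i.1 i.2‖ ^ 2 :=
  (hasSum_norm_sq_coeff hB (memLp_evolve hB hD hf hf2 t)).summable

/-- The multipliers are at most one, so Parseval for `f` bounds every tail. The bound is free of `N`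
and serves as majorant for dominated convergence in `ω`. -/
theorem truncError_le (hB : ∀ x, IsSphereBM P (B x) x) (hD : IsSubordinator P M D) {f : S2 → ℝ}
    (hf : Measurable f) (hf2 : MemLp f 2 lam) (t : ℝ≥0) (N : ℕ) :
    truncError P M D t N f ≤ ∫⁻ x, ‖f x‖ₑ ^ 2 ∂lam := by
  have h1 : ∫⁻ x, ‖f x‖ₑ ^ 2 ∂lam = ENNReal.ofReal (∫ x, f x ^ 2 ∂lam) := by
    rw [ofReal_integral_eq_lintegral_ofReal hf2.integrable_sq
      (Eventually.of_forall fun _ => sq_nonneg _)]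
    refine lintegral_congr fun x => ?_
    rw [← ofReal_norm, ← ENNReal.ofReal_pow (norm_nonneg _), Real.norm_eq_abs, sq_abs]
  have hsum := hasSum_norm_sq_coeff hB hf2
  rw [truncError_eq hB hD hf hf2, h1]
  refine ENNReal.ofReal_le_ofReal ?_
  refine hasSum_le (fun i => ?_)
    (hasSum_norm_sq_coeff_tail hB (memLp_evolve hB hD hf hf2 t) N).summable.hasSum hsum
  split_ifs
  · positivity
  · rw [coeff_evolve hB hD hf hf2 t i.abs_le, norm_mul, mul_pow]
    refine mul_le_of_le_one_left (by positivity) (pow_le_one₀ (norm_nonneg _) ?_)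
    rw [Complex.norm_real, Real.norm_of_nonneg (Real.exp_nonneg _), Real.exp_le_one_iff, neg_mul]
    exact neg_nonpos.2 (mul_nonneg t.2 (laplaceExp_nonneg (eigMu_nonneg _)))

theorem tendsto_truncError (hB : ∀ x, IsSphereBM P (B x) x) (hD : IsSubordinator P M D)
    {f : S2 → ℝ} (hf : Measurable f) (hf2 : MemLp f 2 lam) (t : ℝ≥0) :
    Tendsto (fun N => truncError P M D t N f) atTop (𝓝 0) := by
  simp_rw [truncError_eq hB hD hf hf2]
  rw [← ENNReal.ofReal_zero]
  refine (ENNReal.continuous_ofReal.tendsto 0).comp ?_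
  have h0 : ∑' _ : HarmIdx, (0 : ℝ) = 0 := tsum_zero
  conv => arg 3; rw [← h0]
  refine tendsto_tsum_of_dominated_convergence (summable_norm_sq_coeff_evolve hB hD hf hf2 t)
    (fun i => tendsto_const_nhds.congr' ?_) (Eventually.of_forall fun N i => ?_)
  · filter_upwards [eventually_gt_atTop i.1] with N hN
    rw [if_pos hN]
  · split_ifs
    · rw [norm_zero]; positivity
    · rw [Real.norm_of_nonneg (sq_nonneg _)]

end Evolution

/-! ### The evolution of a random field -/

section Field

variable {Ω : Type*} [mΩ : MeasurableSpace Ω] {P : Measure Ω} [IsProbabilityMeasure P]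
  {M : Measure ℝ} {D : ℝ≥0 → Ω → ℝ≥0} {B : S2 → ℝ≥0 → Ω → S2} {T : S2 → Ω → ℝ}

theorem measurable_integral_field {κ : Kernel S2 S2} [IsMarkovKernel κ]
    (hT : Measurable (Function.uncurry T)) :
    Measurable fun p : S2 × Ω => ∫ y, T y p.2 ∂κ p.1 := by
  have h : StronglyMeasurable fun q : (S2 × Ω) × S2 => T q.2 q.1.2 :=
    (hT.comp (measurable_snd.prodMk (measurable_snd.comp measurable_fst))).stronglyMeasurable
  exact (h.integral_kernel_prod_right' (κ := κ.comap Prod.fst measurable_fst)).measurable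

theorem measurable_coeff_field (hT : Measurable (Function.uncurry T)) (l : ℕ) (m : ℤ) :
    Measurable fun ω => coeff (fun x => T x ω) l m := by
  have h : Measurable fun p : S2 × Ω =>
      (T p.1 p.2 : ℂ) * (starRingEnd ℂ) (sphHarm l m p.1) :=
    (Complex.measurable_ofReal.comp hT).mul
      ((Complex.continuous_conj.comp (continuous_sphHarm l m)).measurable.comp measurable_fst)
  exact (h.stronglyMeasurable.integral_prod_left' (μ := lam)).measurable

theorem measurable_component_field (hT : Measurable (Function.uncurry T)) (l : ℕ) :
    Measurable fun p : S2 × Ω => component (fun x => T x p.2) l p.1 := by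
  unfold component
  exact Finset.measurable_fun_sum _ fun m _ => ((measurable_coeff_field hT l m).comp measurable_snd).mul
    ((continuous_sphHarm l m).measurable.comp measurable_fst)

theorem measurable_evolve_field (hB : ∀ x, IsSphereBM P (B x) x) (hD : IsSubordinator P M D)
    (hT : Measurable (Function.uncurry T)) (t : ℝ≥0) :
    Measurable fun p : S2 × Ω => evolve P D t (fun y => T y p.2) p.1 := by
  have hmarkov : IsMarkovKernel transKer := isMarkovKernel_transKer hB
  have := Measure.isProbabilityMeasure_map (μ := P) (hD.measurable t).aemeasurable
  have := isMarkovKernel_subKer (P.map (D t))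
  exact measurable_integral_field hT

theorem tendsto_lintegral_truncError (hB : ∀ x, IsSphereBM P (B x) x) (hD : IsSubordinator P M D)
    (hT : Measurable (Function.uncurry T)) {C : ℝ≥0∞} (hCt : C < ∞)
    (hC : ∀ x, ∫⁻ ω, ‖T x ω‖ₑ ^ 2 ∂P = C) (t : ℝ≥0) :
    Tendsto (fun N => ∫⁻ ω, truncError P M D t N (fun x => T x ω) ∂P) atTop (𝓝 0) := by
  have hpath : ∀ ω, Measurable fun x => T x ω := fun ω => hT.comp measurable_prodMk_right
  have hfin : ∫⁻ ω, ∫⁻ x, ‖T x ω‖ₑ ^ 2 ∂lam ∂P ≠ ∞ := by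
    have h1 := lintegral_enorm_sq_prod (ν := lam) hT hC
    rw [lintegral_prod_symm _ (by fun_prop)] at h1
    exact (h1.trans_lt (ENNReal.mul_lt_top hCt (measure_lt_top _ _))).ne
  have hmeas : ∀ N, Measurable fun ω => truncError P M D t N fun x => T x ω := fun N => by
    have h2 : Measurable fun p : Ω × S2 => ‖(evolve P D t (fun y => T y p.1) p.2 : ℂ) -
        ∑ l ∈ Finset.range N, (Real.exp (-(t : ℝ) * laplaceExp M (eigMu l)) : ℂ)
          * component (fun y => T y p.1) l p.2‖ₑ ^ 2 := by
      refine (Measurable.enorm (Measurable.sub (Complex.measurable_ofReal.comp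
        ((measurable_evolve_field hB hD hT t).comp measurable_swap)) ?_)).pow_const 2
      exact Finset.measurable_fun_sum _ fun l _ =>
        ((measurable_component_field hT l).comp measurable_swap).const_mul _
    exact h2.lintegral_prod_right'
  have hae := ae_memLp_path (ν := lam) hT hCt hC
  have := tendsto_lintegral_of_dominated_convergence (μ := P)
    (F := fun N ω => truncError P M D t N fun x => T x ω) (f := fun _ => 0)
    (fun ω => ∫⁻ x, ‖T x ω‖ₑ ^ 2 ∂lam) hmeas
    (fun N => by filter_upwards [hae] with ω hω using truncError_le hB hD (hpath ω) hω t N) hfin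
    (by filter_upwards [hae] with ω hω using tendsto_truncError hB hD (hpath ω) hω t)
  simpa using this

end Field

section CondExp

/-- Evaluating a square integrable field at an independent random point. -/
theorem condExp_field {Ω : Type*} {m : MeasurableSpace Ω} [mΩ : MeasurableSpace Ω] {P : Measure Ω}
    [IsProbabilityMeasure P] {T : S2 → Ω → ℝ} (hm : m ≤ mΩ)
    (hT : Measurable[(inferInstance : MeasurableSpace S2).prod m] (Function.uncurry T))
    {C : ℝ≥0∞} (hCt : C < ∞) (hC : ∀ x, ∫⁻ ω, ‖T x ω‖ₑ ^ 2 ∂P = C) {Y : Ω → S2}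
    (hY : Measurable Y) (hind : Indep (MeasurableSpace.comap Y inferInstance) m P) :
    Integrable (fun ω => T (Y ω) ω) P ∧
      (fun ω => ∫ y, T y ω ∂(P.map Y)) =ᵐ[P] P[fun ω => T (Y ω) ω | m] := by
  have hZ : @Measurable Ω Ω mΩ m id := measurable_id'' hm
  have hYZ : @IndepFun Ω S2 Ω mΩ _ m Y id P := indepFun_id_of_indep mΩ m hind
  have hT' : Measurable (Function.uncurry T) := by
    refine hT.mono ?_ le_rfl
    exact sup_le_sup le_rfl (MeasurableSpace.comap_mono hm)
  have := Measure.isProbabilityMeasure_map (μ := P) hY.aemeasurable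
  have hYm : Measurable fun ω => T (Y ω) ω := hT'.comp (hY.prodMk measurable_id)
  have hint : Integrable (fun ω => T (Y ω) ω) P := by
    refine MemLp.integrable (q := 2) (by norm_num) ?_
    refine (memLp_two_iff_integrable_sq hYm.aestronglyMeasurable).2
      ⟨(hYm.pow_const 2).aestronglyMeasurable, ?_⟩
    have h1 := @lintegral_comp_of_indepFun Ω Ω S2 mΩ m _ P _ Y id hY hZ hYZ
      (fun p => ‖Function.uncurry T p‖ₑ ^ 2)
      ((by fun_prop : Measurable fun r : ℝ => ‖r‖ₑ ^ 2).comp hT)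
    simp only [HasFiniteIntegral, enorm_pow]
    refine lt_of_eq_of_lt h1 ?_
    simp [Function.uncurry, hC, hCt]
  refine ⟨hint, ?_⟩
  have h2 := @condExp_comp_of_indepFun Ω Ω S2 mΩ m _ P _ Y id hY hZ hYZ (Function.uncurry T) hT hint
  rwa [MeasurableSpace.comap_id] at h2

end CondExp

end SphereField

end

/-! ### The main theorem. -/

open SphereField in
theorem theorem3 {Ω : Type*} (𝓔 : MeasurableSpace Ω) [mΩ : MeasurableSpace Ω]
    (P : Measure Ω) [IsProbabilityMeasure P]
    -- the Lévy measure, the subordinator and the rotational Brownian motions started from each point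
    (M : Measure ℝ) (hM : IsSubLevyMeasure M)
    (D : ℝ≥0 → Ω → ℝ≥0) (hD : IsSubordinator P M D)
    (B : S2 → ℝ≥0 → Ω → S2) (hB : ∀ x, IsSphereBM P (B x) x)
    -- the random field, jointly measurable for the σ-algebra `𝓔`, which is
    -- independent of the subordinate motion
    (T : S2 → Ω → ℝ) (hT : IsIsotropicGaussianField P T)
    (h𝓔 : 𝓔 ≤ mΩ)
    (hTmeas : Measurable[(inferInstance : MeasurableSpace S2).prod 𝓔]
      (fun p : S2 × Ω => T p.1 p.2))
    (hBD : ∀ x, Indep (sigmaOf (B x)) (sigmaOf D) P)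
    (hTBD : ∀ x, Indep 𝓔 (sigmaOf (B x) ⊔ sigmaOf D) P) :
    ∃ η : ℝ≥0 → S2 → Ω → ℝ,
      -- `η` is a Gaussian random field, equal to `T` at time zero
      (∀ t, Measurable[(inferInstance : MeasurableSpace S2).prod mΩ] fun p : S2 × Ω => η t p.1 p.2) ∧
      IsGaussianProcess (fun (p : ℝ≥0 × S2) => η p.1 p.2) P ∧
      (∀ x, η 0 x =ᵐ[P] T x) ∧
      -- almost surely, `η` is the unique solution of the Cauchy problem
      (∀ᵐ ω ∂P, ∃ u : ℝ≥0 → Lp ℝ 2 lam,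
        IsCauchySolution M (fun x => T x ω) u ∧
        (∀ v, IsCauchySolution M (fun x => T x ω) v → v = u) ∧
        ∀ t, u t =ᵐ[lam] fun x => η t x ω) ∧
      -- the Fourier coefficients of `η`
      (∀ᵐ ω ∂P, ∀ (t : ℝ≥0) (l : ℕ) (m : ℤ), |m| ≤ l →
        coeff (fun x => η t x ω) l m
          = Real.exp (-(t : ℝ) * laplaceExp M (eigMu l)) * coeff (fun x => T x ω) l m) ∧
      -- the series expansion, in mean square with respect to `dP ⊗ λ`
      (∀ t : ℝ≥0, Tendsto
        (fun L : ℕ => ∫⁻ ω, ∫⁻ x,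
          ‖(η t x ω : ℂ) - ∑ l ∈ Finset.range (L + 1),
            (Real.exp (-(t : ℝ) * laplaceExp M (eigMu l)) : ℂ)
              * component (fun y => T y ω) l x‖ₑ ^ 2 ∂lam ∂P)
        atTop (𝓝 0)) ∧
      -- the transition operator of the subordinate motion, applied to `T`
      (∀ (t : ℝ≥0) (x : S2), ∀ᵐ ω ∂P,
        Integrable (fun ω' => T (B x (D t ω') ω') ω) P ∧
        η t x ω = ∫ ω', T (B x (D t ω') ω') ω ∂P) ∧
      -- the conditional expectation given the field
      (∀ (t : ℝ≥0) (x : S2),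
        Integrable (fun ω => T (B x (D t ω) ω) ω) P ∧
        η t x =ᵐ[P] P[fun ω => T (B x (D t ω) ω) ω | sigmaOf T]) := by
  have hmarkov : IsMarkovKernel transKer := isMarkovKernel_transKer hB
  have hprob : ∀ t, IsProbabilityMeasure (P.map (D t)) := fun t =>
    Measure.isProbabilityMeasure_map (hD.measurable t).aemeasurable
  have hker : ∀ t, IsMarkovKernel (subKer (P.map (D t))) := fun t => isMarkovKernel_subKer _
  have hTm : Measurable (Function.uncurry T) :=
    hTmeas.mono (sup_le_sup le_rfl (MeasurableSpace.comap_mono h𝓔)) le_rfl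
  have hTx : ∀ x, Measurable[𝓔] (T x) := fun x =>
    hTmeas.comp (@measurable_prodMk_left S2 Ω _ 𝓔 x)
  have hT𝓔 : sigmaOf T ≤ 𝓔 := iSup_le fun x => (hTx x).comap_le
  have hTσ : ∀ x, Measurable[sigmaOf T] (T x) := fun x =>
    (comap_measurable (T x)).mono (le_iSup (fun x => MeasurableSpace.comap (T x) inferInstance) x) le_rfl
  have hpath : ∀ ω, Measurable fun x => T x ω := fun ω => hTm.comp measurable_prodMk_right
  obtain ⟨C, hCt, hC⟩ := hT.exists_lintegral_enorm_sq_eq fun x => (hTx x).mono h𝓔 le_rfl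
  have hspan : ∀ (t : ℝ≥0) (x : S2), ∃ u ∈ closedSpan hT.memLp,
      u =ᵐ[P] fun ω => evolve P D t (fun y => T y ω) x := fun t x =>
    exists_mem_closedSpan_average (ν := subKer (P.map (D t)) x) hTm hCt hC hT.memLp
  have hae : ∀ᵐ ω ∂P, MemLp (fun x => T x ω) 2 lam := ae_memLp_path hTm hCt hC
  have hY : ∀ t x, Measurable fun ω => B x (D t ω) ω := fun t x =>
    (hB x).measurable_comp (hD.measurable t)
  have hlaw : ∀ t x, P.map (fun ω => B x (D t ω) ω) = subKer (P.map (D t)) x := fun t x =>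
    (hB x).map_comp_eq_subKer (hD.measurable t) (indep_of_indep_of_le_right (hBD x)
      (le_iSup (fun t => MeasurableSpace.comap (D t) inferInstance) t))
  -- With this version of `η` the only exceptional event for the Cauchy problem and the coefficients
  -- is that the path of `T` is not in `L²(λ)`, hence one null set for all `t`, `l`, `m`.
  refine ⟨fun t x ω => evolve P D t (fun y => T y ω) x, measurable_evolve_field hB hD hTm,
    isGaussianProcess_of_mem_closedSpan hT.memLp hT.gaussian hT.mean_zero fun p => hspan p.1 p.2,
    fun x => Eventually.of_forall fun ω => evolve_zero hB hD _ x, ?_, ?_, fun t => ?_,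
    fun t x => ?_, fun t x => ?_⟩
  · filter_upwards [hae] with ω hω using exists_isCauchySolution hB hM hD (hpath ω) hω
  · filter_upwards [hae] with ω hω t l m hm using coeff_evolve hB hD (hpath ω) hω t hm
  -- `truncError` at `N` sums over `l < N`, while the partial sum up to `L` has `L + 1` terms.
  · exact (tendsto_add_atTop_iff_nat 1).2 (tendsto_lintegral_truncError hB hD hTm hCt hC t)
  -- Integrability is required under the law of `B^x_{D_t}`, which may have an atom at `x` and so is
  -- not controlled by `L²(λ)`. The null set depends on `(t, x)`.
  · filter_upwards [ae_memLp_path (ν := subKer (P.map (D t)) x) hTm hCt hC] with ω hω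
    have h1 := hω.integrable (by norm_num)
    rw [← hlaw, integrable_map_measure (hpath ω).aestronglyMeasurable (hY t x).aemeasurable] at h1
    refine ⟨h1, ?_⟩
    rw [evolve, ← hlaw, integral_map (hY t x).aemeasurable (hpath ω).aestronglyMeasurable]
  -- The point `B^x_{D_t}` is measurable for `σ(B^x) ∨ σ(D)`, which is independent of `𝓔`.
  · have hind : Indep (MeasurableSpace.comap (fun ω => B x (D t ω) ω) inferInstance) 𝓔 P := by
      refine (indep_of_indep_of_le_right (hTBD x) ?_).symm
      have hD' : Measurable[sigmaOf (B x) ⊔ sigmaOf D] (D t) := (comap_measurable (D t)).mono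
        ((le_iSup (fun t => MeasurableSpace.comap (D t) inferInstance) t).trans le_sup_right) le_rfl
      have hid : @Measurable Ω Ω (sigmaOf (B x) ⊔ sigmaOf D) (sigmaOf (B x)) id :=
        measurable_id'' le_sup_left
      have hDid : @Measurable Ω (ℝ≥0 × Ω) (sigmaOf (B x) ⊔ sigmaOf D)
          ((inferInstance : MeasurableSpace ℝ≥0).prod (sigmaOf (B x))) (fun ω => (D t ω, ω)) :=
        hD'.prodMk hid
      exact ((measurable_uncurry_sigmaOf (hB x).continuous).comp hDid).comap_le
    obtain ⟨h1, h2⟩ := condExp_field h𝓔 hTmeas hCt hC (hY t x) hind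
    rw [hlaw] at h2
    refine ⟨h1, ?_⟩
    obtain ⟨u, hu, hu'⟩ := hspan t x
    have h3 : AEStronglyMeasurable[sigmaOf T] (fun ω => evolve P D t (fun y => T y ω) x) P :=
      (aestronglyMeasurable_of_mem_closedSpan hT.memLp (hT𝓔.trans h𝓔) hTσ hu).congr hu'
    have h4 : Integrable (fun ω => evolve P D t (fun y => T y ω) x) P :=
      ((Lp.memLp u).integrable (by norm_num)).congr hu'
    -- Tower property: freezing has identified the conditional expectation given `𝓔` with `η t x`,
    -- and conditioning further on `σ(T)` leaves it unchanged.
    exact ((condExp_condExp_of_le hT𝓔 h𝓔).symm.trans ((condExp_congr_ae h2.symm).trans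
      (condExp_of_aestronglyMeasurable' (hT𝓔.trans h𝓔) h3 h4))).symm
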